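/- Let $d \ge 1$ and let $\Sigma = \prod_{i=1}^d \Sigma_i$, where each $\Sigma_i$ is either $\mathbb{R}$ or a circle $L_i\mathbb{T} = \mathbb{R}/L_i\mathbb{Z}$ with $L_i > 0$, and assume that either $\Sigma_1 = \mathbb{R}$ or all the $\Sigma_i$ are circles. Let $\hat\Sigma = \prod_{i=1}^d \hat\Sigma_i \subseteq \mathbb{R}^d$ be the dual group, where $\hat\Sigma_i = \mathbb{R}$ (with Lebesgue measure) if $\Sigma_i = \mathbb{R}$ and $\hat\Sigma_i = L_i^{-1}\mathbb{Z}$ (with counting measure) if $\Sigma_i = L_i\mathbb{T}$. The Fourier transform $f \mapsto \hat f$ on the tempered distributions $\mathscr{S}'(\Sigma;\mathbb{C})$ is the one defined by duality from the unitary transform $\varphi \mapsto \big(\prod_{\Sigma_i = L_i\mathbb{T}} L_i\big)^{-1/2}\int_{\hat\Sigma}\varphi(\xi)e^{-2\pi i \xi\cdot x}\,d\xi$ of Schwartz functions on $\hat\Sigma$. Put $\langle\xi\rangle = (1+|\xi|^2)^{1/2}$ and $$\mu(\xi) = \frac{|\xi_1|}{|\xi|} + |\xi| \quad (\xi \ne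 0), \qquad \mu(0) = 1.$$ For $s \ge 0$ let $$X^s(\Sigma;\mathbb{C}) = \{ f \in \mathscr{S}'(\Sigma;\mathbb{C}) : \hat f \in L^1_{\mathrm{loc}}(\hat\Sigma;\mathbb{C}),\ \|f\|_{X^s} < \infty\}, \qquad \|f\|_{X^s} = \big\|\mu\,\langle\cdot\rangle^{s-1}\hat f\,\big\|_{L^2(\hat\Sigma)},$$ and let $X^s(\Sigma;\mathbb{R}) = \{f \in X^s(\Sigma;\mathbb{C}) : f = \overline{f}\}$, with the same norm. Let $\mathbb{F} \in \{\mathbb{R},\mathbb{C}\}$ and $s > d/2$. Then $X^s(\Sigma;\mathbb{F})$ is an algebra under pointwise multiplication: every element of $X^s(\Sigma;\mathbb{F})$ is (the distribution given by) a bounded continuous function, and there is a constant $C > 0$, depending only on $\Sigma$ and $s$, such that for all $f, g \in X^s(\Sigma;\mathbb{F})$ the product $fg$ belongs to $X^s(\Sigma;\mathbb{F})$ and $\|fg\|_{X^s} \le C\,\|f\|_{X^s}\|g\|_{X^s}$. -/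

import Mathlib

open MeasureTheory
open scoped ContDiff BoundedContinuousFunction

noncomputable section

namespace Aniso

/-- A factor of a product domain: the line `ℝ`, or the circle `L𝕋 = ℝ / Lℤ` of length `L > 0`. -/
inductive Factor : Type
  | line : Factor
  | circle (L : ℝ) (hL : 0 < L) : Factor

namespace Factor

/-- The underlying space: `ℝ` or `ℝ / Lℤ`. -/
def Space : Factor → Type
  | line => ℝ
  | circle L _ => AddCircle L

/-- The dual group: `ℝ`, or `L⁻¹ℤ`, whose element `k / L` is labelled by `k : ℤ`. -/
def Dual : Factor → Type
  | line => ℝ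
  | circle _ _ => ℤ

instance (γ : Factor) : TopologicalSpace γ.Space :=
  match γ with
  | line => inferInstanceAs (TopologicalSpace ℝ)
  | circle L _ => inferInstanceAs (TopologicalSpace (AddCircle L))

instance (γ : Factor) : TopologicalSpace γ.Dual :=
  match γ with
  | line => inferInstanceAs (TopologicalSpace ℝ)
  | circle _ _ => inferInstanceAs (TopologicalSpace ℤ)

/-- Lebesgue measure; the circle `L𝕋` has total mass `L`. -/
instance (γ : Factor) : MeasureSpace γ.Space :=
  match γ with
  | line => inferInstanceAs (MeasureSpace ℝ)
  | circle L hL =>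
    haveI : Fact (0 < L) := ⟨hL⟩
    inferInstanceAs (MeasureSpace (AddCircle L))

/-- Lebesgue measure on `ℝ`, counting measure on `L⁻¹ℤ`. -/
instance (γ : Factor) : MeasureSpace γ.Dual :=
  match γ with
  | line => inferInstanceAs (MeasureSpace ℝ)
  | circle _ _ =>
    { (inferInstanceAs (MeasurableSpace ℤ) : MeasurableSpace ℤ) with
      volume := (Measure.count : Measure ℤ) }

/-- The canonical projection from `ℝ`. -/
def proj : (γ : Factor) → ℝ → γ.Space
  | line => fun x => x
  | circle L _ => fun x => (x : AddCircle L)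

/-- A real coordinate, replaced by `0` in a periodic direction. -/
def realCoord : Factor → ℝ → ℝ
  | line => fun x => x
  | circle _ _ => fun _ => 0

/-- The inclusion of the dual group in `ℝ`. -/
def freq : (γ : Factor) → γ.Dual → ℝ
  | line => fun ξ => ξ
  | circle L _ => fun (k : ℤ) => (k : ℝ) / L

/-- Translation of a frequency by a real number in a line direction; nothing moves in a
periodic direction. -/
def shift : (γ : Factor) → γ.Dual → ℝ → γ.Dual
  | line => fun (ξ : ℝ) (v : ℝ) => ξ + v
  | circle _ _ => fun k _ => k

/-- The character `exp (-2πi ξ x)`. -/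
def char : (γ : Factor) → γ.Dual → γ.Space → ℂ
  | line => fun (ξ : ℝ) (x : ℝ) => Complex.exp (-(2 * Real.pi * Complex.I * ξ * x))
  | circle L _ => fun (k : ℤ) (x : AddCircle L) => fourier (-k) x

/-- `1 / √L` on the circle of length `L`, and `1` on the line. -/
def normalization : Factor → ℝ
  | line => 1
  | circle L _ => 1 / Real.sqrt L

end Factor

variable {d : ℕ}

/-- The domain `Γ = ∏ Γ_i`. -/
abbrev Domain (Γ : Fin d → Factor) : Type := ∀ i, (Γ i).Space

/-- The dual group `∏ Γ̂_i`. -/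
abbrev DualDomain (Γ : Fin d → Factor) : Type := ∀ i, (Γ i).Dual

/-- The lift of a function on `Γ` to a function on `ℝ^d`. -/
def lift (Γ : Fin d → Factor) (f : Domain Γ → ℂ) : (Fin d → ℝ) → ℂ :=
  fun x => f (fun i => (Γ i).proj (x i))

/-- The quantity `|x_R|^k |D^n f (x)|`, where `x_R` collects the non-periodic coordinates. -/
def decay (Γ : Fin d → Factor) (k n : ℕ) (f : Domain Γ → ℂ) (x : Fin d → ℝ) : ℝ :=
  ‖(fun i => (Γ i).realCoord (x i) : Fin d → ℝ)‖ ^ k * ‖iteratedFDeriv ℝ n (lift Γ f) x‖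

lemma decay_nonneg (Γ : Fin d → Factor) (k n : ℕ) (f : Domain Γ → ℂ) (x : Fin d → ℝ) :
    0 ≤ decay Γ k n f x := by
  unfold decay; positivity

lemma decay_add_le (Γ : Fin d → Factor) (k n : ℕ) {f g : Domain Γ → ℂ}
    (hf : ContDiff ℝ ∞ (lift Γ f)) (hg : ContDiff ℝ ∞ (lift Γ g)) (x : Fin d → ℝ) :
    decay Γ k n (f + g) x ≤ decay Γ k n f x + decay Γ k n g x := by
  have h : lift Γ (f + g) = lift Γ f + lift Γ g := rfl
  have hn : ((n : ℕ∞) : WithTop ℕ∞) ≤ ∞ := by exact_mod_cast le_top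
  unfold decay
  rw [h, iteratedFDeriv_add_apply (hf.of_le hn).contDiffAt (hg.of_le hn).contDiffAt, ← mul_add]
  exact mul_le_mul_of_nonneg_left (norm_add_le _ _) (by positivity)

lemma decay_smul (Γ : Fin d → Factor) (k n : ℕ) (c : ℂ) {f : Domain Γ → ℂ}
    (hf : ContDiff ℝ ∞ (lift Γ f)) (x : Fin d → ℝ) :
    decay Γ k n (c • f) x = ‖c‖ * decay Γ k n f x := by
  have h : lift Γ (c • f) = c • lift Γ f := rfl
  have hn : ((n : ℕ∞) : WithTop ℕ∞) ≤ ∞ := by exact_mod_cast le_top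
  unfold decay
  rw [h, iteratedFDeriv_const_smul_apply (hf.of_le hn).contDiffAt, norm_smul]
  ring

/-- The Schwartz functions on `Γ`: smooth functions all of whose derivatives decay faster than
every power in the non-periodic directions. -/
def schwartzSubmodule (Γ : Fin d → Factor) : Submodule ℂ (Domain Γ → ℂ) where
  carrier := {f | ContDiff ℝ ∞ (lift Γ f) ∧ ∀ k n : ℕ, BddAbove (Set.range (decay Γ k n f))}
  zero_mem' := by
    refine ⟨contDiff_const (c := (0 : ℂ)), fun k n => ⟨0, ?_⟩⟩
    rintro _ ⟨x, rfl⟩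
    have h := decay_smul Γ k n 0 (f := 0) (contDiff_const (c := (0 : ℂ))) x
    simp at h
    exact h.le
  add_mem' := by
    rintro f g ⟨hf, hf'⟩ ⟨hg, hg'⟩
    refine ⟨hf.add hg, fun k n => ?_⟩
    obtain ⟨A, hA⟩ := hf' k n
    obtain ⟨B, hB⟩ := hg' k n
    refine ⟨A + B, ?_⟩
    rintro _ ⟨x, rfl⟩
    exact (decay_add_le Γ k n hf hg x).trans (add_le_add (hA ⟨x, rfl⟩) (hB ⟨x, rfl⟩))
  smul_mem' := by
    rintro c f ⟨hf, hf'⟩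
    refine ⟨contDiff_const.smul hf, fun k n => ?_⟩
    obtain ⟨A, hA⟩ := hf' k n
    refine ⟨‖c‖ * A, ?_⟩
    rintro _ ⟨x, rfl⟩
    rw [decay_smul Γ k n c hf x]
    exact mul_le_mul_of_nonneg_left (hA ⟨x, rfl⟩) (norm_nonneg _)

/-- The Schwartz space of `Γ`, a type of its own so that it does not carry the topology of pointwise
convergence. -/
def Schwartz (Γ : Fin d → Factor) : Type := schwartzSubmodule Γ

instance (Γ : Fin d → Factor) : AddCommGroup (Schwartz Γ) :=
  inferInstanceAs (AddCommGroup (schwartzSubmodule Γ))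

instance (Γ : Fin d → Factor) : Module ℂ (Schwartz Γ) :=
  inferInstanceAs (Module ℂ (schwartzSubmodule Γ))

/-- The Schwartz seminorms `sup_x |x_R|^k |D^n f (x)|`. -/
def schwartzSeminorm (Γ : Fin d → Factor) : SeminormFamily ℂ (Schwartz Γ) (ℕ × ℕ) := fun m =>
  Seminorm.of (fun f => ⨆ x, decay Γ m.1 m.2 f.1 x)
    (fun f g => by
      refine ciSup_le fun x => (decay_add_le Γ m.1 m.2 f.2.1 g.2.1 x).trans ?_
      exact add_le_add (le_ciSup (f.2.2 m.1 m.2) x) (le_ciSup (g.2.2 m.1 m.2) x))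
    (fun c f => by
      rw [Real.mul_iSup_of_nonneg (norm_nonneg c)]
      exact congrArg iSup (funext fun x => decay_smul Γ m.1 m.2 c f.2.1 x))

/-- The Fréchet topology of the Schwartz seminorms. -/
instance (Γ : Fin d → Factor) : TopologicalSpace (Schwartz Γ) :=
  (schwartzSeminorm Γ).moduleFilterBasis.topology

/-- Tempered distributions on `Γ`: continuous linear functionals on the Schwartz space. -/
abbrev Distribution (Γ : Fin d → Factor) : Type := Schwartz Γ →L[ℂ] ℂ

/-- The complex conjugate of a Schwartz function. -/
def conjSchwartz {Γ : Fin d → Factor} (f : Schwartz Γ) : Schwartz Γ :=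
  ⟨fun x => starRingEnd ℂ (f.1 x), by
    have h : lift Γ (fun x => starRingEnd ℂ (f.1 x)) = Complex.conjLIE ∘ lift Γ f.1 := rfl
    refine ⟨?_, fun k n => ?_⟩
    · rw [h]
      exact Complex.conjLIE.toContinuousLinearEquiv.contDiff.comp f.2.1
    · have h2 : decay Γ k n (fun x => starRingEnd ℂ (f.1 x)) = decay Γ k n f.1 := by
        funext x
        unfold decay
        rw [h, LinearIsometryEquiv.norm_iteratedFDeriv_comp_left]
      rw [h2]
      exact f.2.2 k n⟩

/-- `T = T̄`, where `⟨T̄, φ⟩` is the conjugate of `⟨T, φ̄⟩`. -/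
def IsReal {Γ : Fin d → Factor} (T : Distribution Γ) : Prop :=
  ∀ φ : Schwartz Γ, T φ = starRingEnd ℂ (T (conjSchwartz φ))

/-- The distribution `T` is the function `f`. -/
def Represents {Γ : Fin d → Factor} (T : Distribution Γ) (f : Domain Γ → ℂ) : Prop :=
  ∀ φ : Schwartz Γ, Integrable (fun x => f x * φ.1 x) ∧ T φ = ∫ x, f x * φ.1 x

/-- The frequency `ξ` as a vector of `ℝ^d`. -/
def freqVec {Γ : Fin d → Factor} (ξ : DualDomain Γ) : EuclideanSpace ℝ (Fin d) :=
  WithLp.toLp 2 (fun i => (Γ i).freq (ξ i))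

/-- Near `ξ`, a function on the dual group as a function of the non-periodic coordinates. -/
def slice {Γ : Fin d → Factor} (φ : DualDomain Γ → ℂ) (ξ : DualDomain Γ) : (Fin d → ℝ) → ℂ :=
  fun v => φ (fun i => (Γ i).shift (ξ i) (v i))

/-- The Schwartz class of the dual group: smooth in the non-periodic directions, with
`sup_ξ |ξ|^k |D^n φ (ξ)| < ∞` for the derivatives in these directions. -/
def IsDualSchwartz {Γ : Fin d → Factor} (φ : DualDomain Γ → ℂ) : Prop :=
  (∀ ξ, ContDiff ℝ ∞ (slice φ ξ)) ∧
    ∀ k n : ℕ, ∃ C : ℝ, ∀ ξ, ‖freqVec ξ‖ ^ k * ‖iteratedFDeriv ℝ n (slice φ ξ) 0‖ ≤ C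

/-- The unitary Fourier transform of a function on the dual group:
`(∏ L_i)^(-1/2) ∫ φ(ξ) exp (-2πi ξ·x) dξ`. -/
def dualFourier {Γ : Fin d → Factor} (φ : DualDomain Γ → ℂ) (x : Domain Γ) : ℂ :=
  ((∏ i, (Γ i).normalization : ℝ) : ℂ) * ∫ ξ : DualDomain Γ, φ ξ * ∏ i, (Γ i).char (ξ i) (x i)

/-- The Fourier transform of the distribution `T`, defined by `⟨T̂, φ⟩ = ⟨T, φ̂⟩` for Schwartz `φ`
on the dual group, is the locally integrable function `F`. The Fourier transform `φ̂` is a Schwartz function on `Γ`;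
it appears below as the element `ψ` of the Schwartz space. -/
structure HasFourier {Γ : Fin d → Factor} (T : Distribution Γ) (F : DualDomain Γ → ℂ) : Prop where
  locallyIntegrable : LocallyIntegrable F
  integrable : ∀ φ : DualDomain Γ → ℂ, IsDualSchwartz φ → Integrable (fun ξ => F ξ * φ ξ)
  pairing : ∀ φ : DualDomain Γ → ℂ, IsDualSchwartz φ →
    ∀ ψ : Schwartz Γ, ψ.1 = dualFourier φ → T ψ = ∫ ξ, F ξ * φ ξ

open Classical in
/-- The function `T̂` (unique up to null sets), when the Fourier transform of `T` is a locally
integrable function. -/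
def fourierFun {Γ : Fin d → Factor} (T : Distribution Γ) : DualDomain Γ → ℂ :=
  if h : ∃ F, HasFourier T F then h.choose else 0

/-- The multiplier `|ξ₁|/|ξ| + |ξ|`, with value `1` at `ξ = 0`. -/
def multiplier [NeZero d] (ξ : EuclideanSpace ℝ (Fin d)) : ℝ :=
  if ξ = 0 then 1 else |ξ 0| / ‖ξ‖ + ‖ξ‖

/-- The weight `(|ξ₁|/|ξ| + |ξ|) ⟨ξ⟩^(s-1)`, where `⟨ξ⟩ = (1 + |ξ|²)^(1/2)`. -/
def weight [NeZero d] (s : ℝ) (ξ : EuclideanSpace ℝ (Fin d)) : ℝ :=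
  multiplier ξ * Real.sqrt (1 + ‖ξ‖ ^ 2) ^ (s - 1)

/-- A function on the dual group times the weight. -/
def weighted [NeZero d] {Γ : Fin d → Factor} (s : ℝ) (F : DualDomain Γ → ℂ) :
    DualDomain Γ → ℂ :=
  fun ξ => (weight s (freqVec ξ) : ℂ) * F ξ

/-- The anisotropic Sobolev space of complex-valued distributions. -/
def XsComplex [NeZero d] (Γ : Fin d → Factor) (s : ℝ) : Submodule ℂ (Distribution Γ) where
  carrier := {T | ∃ F, HasFourier T F ∧ MemLp (weighted s F) 2}
  zero_mem' := by
    refine ⟨0, ⟨locallyIntegrable_zero, fun φ _ => ?_, fun φ _ ψ _ => ?_⟩, ?_⟩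
    · simp
    · simp
    · have : weighted s (0 : DualDomain Γ → ℂ) = 0 := by funext ξ; simp [weighted]
      rw [this]
      exact MemLp.zero
  add_mem' := by
    rintro T U ⟨F, hF, hF2⟩ ⟨G, hG, hG2⟩
    have e : ∀ φ : DualDomain Γ → ℂ,
        (fun ξ => (F + G) ξ * φ ξ) = fun ξ => F ξ * φ ξ + G ξ * φ ξ := fun φ => by
      funext ξ; simp [add_mul]
    refine ⟨F + G, ⟨hF.1.add hG.1, fun φ hφ => ?_, fun φ hφ ψ hψ => ?_⟩, ?_⟩
    · rw [e]
      exact (hF.2 φ hφ).add (hG.2 φ hφ)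
    · rw [e, integral_add (hF.2 φ hφ) (hG.2 φ hφ), ← hF.3 φ hφ ψ hψ, ← hG.3 φ hφ ψ hψ]
      rfl
    · have : weighted s (F + G) = weighted s F + weighted s G := by
        funext ξ; simp [weighted, mul_add]
      rw [this]
      exact hF2.add hG2
  smul_mem' := by
    rintro c T ⟨F, hF, hF2⟩
    have e : ∀ φ : DualDomain Γ → ℂ,
        (fun ξ => (c • F) ξ * φ ξ) = fun ξ => c * (F ξ * φ ξ) := fun φ => by
      funext ξ; simp [mul_assoc]
    refine ⟨c • F, ⟨hF.1.smul c, fun φ hφ => ?_, fun φ hφ ψ hψ => ?_⟩, ?_⟩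
    · rw [e]
      exact (hF.2 φ hφ).const_mul c
    · rw [e, integral_const_mul, ← hF.3 φ hφ ψ hψ]
      rfl
    · have : weighted s (c • F) = c • weighted s F := by
        funext ξ; simp [weighted, mul_left_comm]
      rw [this]
      exact hF2.const_smul c

/-- The anisotropic Sobolev space of real-valued distributions. -/
def XsReal [NeZero d] (Γ : Fin d → Factor) (s : ℝ) : Submodule ℝ (Distribution Γ) where
  carrier := {T | T ∈ XsComplex Γ s ∧ IsReal T}
  zero_mem' := ⟨zero_mem _, fun φ => by simp⟩
  add_mem' := by
    rintro T U ⟨hT, hT'⟩ ⟨hU, hU'⟩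
    refine ⟨add_mem hT hU, fun φ => ?_⟩
    simp only [add_apply, map_add]
    rw [← hT' φ, ← hU' φ]
  smul_mem' := by
    rintro c T ⟨hT, hT'⟩
    refine ⟨?_, fun φ => ?_⟩
    · have : c • T = (c : ℂ) • T := by ext φ; simp
      rw [this]
      exact Submodule.smul_mem _ _ hT
    · simp only [smul_apply, Complex.real_smul, map_mul, Complex.conj_ofReal]
      rw [← hT' φ]

/-- The norm `‖(|ξ₁|/|ξ| + |ξ|) ⟨ξ⟩^(s-1) T̂‖_{L²}`. -/
def xsNorm [NeZero d] {Γ : Fin d → Factor} (s : ℝ) (T : Distribution Γ) : ℝ :=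
  (eLpNorm (weighted s (fourierFun T)) 2 volume).toReal

/-- The space `X` of distributions, with the above norm, is an algebra under pointwise
multiplication: its elements are bounded continuous functions, and products of these stay in `X`
with a bound for the norm. -/
def IsPointwiseAlgebra [NeZero d] {Γ : Fin d → Factor} (s : ℝ) (X : Set (Distribution Γ)) :
    Prop :=
  (∀ T ∈ X, ∃ f : Domain Γ →ᵇ ℂ, Represents T f) ∧
  ∃ C : ℝ, 0 < C ∧ ∀ T₁ ∈ X, ∀ T₂ ∈ X, ∀ f₁ f₂ : Domain Γ →ᵇ ℂ,
    Represents T₁ f₁ → Represents T₂ f₂ →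
      ∃ T ∈ X, Represents T (f₁ * f₂) ∧ xsNorm s T ≤ C * xsNorm s T₁ * xsNorm s T₂

/-- Admissible cross sections: the first factor is `ℝ`, or all factors are circles. -/
def Admissible [NeZero d] (Γ : Fin d → Factor) : Prop :=
  Γ 0 = Factor.line ∨ ∀ i, Γ i ≠ Factor.line

end Aniso

end

/-! On the Fourier side the space consists of the `F` with `W F ∈ L²`, where `W = μ⟨·⟩^(s-1)`, and
pointwise products become convolutions. Two facts about the weight carry the theorem
(`dualWeight_bounds`). First, `1/W ∈ L²`, so Cauchy–Schwarz gives `F ∈ L¹` and the distribution is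
the bounded continuous function `synthesis F`. Second, a substitute for subadditivity holds: `W(ξ) ≤
C (W(ξ-η) + W(η) + W(ξ-η) W(η) (κ(ξ,ξ-η) + κ(ξ,η)))` for a.e. `ξ` and all `η`, with `∫ κ(ξ,η)² dξ`
bounded uniformly in `η`. The first two terms are treated as for Sobolev spaces, using `1/W ∈ L²`;
the kernel terms by grouping the factors differently in Cauchy–Schwarz
(`lintegral_weighted_conv_sq_le`).

At high frequency `W` is comparable to `⟨ξ⟩^s`, so the only difficulty is near `ξ = 0`. If no factor
other than the first is a line, small nonzero frequencies lie on the first axis, where `|ξ₁|/|ξ| =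
1`; then `W` is comparable to `⟨ξ⟩^s` everywhere and `κ = 0` works. Otherwise some `Σ_j` with `j ≠
1` is a line, admissibility makes the first factor a line too, and `d ≥ 2` gives `s > 1`. Now `μ² ≥
|ξ₁|` and `μ ≥ |ξ_j|` make `1/μ²` integrable near `0`. For the second fact let `ξ = x + y` be small
with `|x₁| ≤ |y₁|`. If `|y| ≤ 2|ξ|`, then `|ξ₁|/|ξ|` is bounded by `4μ(y)`. If not, `|x| ≥ |y|/2`,
hence `μ(x)μ(y) ≥ |y₁|/2`, and the loss is `|ξ₁|/(|ξ||y₁|)` on `|ξ₁| ≤ 2|y₁|`; this is `lowKernel`.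
Its square has bounded integral because `∫ |ξ₁|/(ξ₁²+ξ_j²) dξ_j` does not depend on `ξ₁ ≠ 0`, and
what remains is of size `1/|y₁|` on an interval of length `4|y₁|`
(`exists_lintegral_lowKernel_sq_le`).

The rest links this to distributions on a mixed product of lines and circles. Characters separate
points, hence determine finite measures, so the Fourier transform is injective on `L¹`
(`ae_eq_zero_of_integral_mul_eq_zero`). Tensor products of explicit one-dimensional transform pairs
then yield inversion for Schwartz functions (`dualFourier_spaceFourier`), uniqueness of `T̂`
(`HasFourier.ae_eq`), and the passage between `HasFourier T F` and `Represents T (synthesis F)` for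
integrable `F`. -/

noncomputable section

namespace Aniso

/-! ### One factor: group structure, Haar measures and characters. -/

namespace Factor

instance (γ : Factor) : AddCommGroup γ.Space :=
  match γ with
  | line => inferInstanceAs (AddCommGroup ℝ)
  | circle L _ => inferInstanceAs (AddCommGroup (AddCircle L))

instance (γ : Factor) : AddCommGroup γ.Dual :=
  match γ with
  | line => inferInstanceAs (AddCommGroup ℝ)
  | circle _ _ => inferInstanceAs (AddCommGroup ℤ)

instance (γ : Factor) : IsTopologicalAddGroup γ.Space :=
  match γ with
  | line => inferInstanceAs (IsTopologicalAddGroup ℝ)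
  | circle L _ => inferInstanceAs (IsTopologicalAddGroup (AddCircle L))

instance (γ : Factor) : IsTopologicalAddGroup γ.Dual :=
  match γ with
  | line => inferInstanceAs (IsTopologicalAddGroup ℝ)
  | circle _ _ => inferInstanceAs (IsTopologicalAddGroup ℤ)

instance (γ : Factor) : PolishSpace γ.Space :=
  match γ with
  | line => inferInstanceAs (PolishSpace ℝ)
  | circle L hL =>
    haveI : Fact (0 < L) := ⟨hL⟩
    inferInstanceAs (PolishSpace (AddCircle L))

instance (γ : Factor) : PolishSpace γ.Dual :=
  match γ with
  | line => inferInstanceAs (PolishSpace ℝ)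
  | circle _ _ => inferInstanceAs (PolishSpace ℤ)

instance (γ : Factor) : BorelSpace γ.Space :=
  match γ with
  | line => inferInstanceAs (BorelSpace ℝ)
  | circle L hL =>
    haveI : Fact (0 < L) := ⟨hL⟩
    inferInstanceAs (BorelSpace (AddCircle L))

instance (γ : Factor) : BorelSpace γ.Dual :=
  match γ with
  | line => inferInstanceAs (BorelSpace ℝ)
  | circle _ _ => inferInstanceAs (BorelSpace ℤ)

instance (γ : Factor) : (volume : Measure γ.Space).IsAddHaarMeasure :=
  match γ with
  | line => inferInstanceAs (volume : Measure ℝ).IsAddHaarMeasure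
  | circle L hL =>
    haveI : Fact (0 < L) := ⟨hL⟩
    inferInstanceAs (volume : Measure (AddCircle L)).IsAddHaarMeasure

lemma isAddHaarMeasure_count_int : (Measure.count : Measure ℤ).IsAddHaarMeasure where
  lt_top_of_isCompact _ hK := Measure.count_apply_lt_top.2 (isCompact_iff_finite.1 hK)
  open_pos _ _ hU := Measure.count_ne_zero hU

instance (γ : Factor) : (volume : Measure γ.Dual).IsAddHaarMeasure :=
  match γ with
  | line => inferInstanceAs (volume : Measure ℝ).IsAddHaarMeasure
  | circle _ _ => isAddHaarMeasure_count_int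

instance (γ : Factor) : SigmaFinite (volume : Measure γ.Space) :=
  match γ with
  | line => inferInstanceAs (SigmaFinite (volume : Measure ℝ))
  | circle L hL =>
    haveI : Fact (0 < L) := ⟨hL⟩
    inferInstanceAs (SigmaFinite (volume : Measure (AddCircle L)))

instance (γ : Factor) : SigmaFinite (volume : Measure γ.Dual) :=
  match γ with
  | line => inferInstanceAs (SigmaFinite (volume : Measure ℝ))
  | circle _ _ => inferInstanceAs (SigmaFinite (Measure.count : Measure ℤ))

/-- The real coordinate of a point, `0` on a circle. -/
def coord : (γ : Factor) → γ.Space →+ ℝ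
  | line => AddMonoidHom.id ℝ
  | circle _ _ => 0

/-- The real coordinate of a frequency, `0` in a periodic direction. -/
def dualCoord : (γ : Factor) → γ.Dual →+ ℝ
  | line => AddMonoidHom.id ℝ
  | circle _ _ => 0

lemma continuous_dualCoord (γ : Factor) : Continuous γ.dualCoord :=
  match γ with
  | line => continuous_id (X := ℝ)
  | circle _ _ => continuous_const

lemma continuous_proj (γ : Factor) : Continuous γ.proj :=
  match γ with
  | line => continuous_id (X := ℝ)
  | circle L _ => AddCircle.continuous_mk' L

lemma continuous_freq (γ : Factor) : Continuous γ.freq :=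
  match γ with
  | line => continuous_id (X := ℝ)
  | circle _ _ => continuous_of_discreteTopology (α := ℤ)

lemma proj_add (γ : Factor) (s t : ℝ) : γ.proj (s + t) = γ.proj s + γ.proj t :=
  match γ with
  | line => rfl
  | circle _ _ => rfl

lemma proj_zero (γ : Factor) : γ.proj 0 = 0 :=
  match γ with
  | line => rfl
  | circle _ _ => rfl

lemma proj_surjective (γ : Factor) : Function.Surjective γ.proj :=
  match γ with
  | line => fun x => ⟨x, rfl⟩
  | circle _ _ => QuotientAddGroup.mk_surjective

lemma coord_proj (γ : Factor) (t : ℝ) : γ.coord (γ.proj t) = γ.realCoord t :=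
  match γ with
  | line => rfl
  | circle _ _ => rfl

lemma freq_add (γ : Factor) (ξ η : γ.Dual) : γ.freq (ξ + η) = γ.freq ξ + γ.freq η := by
  cases γ with
  | line => rfl
  | circle L _ =>
    have key : ∀ ξ η : ℤ, ((ξ + η : ℤ) : ℝ) / L = (ξ : ℝ) / L + (η : ℝ) / L := fun ξ η => by
      push_cast; ring
    exact key ξ η

lemma shift_zero (γ : Factor) (ξ : γ.Dual) : γ.shift ξ 0 = ξ :=
  match γ with
  | line => add_zero (ξ : ℝ)
  | circle _ _ => rfl

/-- In a periodic direction the dual is discrete, so nearby frequencies coincide there. This lets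
smoothness along slices control a whole neighbourhood. -/
lemma eventually_shift_eq (γ : Factor) (ξ : γ.Dual) :
    ∀ᶠ η in nhds ξ, γ.shift ξ (γ.dualCoord η - γ.dualCoord ξ) = η :=
  match γ with
  | line => Filter.Eventually.of_forall fun (η : ℝ) => add_sub_cancel (ξ : ℝ) η
  | circle _ _ => by
    have key : ∀ k : ℤ, ∀ᶠ l in nhds k, k = l := fun k => by simp
    exact key ξ

lemma norm_char (γ : Factor) (ξ : γ.Dual) (x : γ.Space) : ‖γ.char ξ x‖ = 1 := by
  cases γ with
  | line =>
    have key : ∀ ξ x : ℝ, ‖Complex.exp (-(2 * Real.pi * Complex.I * ξ * x))‖ = 1 := fun ξ x => by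
      have : -(2 * Real.pi * Complex.I * (ξ : ℂ) * (x : ℂ)) =
        ((-(2 * Real.pi * ξ * x) : ℝ) : ℂ) * Complex.I := by push_cast; ring
      rw [this, Complex.norm_exp_ofReal_mul_I]
    exact key ξ x
  | circle L _ =>
    have key : ∀ (k : ℤ) (x : AddCircle L), ‖(fourier (-k) x : ℂ)‖ = 1 := fun k x => by
      rw [fourier_apply]; exact Circle.norm_coe _
    exact key ξ x

lemma char_add_left (γ : Factor) (ξ η : γ.Dual) (x : γ.Space) :
    γ.char (ξ + η) x = γ.char ξ x * γ.char η x := by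
  cases γ with
  | line =>
    have key : ∀ ξ η x : ℝ, Complex.exp (-(2 * Real.pi * Complex.I * (ξ + η : ℝ) * x)) =
        Complex.exp (-(2 * Real.pi * Complex.I * ξ * x)) *
        Complex.exp (-(2 * Real.pi * Complex.I * η * x)) := fun ξ η x => by
      rw [← Complex.exp_add]; congr 1; push_cast; ring
    exact key ξ η x
  | circle L _ =>
    have key : ∀ (k l : ℤ) (x : AddCircle L),
        (fourier (-(k + l)) x : ℂ) = fourier (-k) x * fourier (-l) x := fun k l x => by
      rw [neg_add, fourier_add]
    exact key ξ η x

lemma char_add_right (γ : Factor) (ξ : γ.Dual) (x y : γ.Space) :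
    γ.char ξ (x + y) = γ.char ξ x * γ.char ξ y := by
  cases γ with
  | line =>
    have key : ∀ ξ x y : ℝ, Complex.exp (-(2 * Real.pi * Complex.I * ξ * (x + y : ℝ))) =
        Complex.exp (-(2 * Real.pi * Complex.I * ξ * x)) *
        Complex.exp (-(2 * Real.pi * Complex.I * ξ * y)) := fun ξ x y => by
      rw [← Complex.exp_add]; congr 1; push_cast; ring
    exact key ξ x y
  | circle L _ =>
    have key : ∀ (k : ℤ) (x y : AddCircle L),
        (fourier (-k) (x + y) : ℂ) = fourier (-k) x * fourier (-k) y := fun k x y => by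
      simp only [fourier_apply, smul_add, AddCircle.toCircle_add, Circle.coe_mul]
    exact key ξ x y

lemma char_proj (γ : Factor) (ξ : γ.Dual) (t : ℝ) :
    γ.char ξ (γ.proj t) = Complex.exp (-(2 * Real.pi * Complex.I * γ.freq ξ * t)) := by
  cases γ with
  | line => rfl
  | circle L _ =>
    have key : ∀ k : ℤ, (fourier (-k) (t : AddCircle L) : ℂ) =
        Complex.exp (-(2 * Real.pi * Complex.I * ((k : ℝ) / L : ℝ) * t)) := fun k => by
      rw [fourier_coe_apply]; congr 1; push_cast; ring
    exact key ξ

lemma char_shift (γ : Factor) (ξ : γ.Dual) (v : ℝ) (x : γ.Space) :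
    γ.char (γ.shift ξ v) x =
      γ.char ξ x * Complex.exp (-(2 * Real.pi * Complex.I * v * γ.coord x)) := by
  cases γ with
  | line => exact char_add_left line ξ v x
  | circle L _ =>
    change _ = _ * Complex.exp (-(2 * Real.pi * Complex.I * v * (0 : ℝ)))
    simp [shift]

lemma continuous_char (γ : Factor) : Continuous fun p : γ.Dual × γ.Space => γ.char p.1 p.2 :=
  match γ with
  | line => by
    change Continuous fun p : ℝ × ℝ => Complex.exp (-(2 * Real.pi * Complex.I * p.1 * p.2))
    fun_prop
  | circle L _ => by
    change Continuous fun p : ℤ × AddCircle L => (fourier (-p.1) p.2 : ℂ)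
    exact continuous_prod_of_discrete_left.2 fun k => (fourier (-k)).continuous

lemma conj_char (γ : Factor) (ξ : γ.Dual) (x : γ.Space) :
    starRingEnd ℂ (γ.char ξ x) = (γ.char ξ x)⁻¹ :=
  (Complex.inv_eq_conj (norm_char γ ξ x)).symm

lemma char_zero_left (γ : Factor) (x : γ.Space) : γ.char 0 x = 1 := by
  have h := char_add_left γ 0 0 x
  have h0 : γ.char 0 x ≠ 0 := norm_ne_zero_iff.1 (by rw [norm_char]; exact one_ne_zero)
  rw [add_zero] at h
  exact (mul_eq_left₀ h0).1 h.symm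

lemma char_zero_right (γ : Factor) (ξ : γ.Dual) : γ.char ξ 0 = 1 := by
  have h := char_add_right γ ξ 0 0
  have h0 : γ.char ξ 0 ≠ 0 := norm_ne_zero_iff.1 (by rw [norm_char]; exact one_ne_zero)
  rw [add_zero] at h
  exact (mul_eq_left₀ h0).1 h.symm

lemma char_neg_left (γ : Factor) (ξ : γ.Dual) (x : γ.Space) :
    γ.char (-ξ) x = starRingEnd ℂ (γ.char ξ x) := by
  rw [conj_char]
  refine eq_inv_of_mul_eq_one_left ?_
  rw [← char_add_left, neg_add_cancel, char_zero_left]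

lemma char_neg_right (γ : Factor) (ξ : γ.Dual) (x : γ.Space) :
    γ.char ξ (-x) = starRingEnd ℂ (γ.char ξ x) := by
  rw [conj_char]
  refine eq_inv_of_mul_eq_one_left ?_
  rw [← char_add_right, neg_add_cancel, char_zero_right]

/-- Separation of points, for the Stone–Weierstrass type argument. On the line the frequency
`1/(2x)` gives the value `-1`; on a circle a single generator of the dual is already injective. -/
lemma exists_char_ne_one_of_ne_zero (γ : Factor) {x : γ.Space} (hx : x ≠ 0) :
    ∃ ξ, γ.char ξ x ≠ 1 := by
  cases γ with
  | line =>
    have key : ∀ x : ℝ, x ≠ 0 → ∃ ξ : ℝ,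
        Complex.exp (-(2 * Real.pi * Complex.I * ξ * x)) ≠ 1 := fun x hx => by
      refine ⟨1 / (2 * x), ?_⟩
      have h : -(2 * Real.pi * Complex.I * ((1 / (2 * x) : ℝ) : ℂ) * (x : ℂ)) =
          -(Real.pi * Complex.I) := by
        have : (x : ℂ) ≠ 0 := by exact_mod_cast hx
        push_cast; field_simp
      rw [h, Complex.exp_neg, Complex.exp_pi_mul_I]; norm_num
    exact key x hx
  | circle L hL =>
    have key : ∀ x : AddCircle L, x ≠ 0 → ∃ k : ℤ, (fourier (-k) x : ℂ) ≠ 1 := fun x hx => by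
      refine ⟨-1, fun h => hx ?_⟩
      rw [neg_neg, fourier_one] at h
      have h3 : AddCircle.toCircle x = AddCircle.toCircle (0 : AddCircle L) := by
        rw [AddCircle.toCircle_zero]; exact Circle.ext h
      exact AddCircle.injective_toCircle hL.ne' h3
    exact key x hx

lemma exists_char_ne_one_of_dual_ne_zero (γ : Factor) {ξ : γ.Dual} (hξ : ξ ≠ 0) :
    ∃ x, γ.char ξ x ≠ 1 := by
  have hf : γ.freq ξ ≠ 0 :=
    match γ with
    | line => hξ
    | circle L hL => div_ne_zero (Int.cast_ne_zero.2 hξ) hL.ne'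
  refine ⟨γ.proj (1 / (2 * γ.freq ξ)), ?_⟩
  rw [char_proj]
  have h : -(2 * Real.pi * Complex.I * (γ.freq ξ : ℂ) * ((1 / (2 * γ.freq ξ) : ℝ) : ℂ)) =
      -(Real.pi * Complex.I) := by
    have : (γ.freq ξ : ℂ) ≠ 0 := by exact_mod_cast hf
    push_cast; field_simp
  rw [h, Complex.exp_neg, Complex.exp_pi_mul_I]; norm_num

lemma integrable_inv_one_add_coord_sq (γ : Factor) :
    Integrable fun x : γ.Space => (1 + γ.coord x ^ 2)⁻¹ :=
  match γ with
  | line => integrable_inv_one_add_sq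
  | circle L hL => by
    have : Fact (0 < L) := ⟨hL⟩
    change Integrable fun x : AddCircle L => (1 + (0 : ℝ) ^ 2)⁻¹
    exact integrable_const _

/-- Here `2p > 1`, the threshold both for the integral on the line and for the series `∑ |k|^(-2p)`
on a circle. Splitting `s` into `d` equal exponents turns this into the condition `s > d/2`. -/
lemma integrable_one_add_freq_sq_rpow (γ : Factor) {p : ℝ} (hp : 1 / 2 < p) :
    Integrable fun ξ : γ.Dual => (1 + γ.freq ξ ^ 2) ^ (-p) :=
  match γ with
  | line => by
    have h := integrable_rpow_neg_one_add_norm_sq (E := ℝ) (μ := volume) (r := 2 * p)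
      (by simp; linarith)
    refine h.congr (Filter.Eventually.of_forall fun x => ?_)
    change (1 + ‖x‖ ^ 2) ^ (-(2 * p) / 2) = (1 + x ^ 2) ^ (-p)
    rw [Real.norm_eq_abs, sq_abs]; congr 1; ring
  | circle L hL => by
    change Integrable (fun k : ℤ => (1 + ((k : ℝ) / L) ^ 2) ^ (-p)) Measure.count
    rw [integrable_count_iff]
    have h1 : Summable fun k : ℤ => L ^ (2 * p) * |(k : ℝ)| ^ (-(2 * p)) :=
      (Real.summable_abs_int_rpow (by linarith)).mul_left _
    refine Summable.of_norm_bounded_eventually h1 ?_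
    -- At `k = 0` the majorant takes the default value `0` of a negative power of `0`, so the
    -- comparison is made off this point.
    have : ({0} : Set ℤ)ᶜ ∈ Filter.cofinite := (Set.finite_singleton 0).compl_mem_cofinite
    filter_upwards [this] with k hk
    have hk0 : (0 : ℝ) < |(k : ℝ)| := abs_pos.2 (Int.cast_ne_zero.2 hk)
    have h2 : ((k : ℝ) / L) ^ 2 = (|(k : ℝ)| / L) ^ 2 := by rw [div_pow, div_pow, sq_abs]
    have h3 : 0 < |(k : ℝ)| / L := div_pos hk0 hL
    rw [norm_norm, h2, Real.norm_of_nonneg (by positivity)]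
    calc (1 + (|(k : ℝ)| / L) ^ 2) ^ (-p) ≤ ((|(k : ℝ)| / L) ^ 2) ^ (-p) :=
          Real.rpow_le_rpow_of_nonpos (by positivity) (by linarith) (by linarith)
      _ = (|(k : ℝ)| / L) ^ (-(2 * p)) := by
          rw [← Real.rpow_natCast, ← Real.rpow_mul h3.le]; congr 1; push_cast; ring
      _ = L ^ (2 * p) * |(k : ℝ)| ^ (-(2 * p)) := by
          rw [Real.div_rpow hk0.le hL.le, Real.rpow_neg hL.le]; field_simp

end Factor

/-! ### One-dimensional test functions with explicit transforms. -/

namespace Factor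

open scoped FourierTransform SchwartzMap

/-- A pair of a test function on the space and its inverse Fourier transform: Schwartz functions on
the line, monomials and finitely supported sequences on a circle. -/
def IsTestPair : (γ : Factor) → (γ.Space → ℂ) → (γ.Dual → ℂ) → Prop
  | line => fun (a : ℝ → ℂ) (b : ℝ → ℂ) => ∃ h : 𝓢(ℝ, ℂ), b = h ∧ a = (𝓕 h : 𝓢(ℝ, ℂ))
  | circle L _ => fun (a : AddCircle L → ℂ) (b : ℤ → ℂ) => ∃ (k : ℤ) (c : ℂ),
      b = Pi.single k c ∧ a = fun x => ((1 / Real.sqrt L : ℝ) : ℂ) * (c * fourier (-k) x)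

lemma schwartzMap_fourier_eq_integral (h : 𝓢(ℝ, ℂ)) (x : ℝ) :
    (𝓕 h : 𝓢(ℝ, ℂ)) x =
      ∫ ξ : ℝ, h ξ * Complex.exp (-(2 * Real.pi * Complex.I * ξ * x)) := by
  rw [SchwartzMap.fourier_coe, Real.fourier_real_eq_integral_exp_smul]
  refine integral_congr_ae (Filter.Eventually.of_forall fun ξ => ?_)
  simp only [smul_eq_mul]
  rw [mul_comm]; congr 2; push_cast; ring

lemma schwartzMap_eq_integral_fourier (h : 𝓢(ℝ, ℂ)) (ξ : ℝ) :
    h ξ = ∫ x : ℝ, (𝓕 h : 𝓢(ℝ, ℂ)) x *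
      starRingEnd ℂ (Complex.exp (-(2 * Real.pi * Complex.I * ξ * x))) := by
  have h1 : h ξ = (𝓕⁻ (𝓕 h : 𝓢(ℝ, ℂ)) : 𝓢(ℝ, ℂ)) ξ := by
    rw [FourierTransform.fourierInv_fourier_eq]
  rw [h1, SchwartzMap.fourierInv_coe, Real.fourierInv_eq']
  refine integral_congr_ae (Filter.Eventually.of_forall fun x => ?_)
  simp only [smul_eq_mul]
  rw [mul_comm, ← Complex.exp_conj]
  congr 2
  simp only [RCLike.inner_apply, conj_trivial, map_neg, map_mul, Complex.conj_ofReal,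
    Complex.conj_I, Complex.conj_ofNat]
  push_cast
  ring

lemma integral_fourier_mul_conj {L : ℝ} (hL : 0 < L) (k l : ℤ) :
    haveI : Fact (0 < L) := ⟨hL⟩
    ∫ x : AddCircle L, (fourier (-k) x : ℂ) * starRingEnd ℂ (fourier (-l) x) =
      if l = k then (L : ℂ) else 0 := by
  have : Fact (0 < L) := ⟨hL⟩
  have h := congrFun (fourierCoeff_fourier (T := L) (-k)) (-l)
  rw [fourierCoeff] at h
  have e : ∀ x : AddCircle L, (fourier (-k) x : ℂ) * starRingEnd ℂ (fourier (-l) x) =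
      fourier (-(-l)) x • (fourier (-k) x : ℂ) := fun x => by
    rw [fourier_neg (n := -l), smul_eq_mul, mul_comm]
  simp_rw [e]
  -- Fourier coefficients are taken with respect to the probability Haar measure; the rescaling
  -- produces the factor `L`.
  rw [AddCircle.volume_eq_smul_haarAddCircle, integral_smul_measure, h,
    ENNReal.toReal_ofReal hL.le, Pi.single_apply]
  simp only [neg_inj]
  split_ifs <;> simp

variable {γ : Factor} {a : γ.Space → ℂ} {b : γ.Dual → ℂ}

namespace IsTestPair

lemma eq_integral_char (h : IsTestPair γ a b) (x : γ.Space) :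
    a x = γ.normalization * ∫ ξ, b ξ * γ.char ξ x := by
  cases γ with
  | line =>
    obtain ⟨h, rfl, rfl⟩ := h
    have key : ∀ x : ℝ, (𝓕 h : 𝓢(ℝ, ℂ)) x = ((1 : ℝ) : ℂ) *
        ∫ ξ : ℝ, h ξ * Complex.exp (-(2 * Real.pi * Complex.I * ξ * x)) := fun x => by
      rw [Complex.ofReal_one, one_mul, schwartzMap_fourier_eq_integral]
    exact key x
  | circle L hL =>
    obtain ⟨k, c, rfl, rfl⟩ := h
    have key : ∀ x : AddCircle L, ((1 / Real.sqrt L : ℝ) : ℂ) * (c * fourier (-k) x) =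
        ((1 / Real.sqrt L : ℝ) : ℂ) *
        ∫ l : ℤ, (Pi.single k c : ℤ → ℂ) l * fourier (-l) x ∂Measure.count := fun x => by
      have e : (fun l : ℤ => (Pi.single k c : ℤ → ℂ) l * (fourier (-l) x : ℂ)) =
          Pi.single k (c * fourier (-k) x) := by
        funext l
        by_cases hl : l = k
        · subst hl; simp
        · simp [Pi.single_eq_of_ne hl]
      congr 1
      rw [e, integral_countable (integrable_count_iff.2 (summable_of_hasFiniteSupport
        ((Set.finite_singleton k).subset fun l hl => ?_)))]
      · simp [Measure.real, tsum_pi_single]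
      · by_contra hlk
        exact hl (by simp [Pi.single_eq_of_ne (show l ≠ k from hlk)])
    exact key x

/-- Inversion on one factor: the Schwartz inversion theorem on the line, orthogonality of characters
on a circle, where the two factors `1/√L` cancel the total mass `L`. -/
lemma eq_integral_conj_char (h : IsTestPair γ a b) (ξ : γ.Dual) :
    b ξ = γ.normalization * ∫ x, a x * starRingEnd ℂ (γ.char ξ x) := by
  cases γ with
  | line =>
    obtain ⟨h, rfl, rfl⟩ := h
    have key : ∀ ξ : ℝ, h ξ = ((1 : ℝ) : ℂ) *
        ∫ x : ℝ, (𝓕 h : 𝓢(ℝ, ℂ)) x *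
          starRingEnd ℂ (Complex.exp (-(2 * Real.pi * Complex.I * ξ * x))) := fun x => by
      rw [Complex.ofReal_one, one_mul, ← schwartzMap_eq_integral_fourier]
    exact key ξ
  | circle L hL =>
    obtain ⟨k, c, rfl, rfl⟩ := h
    have : Fact (0 < L) := ⟨hL⟩
    have key : ∀ l : ℤ, (Pi.single k c : ℤ → ℂ) l = ((1 / Real.sqrt L : ℝ) : ℂ) *
        ∫ x : AddCircle L, ((1 / Real.sqrt L : ℝ) : ℂ) * (c * fourier (-k) x) *
          starRingEnd ℂ (fourier (-l) x) := fun l => by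
      have e : ∀ x : AddCircle L, ((1 / Real.sqrt L : ℝ) : ℂ) * (c * fourier (-k) x) *
          starRingEnd ℂ (fourier (-l) x) = (((1 / Real.sqrt L : ℝ) : ℂ) * c) *
          ((fourier (-k) x : ℂ) * starRingEnd ℂ (fourier (-l) x)) := fun x => by ring
      simp_rw [e]
      rw [integral_const_mul, integral_fourier_mul_conj hL, Pi.single_apply]
      split_ifs
      · have h1 : ((1 / Real.sqrt L : ℝ) : ℂ) * ((1 / Real.sqrt L : ℝ) : ℂ) * (L : ℂ) = 1 := by
          norm_cast
          have := Real.mul_self_sqrt hL.le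
          have h0 : Real.sqrt L ≠ 0 := (Real.sqrt_pos.2 hL).ne'
          field_simp
          rw [sq, this]
        linear_combination (-c) * h1
      · simp
    exact key ξ

lemma decay (h : IsTestPair γ a b) (k : ℕ) : ∃ C, ∀ x, (1 + |γ.coord x|) ^ k * ‖a x‖ ≤ C := by
  cases γ with
  | line =>
    obtain ⟨h, rfl, rfl⟩ := h
    refine ⟨2 ^ k * (Finset.Iic (k, 0)).sup (fun m => SchwartzMap.seminorm ℝ m.1 m.2)
      (𝓕 h : 𝓢(ℝ, ℂ)), fun x : ℝ => ?_⟩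
    have := SchwartzMap.one_add_le_sup_seminorm_apply (𝕜 := ℝ) (m := (k, 0)) le_rfl le_rfl
      (𝓕 h : 𝓢(ℝ, ℂ)) x
    rw [norm_iteratedFDeriv_zero] at this
    exact this
  | circle L hL =>
    obtain ⟨n, c, rfl, rfl⟩ := h
    have key : ∀ x : AddCircle L, (1 + |(0 : ℝ)|) ^ k *
        ‖((1 / Real.sqrt L : ℝ) : ℂ) * (c * fourier (-n) x)‖ ≤
          ‖((1 / Real.sqrt L : ℝ) : ℂ)‖ * ‖c‖ := fun x => by
      have := norm_char (circle L hL) n x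
      change ‖(fourier (-n) x : ℂ)‖ = 1 at this
      rw [norm_mul, norm_mul, this]; simp
    exact ⟨_, key⟩

lemma decay_dual (h : IsTestPair γ a b) (k : ℕ) : ∃ C, ∀ ξ, (1 + |γ.freq ξ|) ^ k * ‖b ξ‖ ≤ C := by
  cases γ with
  | line =>
    obtain ⟨h, rfl, rfl⟩ := h
    refine ⟨2 ^ k * (Finset.Iic (k, 0)).sup (fun m => SchwartzMap.seminorm ℝ m.1 m.2)
      h, fun x : ℝ => ?_⟩
    have := SchwartzMap.one_add_le_sup_seminorm_apply (𝕜 := ℝ) (m := (k, 0)) le_rfl le_rfl h x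
    rw [norm_iteratedFDeriv_zero] at this
    exact this
  | circle L hL =>
    obtain ⟨n, c, rfl, rfl⟩ := h
    have key : ∀ l : ℤ, (1 + |(l : ℝ) / L|) ^ k * ‖(Pi.single n c : ℤ → ℂ) l‖ ≤
        (1 + |(n : ℝ) / L|) ^ k * ‖c‖ := fun l => by
      by_cases hl : l = n
      · subst hl; simp
      · rw [Pi.single_eq_of_ne hl, norm_zero, mul_zero]; positivity
    exact ⟨_, key⟩

/-- Stability under differentiation is what lets decay alone imply membership in the Schwartz class.
On a circle the derivative merely rescales the coefficient. -/
lemma exists_hasDerivAt (h : IsTestPair γ a b) : ∃ a' b', IsTestPair γ a' b' ∧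
    ∀ t : ℝ, HasDerivAt (fun t => a (γ.proj t)) (a' (γ.proj t)) t := by
  cases γ with
  | line =>
    obtain ⟨h, rfl, rfl⟩ := h
    refine ⟨SchwartzMap.derivCLM ℂ ℂ (𝓕 h : 𝓢(ℝ, ℂ)),
      (𝓕⁻ (SchwartzMap.derivCLM ℂ ℂ (𝓕 h : 𝓢(ℝ, ℂ))) : 𝓢(ℝ, ℂ)), ⟨_, rfl, ?_⟩, fun t => ?_⟩
    · rw [FourierTransform.fourier_fourierInv_eq]
    · exact (𝓕 h : 𝓢(ℝ, ℂ)).hasDerivAt t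
  | circle L hL =>
    obtain ⟨k, c, rfl, rfl⟩ := h
    refine ⟨_, _, ⟨k, c * (-2 * Real.pi * Complex.I * k / L), rfl, rfl⟩, fun t => ?_⟩
    have key : HasDerivAt (fun t : ℝ => ((1 / Real.sqrt L : ℝ) : ℂ) *
        (c * fourier (-k) (t : AddCircle L))) (((1 / Real.sqrt L : ℝ) : ℂ) *
        (c * (-2 * Real.pi * Complex.I * k / L) * fourier (-k) (t : AddCircle L))) t := by
      have := ((hasDerivAt_fourier_neg L k t).const_mul c).const_mul ((1 / Real.sqrt L : ℝ) : ℂ)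
      rw [mul_assoc c]
      exact this
    exact key

lemma exists_hasDerivAt_dual (h : IsTestPair γ a b) : ∃ a' b', IsTestPair γ a' b' ∧
    ∀ (ξ : γ.Dual) (v : ℝ), HasDerivAt (fun v => b (γ.shift ξ v)) (b' (γ.shift ξ v)) v := by
  cases γ with
  | line =>
    obtain ⟨h, rfl, rfl⟩ := h
    refine ⟨_, SchwartzMap.derivCLM ℂ ℂ h, ⟨_, rfl, rfl⟩, fun (ξ : ℝ) v => ?_⟩
    exact (h.hasDerivAt (ξ + v)).comp_const_add ξ v
  | circle L hL =>
    refine ⟨_, _, ⟨0, 0, rfl, rfl⟩, fun ξ v => ?_⟩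
    rw [Pi.single_zero]
    exact hasDerivAt_const v (b ξ)

end IsTestPair

/-- Smooth cutoffs on the line, `1` on a circle. -/
def cutoff : (γ : Factor) → ℕ → γ.Space → ℂ
  | line => fun n (x : ℝ) =>
      (((⟨n + 1, n + 2, by positivity, by linarith⟩ : ContDiffBump (0 : ℝ)) x : ℝ) : ℂ)
  | circle _ _ => fun _ _ => 1

/-- Smooth cutoffs on the line, indicators of points in the dual of a circle. -/
def dualCutoff : (γ : Factor) → ℕ × ℤ → γ.Dual → ℂ
  | line => fun n (x : ℝ) =>
      (((⟨n.1 + 1, n.1 + 2, by positivity, by linarith⟩ : ContDiffBump (0 : ℝ)) x : ℝ) : ℂ)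
  | circle _ _ => fun n (k : ℤ) => (Pi.single n.2 1 : ℤ → ℂ) k

/-- A bump function times a character is a Schwartz function. -/
lemma exists_schwartzMap_bump_mul_exp (f : ContDiffBump (0 : ℝ)) (t : ℝ) : ∃ h : 𝓢(ℝ, ℂ),
    ∀ x, h x = ((f x : ℝ) : ℂ) * Complex.exp (-(2 * Real.pi * Complex.I * t * x)) := by
  have h1 : HasCompactSupport fun x : ℝ =>
      ((f x : ℝ) : ℂ) * Complex.exp (-(2 * Real.pi * Complex.I * t * x)) :=
    HasCompactSupport.mul_right (f.hasCompactSupport.comp_left (g := fun y : ℝ => (y : ℂ)) rfl)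
  have h2 : ContDiff ℝ ∞ fun x : ℝ =>
      ((f x : ℝ) : ℂ) * Complex.exp (-(2 * Real.pi * Complex.I * t * x)) := by
    refine (Complex.ofRealCLM.contDiff.comp f.contDiff).mul (ContDiff.cexp ?_)
    exact (contDiff_const.mul Complex.ofRealCLM.contDiff).neg
  exact ⟨h1.toSchwartzMap h2, fun x => rfl⟩

lemma continuous_cutoff (γ : Factor) (n : ℕ) : Continuous (γ.cutoff n) := by
  cases γ with
  | line =>
    exact Complex.continuous_ofReal.comp (ContDiffBump.continuous
      (⟨n + 1, n + 2, by positivity, by linarith⟩ : ContDiffBump (0 : ℝ)))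
  | circle _ _ => exact continuous_const

/-- Nonvanishing for all large indices allows one index to serve all coordinates of a product
simultaneously. -/
lemma exists_cutoff_ne_zero (γ : Factor) (x : γ.Space) : ∃ n, ∀ m ≥ n, γ.cutoff m x ≠ 0 := by
  cases γ with
  | line =>
    have key : ∀ x : ℝ, ∃ n : ℕ, ∀ m ≥ n, cutoff line m x ≠ 0 := fun x => by
      obtain ⟨n, hn⟩ := exists_nat_ge |x|
      refine ⟨n, fun m hm => ?_⟩
      refine Complex.ofReal_ne_zero.2 (ne_of_gt ?_)
      refine ContDiffBump.pos_of_mem_ball _ ?_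
      have : (n : ℝ) ≤ m := by exact_mod_cast hm
      simp only [Metric.mem_ball, dist_zero_right, Real.norm_eq_abs]
      linarith
    exact key x
  | circle _ _ => exact ⟨0, fun _ _ => one_ne_zero⟩

lemma exists_dualCutoff_ne_zero (γ : Factor) (ξ : γ.Dual) : ∃ n, γ.dualCutoff n ξ ≠ 0 := by
  cases γ with
  | line =>
    obtain ⟨n, hn⟩ := exists_cutoff_ne_zero line ξ
    exact ⟨(n, 0), hn n le_rfl⟩
  | circle _ _ =>
    have key : ∀ k : ℤ, (Pi.single k 1 : ℤ → ℂ) k ≠ 0 := fun k => by simp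
    exact ⟨(0, ξ), key ξ⟩

/-- Test functions thus include all modulations of a cutoff: if `u` integrates to zero against them,
every Fourier coefficient of the localized `u` vanishes. -/
lemma exists_isTestPair_cutoff (γ : Factor) (n : ℕ) (ξ : γ.Dual) :
    ∃ b, IsTestPair γ (fun x => γ.cutoff n x * γ.char ξ x) b := by
  cases γ with
  | line =>
    obtain ⟨h, hh⟩ := exists_schwartzMap_bump_mul_exp
      ⟨n + 1, n + 2, by positivity, by linarith⟩ ξ
    refine ⟨(𝓕⁻ h : 𝓢(ℝ, ℂ)), _, rfl, ?_⟩
    rw [FourierTransform.fourier_fourierInv_eq]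
    exact (funext hh).symm
  | circle L hL =>
    have key : ∀ k : ℤ, ∃ b, IsTestPair (circle L hL) (fun x : AddCircle L => 1 * fourier (-k) x) b :=
      fun k => by
        -- The coefficient `√L` cancels the normalization `1/√L`.
        refine ⟨_, k, (Real.sqrt L : ℂ), rfl, ?_⟩
        funext x
        have h0 : (Real.sqrt L : ℂ) ≠ 0 := by exact_mod_cast (Real.sqrt_pos.2 hL).ne'
        push_cast
        field_simp
    exact key ξ

lemma exists_isTestPair_dualCutoff (γ : Factor) (n : ℕ × ℤ) (x : γ.Space) :
    ∃ a, IsTestPair γ a (fun ξ => γ.dualCutoff n ξ * γ.char ξ x) := by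
  cases γ with
  | line =>
    obtain ⟨h, hh⟩ := exists_schwartzMap_bump_mul_exp
      ⟨n.1 + 1, n.1 + 2, by positivity, by linarith⟩ x
    refine ⟨_, h, ?_, rfl⟩
    funext ξ
    rw [hh ξ]
    have key : ∀ ξ x : ℝ, Complex.exp (-(2 * Real.pi * Complex.I * ξ * x)) =
      Complex.exp (-(2 * Real.pi * Complex.I * x * ξ)) := fun ξ x => by congr 1; ring
    exact congrArg _ (key ξ x)
  | circle L hL =>
    have key : ∀ x : AddCircle L, ∃ a, IsTestPair (circle L hL) a
        (fun k : ℤ => (Pi.single n.2 1 : ℤ → ℂ) k * fourier (-k) x) := fun x => by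
      refine ⟨_, n.2, fourier (-n.2) x, ?_, rfl⟩
      funext l
      by_cases hl : l = n.2
      · subst hl; simp
      · simp [Pi.single_eq_of_ne hl]
    exact key x

end Factor

/-! ### General tools: functions determined by integrals, smoothness from closure under derivatives.
-/

/-- A family of bounded continuous functions which contains `1`, is closed under products and
conjugation and separates points determines real integrable functions. -/
lemma ae_eq_zero_of_integral_mul_eq_zero_real {X J : Type*} [TopologicalSpace X] [PolishSpace X]
    [MeasurableSpace X] [BorelSpace X] {ν : Measure X} (e : J → X →ᵇ ℂ)
    (hone : ∃ j, e j = 1) (hmul : ∀ j k, ∃ l, e l = e j * e k) (hstar : ∀ j, ∃ k, e k = star (e j))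
    (hsep : ∀ x y, x ≠ y → ∃ j, e j x ≠ e j y) {v : X → ℝ} (hv : Integrable v ν)
    (h : ∀ j, ∫ x, (v x : ℂ) * e j x ∂ν = 0) : v =ᵐ[ν] 0 := by
  -- The positive and negative parts of `v`, as finite measures. They agree on a point-separating
  -- star algebra of bounded continuous functions, hence coincide, which forces `v = 0`.
  let P := ν.withDensity fun x => ENNReal.ofReal (v x)
  let Q := ν.withDensity fun x => ENNReal.ofReal (-v x)
  have hP : IsFiniteMeasure P := isFiniteMeasure_withDensity_ofReal hv.2
  have hQ : IsFiniteMeasure Q := isFiniteMeasure_withDensity_ofReal hv.neg.2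
  have h_int : ∀ g : X →ᵇ ℂ, ∫ x, g x ∂P - ∫ x, g x ∂Q = ∫ x, (v x : ℂ) * g x ∂ν := fun g => by
    have hb : ∀ u : X → ℝ, Integrable u ν → Integrable (fun x => (u x : ℂ) * g x) ν :=
      fun u hu => hu.ofReal.mul_bdd (c := ‖g‖) g.continuous.aestronglyMeasurable
        (Filter.Eventually.of_forall g.norm_coe_le_norm)
    have hp : ∀ u : X → ℝ, Integrable u ν →
        ∫ x, g x ∂(ν.withDensity fun x => ENNReal.ofReal (u x)) =
          ∫ x, ((max (u x) 0 : ℝ) : ℂ) * g x ∂ν := fun u hu => by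
      rw [integral_withDensity_eq_integral_toReal_smul₀ hu.aemeasurable.ennreal_ofReal
        (Filter.Eventually.of_forall fun x => ENNReal.ofReal_lt_top)]
      refine integral_congr_ae (Filter.Eventually.of_forall fun x => ?_)
      simp only [ENNReal.toReal_ofReal', Complex.real_smul]
    rw [hp v hv, hp (fun x => -v x) hv.neg, ← integral_sub]
    · refine integral_congr_ae (Filter.Eventually.of_forall fun x => ?_)
      have : v x = max (v x) 0 - max (-v x) 0 := by
        rcases le_total 0 (v x) with h | h
        · rw [max_eq_left h, max_eq_right (by linarith)]; ring
        · rw [max_eq_right h, max_eq_left (by linarith)]; ring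
      simp only
      conv_rhs => rw [this]
      push_cast; ring
    · exact hb _ hv.pos_part
    · exact hb _ hv.neg.pos_part
  let A : StarSubalgebra ℂ (X →ᵇ ℂ) := StarAlgebra.adjoin ℂ (Set.range e)
  have hA : ∀ g ∈ A, ∫ x, (v x : ℂ) * g x ∂ν = 0 := by
    intro g hg
    have hstar' : Set.range e ∪ star (Set.range e) = Set.range e := by
      refine Set.union_eq_left.2 ?_
      rintro f ⟨j, hj⟩
      obtain ⟨k, hk⟩ := hstar j
      exact ⟨k, by rw [hk, hj, star_star]⟩
    have hcl : ((Submonoid.closure (Set.range e) : Submonoid (X →ᵇ ℂ)) : Set (X →ᵇ ℂ)) =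
        Set.range e := by
      refine Set.Subset.antisymm ?_ Submonoid.subset_closure
      let M : Submonoid (X →ᵇ ℂ) :=
        { carrier := Set.range e
          one_mem' := hone
          mul_mem' := by
            rintro _ _ ⟨j, rfl⟩ ⟨k, rfl⟩
            exact hmul j k }
      exact (Submonoid.closure_le (S := M)).2 le_rfl
    -- Since the family is closed under products and conjugation, the star algebra it generates is
    -- just its linear span, to which the hypothesis extends by linearity.
    have hg' : g ∈ Submodule.span ℂ (Set.range e) := by
      have h1 : g ∈ A.toSubalgebra := hg
      rw [StarAlgebra.adjoin_toSubalgebra, hstar', ← Subalgebra.mem_toSubmodule,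
        Algebra.adjoin_eq_span, hcl] at h1
      exact h1
    have hb : ∀ g : X →ᵇ ℂ, Integrable (fun x => (v x : ℂ) * g x) ν :=
      fun g => hv.ofReal.mul_bdd (c := ‖g‖) g.continuous.aestronglyMeasurable
        (Filter.Eventually.of_forall g.norm_coe_le_norm)
    clear hg
    induction hg' using Submodule.span_induction with
    | mem f hf => obtain ⟨j, rfl⟩ := hf; exact h j
    | zero => simp
    | add f₁ f₂ _ _ h₁ h₂ =>
      simp only [BoundedContinuousFunction.coe_add, Pi.add_apply, mul_add]
      rw [integral_add (hb _) (hb _), h₁, h₂, add_zero]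
    | smul c f _ hf =>
      simp only [BoundedContinuousFunction.coe_smul, smul_eq_mul, mul_left_comm _ c]
      rw [integral_const_mul, hf, mul_zero]
  have hPQ : P = Q := by
    refine ext_of_forall_mem_subalgebra_integral_eq_of_polish (𝕜 := ℂ) (A := A) ?_ fun g hg => ?_
    · intro x y hxy
      obtain ⟨j, hj⟩ := hsep x y hxy
      exact ⟨e j, ⟨_, ⟨e j, StarAlgebra.subset_adjoin ℂ _ ⟨j, rfl⟩, rfl⟩, rfl⟩, hj⟩
    · exact sub_eq_zero.1 ((h_int g).trans (hA g hg))
  have := (withDensity_eq_iff hv.aemeasurable.ennreal_ofReal hv.neg.aemeasurable.ennreal_ofReal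
    hv.lintegral_lt_top.ne).1 hPQ
  filter_upwards [this] with x hx
  rcases le_total 0 (v x) with h0 | h0
  · have h1 : ENNReal.ofReal (-v x) = 0 := ENNReal.ofReal_eq_zero.2 (by linarith)
    simp only [Pi.neg_apply] at hx
    rw [h1, ENNReal.ofReal_eq_zero] at hx
    exact le_antisymm hx h0
  · have h1 : ENNReal.ofReal (v x) = 0 := ENNReal.ofReal_eq_zero.2 h0
    simp only [Pi.neg_apply] at hx
    rw [h1, eq_comm, ENNReal.ofReal_eq_zero] at hx
    exact le_antisymm h0 (neg_nonpos.1 hx)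

/-- A family of bounded continuous functions which contains `1`, is closed under products and
conjugation and separates points determines integrable functions. -/
lemma ae_eq_zero_of_integral_mul_eq_zero {X J : Type*} [TopologicalSpace X] [PolishSpace X]
    [MeasurableSpace X] [BorelSpace X] {ν : Measure X} (e : J → X →ᵇ ℂ)
    (hone : ∃ j, e j = 1) (hmul : ∀ j k, ∃ l, e l = e j * e k) (hstar : ∀ j, ∃ k, e k = star (e j))
    (hsep : ∀ x y, x ≠ y → ∃ j, e j x ≠ e j y) {v : X → ℂ} (hv : Integrable v ν)
    (h : ∀ j, ∫ x, v x * e j x ∂ν = 0) : v =ᵐ[ν] 0 := by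
  have hb : ∀ (u : X → ℂ) (j : J), Integrable u ν → Integrable (fun x => u x * e j x) ν :=
    fun u j hu => hu.mul_bdd (c := ‖e j‖) (e j).continuous.aestronglyMeasurable
      (Filter.Eventually.of_forall (e j).norm_coe_le_norm)
  -- Closure under conjugation carries the hypothesis over to the conjugate of `v`, and so to its
  -- real and imaginary parts.
  have hconj : ∀ j, ∫ x, starRingEnd ℂ (v x) * e j x ∂ν = 0 := fun j => by
    obtain ⟨k, hk⟩ := hstar j
    have h1 : ∀ x, starRingEnd ℂ (v x) * e j x = starRingEnd ℂ (v x * e k x) := fun x => by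
      rw [hk]; simp
    simp_rw [h1]
    rw [integral_conj, h k, map_zero]
  have hcv : Integrable (fun x => starRingEnd ℂ (v x)) ν :=
    (Complex.conjCLE : ℂ →L[ℝ] ℂ).integrable_comp hv
  have hre : (fun x => (v x).re) =ᵐ[ν] 0 := by
    refine ae_eq_zero_of_integral_mul_eq_zero_real e hone hmul hstar hsep hv.re fun j => ?_
    have h1 : ∀ x, ((RCLike.re (v x) : ℝ) : ℂ) * e j x =
        (1 / 2) * (v x * e j x) + (1 / 2) * (starRingEnd ℂ (v x) * e j x) := fun x => by
      rw [RCLike.re_to_complex, Complex.re_eq_add_conj]; ring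
    refine (integral_congr_ae (Filter.Eventually.of_forall h1)).trans ?_
    rw [integral_add ((hb _ j hv).const_mul _) ((hb _ j hcv).const_mul _), integral_const_mul,
      integral_const_mul, h j, hconj j]
    simp
  have him : (fun x => (v x).im) =ᵐ[ν] 0 := by
    refine ae_eq_zero_of_integral_mul_eq_zero_real e hone hmul hstar hsep hv.im fun j => ?_
    have h1 : ∀ x, ((RCLike.im (v x) : ℝ) : ℂ) * e j x =
        (1 / (2 * Complex.I)) * (v x * e j x) -
          (1 / (2 * Complex.I)) * (starRingEnd ℂ (v x) * e j x) := fun x => by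
      rw [RCLike.im_to_complex, Complex.im_eq_sub_conj]; ring
    refine (integral_congr_ae (Filter.Eventually.of_forall h1)).trans ?_
    rw [integral_sub ((hb _ j hv).const_mul _) ((hb _ j hcv).const_mul _), integral_const_mul,
      integral_const_mul, h j, hconj j]
    simp
  filter_upwards [hre, him] with x h1 h2
  exact Complex.ext h1 h2

/-- Functions of `v ∈ ℝ^d` depending on a parameter, closed under partial derivatives and decaying
rapidly: all of them are smooth with rapidly decaying derivatives. -/
lemma contDiff_and_decay_of_family {d : ℕ} {J X : Type*} (f : J → X → (Fin d → ℝ) → ℂ)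
    (f' : J → Fin d → J) (wt : X → (Fin d → ℝ) → ℝ) (hwt : ∀ x v, 0 ≤ wt x v)
    (hf : ∀ j x v, HasFDerivAt (f j x)
      (∑ i, (f (f' j i) x v) • (Complex.ofRealCLM.comp
        (ContinuousLinearMap.proj (R := ℝ) (φ := fun _ : Fin d => ℝ) i))) v)
    (h0 : ∀ j (k : ℕ), ∃ C, ∀ x v, wt x v ^ k * ‖f j x v‖ ≤ C) :
    (∀ j x, ContDiff ℝ ∞ (f j x)) ∧
      ∀ (n : ℕ) j (k : ℕ), ∃ C, ∀ x v, wt x v ^ k * ‖iteratedFDeriv ℝ n (f j x) v‖ ≤ C := by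
  let p : Fin d → (Fin d → ℝ) →L[ℝ] ℂ := fun i => Complex.ofRealCLM.comp
        (ContinuousLinearMap.proj (R := ℝ) (φ := fun _ : Fin d => ℝ) i)
  have hfd : ∀ j x, fderiv ℝ (f j x) = fun v => ∑ i, f (f' j i) x v • p i :=
    fun j x => funext fun v => (hf j x v).fderiv
  have hs : ∀ j x, ContDiff ℝ ∞ (f j x) := by
    intro j x
    refine contDiff_infty.2 fun n => ?_
    -- The induction must range over all members, since the derivative of one is a combination of
    -- others.
    induction n generalizing j with
    | zero =>
      exact contDiff_zero.2 (continuous_iff_continuousAt.2 fun v => (hf j x v).continuousAt)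
    | succ n ih =>
      refine contDiff_succ_iff_hasFDerivAt.2 ⟨fun v => ∑ i, f (f' j i) x v • p i, ?_, hf j x⟩
      exact ContDiff.sum fun i _ => (ih (f' j i)).smul contDiff_const
  refine ⟨hs, fun n => ?_⟩
  induction n with
  | zero =>
    intro j k
    obtain ⟨C, hC⟩ := h0 j k
    exact ⟨C, fun x v => by rw [norm_iteratedFDeriv_zero]; exact hC x v⟩
  | succ n ih =>
    intro j k
    choose C hC using fun i => ih (f' j i) k
    refine ⟨∑ i, C i * ‖p i‖, fun x v => ?_⟩
    have hn : ((n : ℕ∞) : WithTop ℕ∞) ≤ ∞ := by exact_mod_cast le_top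
    rw [← norm_iteratedFDeriv_fderiv, hfd]
    have h1 : ‖iteratedFDeriv ℝ n (fun v => ∑ i, f (f' j i) x v • p i) v‖ ≤
        ∑ i, ‖iteratedFDeriv ℝ n (f (f' j i) x) v‖ * ‖p i‖ := by
      rw [iteratedFDeriv_fun_sum_apply (f := fun i v => f (f' j i) x v • p i) fun i _ =>
        (((hs (f' j i) x).smul contDiff_const).of_le hn).contDiffAt]
      refine (norm_sum_le _ _).trans (Finset.sum_le_sum fun i _ => ?_)
      -- The map `z ↦ z • p i`, of operator norm at most `‖p i‖`, commutes with iterated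
      -- derivatives.
      let S : ℂ →L[ℝ] ((Fin d → ℝ) →L[ℝ] ℂ) :=
        (ContinuousLinearMap.lsmul ℝ ℂ).flip (p i)
      have h2 := S.norm_iteratedFDeriv_comp_left (n := n) ((hs (f' j i) x).contDiffAt (x := v)) hn
      refine h2.trans ?_
      rw [mul_comm]
      refine mul_le_mul_of_nonneg_left ?_ (norm_nonneg _)
      refine ContinuousLinearMap.opNorm_le_bound _ (norm_nonneg _) fun z => ?_
      change ‖z • p i‖ ≤ _
      rw [norm_smul, mul_comm]
    calc wt x v ^ k * ‖iteratedFDeriv ℝ n (fun v => ∑ i, f (f' j i) x v • p i) v‖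
        ≤ wt x v ^ k * ∑ i, ‖iteratedFDeriv ℝ n (f (f' j i) x) v‖ * ‖p i‖ :=
          mul_le_mul_of_nonneg_left h1 (pow_nonneg (hwt x v) k)
      _ = ∑ i, (wt x v ^ k * ‖iteratedFDeriv ℝ n (f (f' j i) x) v‖) * ‖p i‖ := by
          rw [Finset.mul_sum]; exact Finset.sum_congr rfl fun i _ => by ring
      _ ≤ _ := Finset.sum_le_sum fun i _ =>
          mul_le_mul_of_nonneg_right (hC i x v) (norm_nonneg _)

/-! ### Schwartz functions on the product domain. -/

lemma Factor.isOpenQuotientMap_proj (γ : Factor) : IsOpenQuotientMap γ.proj := by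
  refine ⟨γ.proj_surjective, γ.continuous_proj, ?_⟩
  cases γ with
  | line => exact IsOpenMap.id (X := ℝ)
  | circle L _ => exact QuotientAddGroup.isOpenMap_coe (G := ℝ) (N := AddSubgroup.zmultiples L)

variable {d : ℕ} {Γ : Fin d → Factor}

/-- The real coordinates of a point, `0` in the periodic directions. -/
def coordVec (x : Domain Γ) : Fin d → ℝ := fun i => (Γ i).coord (x i)

/-- The canonical projection `ℝ^d → Γ`. -/
def projVec (Γ : Fin d → Factor) (v : Fin d → ℝ) : Domain Γ := fun i => (Γ i).proj (v i)

/-- The `i`-th coordinate on `ℝ^d`, as a complex number. -/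
def coordCLM (i : Fin d) : (Fin d → ℝ) →L[ℝ] ℂ :=
  Complex.ofRealCLM.comp (ContinuousLinearMap.proj (R := ℝ) (φ := fun _ : Fin d => ℝ) i)

@[simp] lemma coordCLM_apply (i : Fin d) (v : Fin d → ℝ) : coordCLM i v = (v i : ℂ) := rfl

/-- Openness matters: products of open quotient maps are again quotient maps, so continuity on the
domain may be checked on lifts. -/
lemma isOpenQuotientMap_projVec (Γ : Fin d → Factor) : IsOpenQuotientMap (projVec Γ) :=
  IsOpenQuotientMap.piMap fun i => (Γ i).isOpenQuotientMap_proj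

lemma projVec_add (v w : Fin d → ℝ) : projVec Γ (v + w) = projVec Γ v + projVec Γ w :=
  funext fun i => (Γ i).proj_add _ _

lemma projVec_single (j : Fin d) (t : ℝ) :
    projVec Γ (Pi.single j t) = Pi.single j ((Γ j).proj t) := by
  funext i
  by_cases h : i = j
  · subst h; simp [projVec]
  · simp [projVec, Pi.single_eq_of_ne h, Factor.proj_zero]

lemma decay_eq (k n : ℕ) (f : Domain Γ → ℂ) (v : Fin d → ℝ) :
    decay Γ k n f v =
      ‖coordVec (projVec Γ v)‖ ^ k * ‖iteratedFDeriv ℝ n (lift Γ f) v‖ := by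
  unfold decay coordVec projVec
  simp only [Factor.coord_proj]

/-- A set of rapidly decaying functions closed under partial derivatives consists of Schwartz
functions. -/
lemma mem_schwartzSubmodule_of_family (P : Set (Domain Γ → ℂ))
    (hdecay : ∀ f ∈ P, ∀ k : ℕ, ∃ C, ∀ x, ‖coordVec x‖ ^ k * ‖f x‖ ≤ C)
    (hderiv : ∀ f ∈ P, ∃ f' : Fin d → Domain Γ → ℂ, (∀ i, f' i ∈ P) ∧
      ∀ v, HasFDerivAt (lift Γ f) (∑ i, f' i (projVec Γ v) • coordCLM i) v)
    {f : Domain Γ → ℂ} (hf : f ∈ P) : f ∈ schwartzSubmodule Γ := by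
  choose F hF hF' using hderiv
  have h := contDiff_and_decay_of_family (J := P) (X := Unit) (fun j _ v => lift Γ j.1 v)
    (fun j i => ⟨F j.1 j.2 i, hF j.1 j.2 i⟩) (fun _ v => ‖coordVec (projVec Γ v)‖)
    (fun _ _ => norm_nonneg _) (fun j _ v => hF' j.1 j.2 v) (fun j k => by
      obtain ⟨C, hC⟩ := hdecay j.1 j.2 k
      exact ⟨C, fun _ v => hC _⟩)
  refine ⟨h.1 ⟨f, hf⟩ (), fun k n => ?_⟩
  obtain ⟨C, hC⟩ := h.2 n ⟨f, hf⟩ k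
  refine ⟨C, ?_⟩
  rintro _ ⟨v, rfl⟩
  rw [decay_eq]
  exact hC () v

/-- The partial derivative of a function on `Γ`. -/
def partialDeriv (j : Fin d) (f : Domain Γ → ℂ) (x : Domain Γ) : ℂ :=
  deriv (fun t : ℝ => f (x + Pi.single j ((Γ j).proj t))) 0

section Schwartz

variable {ψ : Domain Γ → ℂ}

lemma continuous_of_mem_schwartz (hψ : ψ ∈ schwartzSubmodule Γ) : Continuous ψ :=
  (isOpenQuotientMap_projVec Γ).isQuotientMap.continuous_iff.2 hψ.1.continuous

lemma lift_add_single (f : Domain Γ → ℂ) (v : Fin d → ℝ) (j : Fin d) (t : ℝ) :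
    f (projVec Γ v + Pi.single j ((Γ j).proj t)) = lift Γ f (v + t • Pi.single j (1 : ℝ)) := by
  have : t • (Pi.single j (1 : ℝ) : Fin d → ℝ) = Pi.single j t := by
    rw [← Pi.single_smul]; simp
  rw [this, ← projVec_single, ← projVec_add]
  rfl

lemma hasDerivAt_lift_line (hψ : ψ ∈ schwartzSubmodule Γ) (v : Fin d → ℝ) (j : Fin d) :
    HasDerivAt (fun t : ℝ => ψ (projVec Γ v + Pi.single j ((Γ j).proj t)))
      (fderiv ℝ (lift Γ ψ) v (Pi.single j 1)) 0 := by
  simp_rw [lift_add_single]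
  have h1 : HasFDerivAt (lift Γ ψ) (fderiv ℝ (lift Γ ψ) v) (v + (0 : ℝ) • Pi.single j (1 : ℝ)) := by
    rw [zero_smul, add_zero]
    exact (hψ.1.differentiable (by simp) v).hasFDerivAt
  have h2 : HasDerivAt (fun t : ℝ => v + t • (Pi.single j (1 : ℝ) : Fin d → ℝ))
      (Pi.single j 1) 0 := by
    simpa using ((hasDerivAt_id (0 : ℝ)).smul_const (Pi.single j (1 : ℝ) : Fin d → ℝ)).const_add v
  exact h1.comp_hasDerivAt (0 : ℝ) h2

lemma partialDeriv_projVec (hψ : ψ ∈ schwartzSubmodule Γ) (j : Fin d) (v : Fin d → ℝ) :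
    partialDeriv j ψ (projVec Γ v) = fderiv ℝ (lift Γ ψ) v (Pi.single j 1) :=
  (hasDerivAt_lift_line hψ v j).deriv

lemma hasDerivAt_add_single (hψ : ψ ∈ schwartzSubmodule Γ) (j : Fin d) (x : Domain Γ) (t : ℝ) :
    HasDerivAt (fun t : ℝ => ψ (x + Pi.single j ((Γ j).proj t)))
      (partialDeriv j ψ (x + Pi.single j ((Γ j).proj t))) t := by
  -- Lift the moved point rather than `x`; the derivative at `t` is then a derivative at `0` along
  -- the shifted line.
  obtain ⟨v, hv⟩ := (isOpenQuotientMap_projVec Γ).surjective (x + Pi.single j ((Γ j).proj t))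
  rw [← hv, partialDeriv_projVec hψ]
  have h := hasDerivAt_lift_line hψ v j
  rw [hv] at h
  have e : ∀ u : ℝ, x + Pi.single j ((Γ j).proj t) + Pi.single j ((Γ j).proj u) =
      x + Pi.single j ((Γ j).proj (t + u)) := fun u => by
    rw [add_assoc, ← Pi.single_add, ← Factor.proj_add]
  simp_rw [e] at h
  have h' := HasDerivAt.comp_sub_const t t (f := fun u => ψ (x + Pi.single j ((Γ j).proj (t + u))))
    (f' := fderiv ℝ (lift Γ ψ) v (Pi.single j 1)) (by rwa [sub_self])
  simpa using h'

lemma hasFDerivAt_lift (hψ : ψ ∈ schwartzSubmodule Γ) (v : Fin d → ℝ) :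
    HasFDerivAt (lift Γ ψ) (∑ i, partialDeriv i ψ (projVec Γ v) • coordCLM i) v := by
  have h := (hψ.1.differentiable (by simp) v).hasFDerivAt
  have e : (∑ i, partialDeriv i ψ (projVec Γ v) • coordCLM i) = fderiv ℝ (lift Γ ψ) v := by
    ext w
    conv_rhs => rw [← Finset.univ_sum_single w]
    rw [map_sum, sum_apply]
    refine Finset.sum_congr rfl fun i _ => ?_
    have : (Pi.single i (w i) : Fin d → ℝ) = w i • Pi.single i (1 : ℝ) := by
      rw [← Pi.single_smul]; simp
    rw [this, map_smul, partialDeriv_projVec hψ]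
    simp [mul_comm]
  rw [e]; exact h

lemma partialDeriv_mem_schwartz (hψ : ψ ∈ schwartzSubmodule Γ) (j : Fin d) :
    partialDeriv j ψ ∈ schwartzSubmodule Γ := by
  have e : lift Γ (partialDeriv j ψ) = fun v => fderiv ℝ (lift Γ ψ) v (Pi.single j 1) :=
    funext fun v => partialDeriv_projVec hψ j v
  have hs : ContDiff ℝ ∞ (fderiv ℝ (lift Γ ψ)) := hψ.1.fderiv_right (by exact_mod_cast le_top)
  refine ⟨?_, fun k n => ?_⟩
  · rw [e]; exact hs.clm_apply contDiff_const
  -- One derivative is spent on the partial derivative, whose direction has norm one.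
  · obtain ⟨C, hC⟩ := hψ.2 k (n + 1)
    refine ⟨C, ?_⟩
    rintro _ ⟨v, rfl⟩
    refine le_trans ?_ (hC ⟨v, rfl⟩)
    unfold decay
    refine mul_le_mul_of_nonneg_left ?_ (by positivity)
    have hn : ((n : ℕ∞) : WithTop ℕ∞) ≤ ∞ := by exact_mod_cast le_top
    rw [e, ← norm_iteratedFDeriv_fderiv]
    refine (norm_iteratedFDeriv_clm_apply_const hs.contDiffAt hn).trans ?_
    rw [Pi.norm_single, norm_one, one_mul]

lemma exists_decay_of_mem_schwartz (hψ : ψ ∈ schwartzSubmodule Γ) (k : ℕ) :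
    ∃ C, ∀ x, ‖coordVec x‖ ^ k * ‖ψ x‖ ≤ C := by
  obtain ⟨C, hC⟩ := hψ.2 k 0
  refine ⟨C, fun x => ?_⟩
  obtain ⟨v, rfl⟩ := (isOpenQuotientMap_projVec Γ).surjective x
  have := hC ⟨v, rfl⟩
  rwa [decay_eq, norm_iteratedFDeriv_zero] at this

/-- Multiplication by a real coordinate. -/
def mulCoord (j : Fin d) (f : Domain Γ → ℂ) (x : Domain Γ) : ℂ := (coordVec x j : ℂ) * f x

lemma Factor.exists_hasDerivAt_realCoord (γ : Factor) :
    ∃ c : ℝ, ∀ t, HasDerivAt γ.realCoord c t := by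
  cases γ with
  | line => exact ⟨1, fun t => hasDerivAt_id t⟩
  | circle _ _ => exact ⟨0, fun t => hasDerivAt_const t 0⟩

/-- By the Leibniz rule the functions `φ + x_j ψ` with Schwartz `φ`, `ψ` form a class closed under
partial derivatives: `∂_i` gives `(∂_i φ + c δ_ij ψ) + x_j ∂_i ψ`, with `c = 1` on a line and `c =
0` on a circle. -/
lemma mulCoord_mem_schwartz (hψ : ψ ∈ schwartzSubmodule Γ) (j : Fin d) :
    mulCoord j ψ ∈ schwartzSubmodule Γ := by
  obtain ⟨c, hc⟩ := (Γ j).exists_hasDerivAt_realCoord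
  let P : Set (Domain Γ → ℂ) :=
    {f | ∃ φ ∈ schwartzSubmodule Γ, ∃ ψ ∈ schwartzSubmodule Γ, f = φ + mulCoord j ψ}
  refine mem_schwartzSubmodule_of_family P ?_ ?_ (f := mulCoord j ψ)
    ⟨0, zero_mem _, ψ, hψ, (zero_add _).symm⟩
  · rintro _ ⟨φ, hφ, ψ, hψ, rfl⟩ k
    obtain ⟨A, hA⟩ := exists_decay_of_mem_schwartz hφ k
    obtain ⟨B, hB⟩ := exists_decay_of_mem_schwartz hψ (k + 1)
    refine ⟨A + B, fun x => ?_⟩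
    have h1 : ‖(φ + mulCoord j ψ) x‖ ≤ ‖φ x‖ + ‖coordVec x‖ * ‖ψ x‖ := by
      refine (norm_add_le _ _).trans (add_le_add le_rfl ?_)
      rw [mulCoord, norm_mul, Complex.norm_real]
      exact mul_le_mul_of_nonneg_right (norm_le_pi_norm (coordVec x) j) (norm_nonneg _)
    calc ‖coordVec x‖ ^ k * ‖(φ + mulCoord j ψ) x‖
        ≤ ‖coordVec x‖ ^ k * (‖φ x‖ + ‖coordVec x‖ * ‖ψ x‖) :=
          mul_le_mul_of_nonneg_left h1 (by positivity)
      _ = ‖coordVec x‖ ^ k * ‖φ x‖ + ‖coordVec x‖ ^ (k + 1) * ‖ψ x‖ := by ring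
      _ ≤ A + B := add_le_add (hA x) (hB x)
  · rintro _ ⟨φ, hφ, ψ, hψ, rfl⟩
    refine ⟨fun i => (partialDeriv i φ + (if i = j then (c : ℂ) else 0) • ψ) +
      mulCoord j (partialDeriv i ψ), fun i => ⟨_, add_mem (partialDeriv_mem_schwartz hφ i)
        (Submodule.smul_mem _ _ hψ), _, partialDeriv_mem_schwartz hψ i, rfl⟩, fun v => ?_⟩
    have h1 : HasFDerivAt (fun v : Fin d → ℝ => (((Γ j).realCoord (v j) : ℝ) : ℂ))
        ((c : ℂ) • coordCLM j) v := by
      have h2 : HasFDerivAt (fun v : Fin d → ℝ => v j)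
        (ContinuousLinearMap.proj (R := ℝ) (φ := fun _ : Fin d => ℝ) j) v :=
        (ContinuousLinearMap.proj (R := ℝ) (φ := fun _ : Fin d => ℝ) j).hasFDerivAt
      have h3 := Complex.ofRealCLM.hasFDerivAt.comp v ((hc (v j)).comp_hasFDerivAt v h2)
      refine h3.congr_fderiv ?_
      ext w; simp
    have h2 : lift Γ (φ + mulCoord j ψ) = lift Γ φ +
        (fun v : Fin d → ℝ => (((Γ j).realCoord (v j) : ℝ) : ℂ)) * lift Γ ψ := by
      funext v
      simp [lift, mulCoord, coordVec, Factor.coord_proj]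
    rw [h2]
    refine ((hasFDerivAt_lift hφ v).add (h1.mul (hasFDerivAt_lift hψ v))).congr_fderiv ?_
    ext w
    simp only [add_apply, sum_apply,
      smul_apply, coordCLM_apply, smul_eq_mul, Pi.add_apply, Pi.smul_apply,
      mulCoord, coordVec, projVec, Factor.coord_proj]
    have h3 : lift Γ ψ v * ((c : ℂ) * (w j : ℂ)) =
        ∑ i, (if i = j then (c : ℂ) else 0) * ψ (projVec Γ v) * (w i : ℂ) := by
      rw [Finset.sum_eq_single j (fun i _ hi => by simp [hi]) (by simp), if_pos rfl]
      change ψ (projVec Γ v) * _ = _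
      ring
    rw [h3, Finset.mul_sum, ← Finset.sum_add_distrib, ← Finset.sum_add_distrib]
    exact Finset.sum_congr rfl fun i _ => by ring

/-- An integrable majorant of Schwartz functions. -/
def majorant (x : Domain Γ) : ℝ := ∏ i, (1 + (Γ i).coord (x i) ^ 2)⁻¹

lemma integrable_majorant : Integrable (majorant (Γ := Γ)) :=
  Integrable.fintype_prod_dep fun i => (Γ i).integrable_inv_one_add_coord_sq

lemma majorant_pos (x : Domain Γ) : 0 < majorant x :=
  Finset.prod_pos fun i _ => by positivity

/-- Two bounds, of orders `0` and `2d`, give an integrable product majorant, because `∏ (1 + c_i²) ≤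
(1 + R²)^d ≤ 2^d (1 + R^(2d))`. -/
lemma norm_le_mul_prod_inv {A B R : ℝ} {c : Fin d → ℝ} (hc : ∀ i, |c i| ≤ R) (hR : 0 ≤ R) {z : ℂ}
    (hA : ‖z‖ ≤ A) (hB : R ^ (2 * d) * ‖z‖ ≤ B) :
    ‖z‖ ≤ 2 ^ d * (A + B) * ∏ i, (1 + c i ^ 2)⁻¹ := by
  have h1 : ∏ i, (1 + c i ^ 2) ≤ 2 ^ d * (1 + R ^ (2 * d)) := by
    calc ∏ i, (1 + c i ^ 2) ≤ ∏ _i : Fin d, (1 + R ^ 2) := by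
          refine Finset.prod_le_prod (fun i _ => by positivity) fun i _ => ?_
          have h2 := pow_le_pow_left₀ (abs_nonneg _) (hc i) 2
          rw [sq_abs] at h2
          exact add_le_add le_rfl h2
      _ = (1 + R ^ 2) ^ d := by simp
      _ ≤ (2 * max 1 (R ^ 2)) ^ d := by
          refine pow_le_pow_left₀ (by positivity) ?_ d
          rw [two_mul]
          exact add_le_add (le_max_left _ _) (le_max_right _ _)
      _ ≤ 2 ^ d * (1 + R ^ (2 * d)) := by
          rw [mul_pow]
          refine mul_le_mul_of_nonneg_left ?_ (by positivity)
          rcases max_choice 1 (R ^ 2) with h | h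
          · rw [h, one_pow]; exact le_add_of_nonneg_right (by positivity)
          · rw [h, ← pow_mul]; linarith
  have h3 : 0 < ∏ i, (1 + c i ^ 2) := Finset.prod_pos fun i _ => by positivity
  rw [Finset.prod_inv_distrib, ← div_eq_mul_inv, le_div_iff₀ h3]
  calc ‖z‖ * ∏ i, (1 + c i ^ 2)
      ≤ ‖z‖ * (2 ^ d * (1 + R ^ (2 * d))) := mul_le_mul_of_nonneg_left h1 (norm_nonneg _)
    _ = 2 ^ d * (‖z‖ + R ^ (2 * d) * ‖z‖) := by ring
    _ ≤ _ := mul_le_mul_of_nonneg_left (add_le_add hA hB) (by positivity)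

lemma norm_le_mul_majorant {A B : ℝ} (x : Domain Γ) {z : ℂ} (hA : ‖z‖ ≤ A)
    (hB : ‖coordVec x‖ ^ (2 * d) * ‖z‖ ≤ B) : ‖z‖ ≤ 2 ^ d * (A + B) * majorant x :=
  norm_le_mul_prod_inv (norm_le_pi_norm (coordVec x)) (norm_nonneg _) hA hB

lemma exists_norm_le_majorant (hψ : ψ ∈ schwartzSubmodule Γ) :
    ∃ C, 0 ≤ C ∧ ∀ x, ‖ψ x‖ ≤ C * majorant x := by
  obtain ⟨A, hA⟩ := exists_decay_of_mem_schwartz hψ 0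
  obtain ⟨B, hB⟩ := exists_decay_of_mem_schwartz hψ (2 * d)
  have key : ∀ x, ‖ψ x‖ ≤ 2 ^ d * (A + B) * majorant x := fun x =>
    norm_le_mul_majorant x (by simpa using hA x) (hB x)
  refine ⟨_, ?_, key⟩
  exact nonneg_of_mul_nonneg_left ((norm_nonneg _).trans (key 0)) (majorant_pos 0)

lemma integrable_of_mem_schwartz (hψ : ψ ∈ schwartzSubmodule Γ) : Integrable ψ := by
  obtain ⟨C, _, hC⟩ := exists_norm_le_majorant hψ
  exact (integrable_majorant.const_mul C).mono'
    (continuous_of_mem_schwartz hψ).aestronglyMeasurable (Filter.Eventually.of_forall hC)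

end Schwartz

/-! ### Characters of the product, injectivity of the Fourier transform, kernel integrals. -/

variable {d : ℕ} {Γ : Fin d → Factor}

/-- The character `exp (-2πi ξ·x)` of `Γ`. -/
def character (ξ : DualDomain Γ) (x : Domain Γ) : ℂ := ∏ i, (Γ i).char (ξ i) (x i)

/-- The normalization of the Fourier transform. -/
def normConst (Γ : Fin d → Factor) : ℂ := ((∏ i, (Γ i).normalization : ℝ) : ℂ)

/-- The unitary Fourier transform of a function on `Γ`, inverse to `dualFourier`. -/
def spaceFourier (ψ : Domain Γ → ℂ) (ξ : DualDomain Γ) : ℂ :=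
  normConst Γ * ∫ x, ψ x * starRingEnd ℂ (character ξ x)

lemma dualFourier_eq (φ : DualDomain Γ → ℂ) (x : Domain Γ) :
    dualFourier φ x = normConst Γ * ∫ ξ, φ ξ * character ξ x := rfl

lemma norm_character (ξ : DualDomain Γ) (x : Domain Γ) : ‖character ξ x‖ = 1 := by
  rw [character, norm_prod]
  exact Finset.prod_eq_one fun i _ => (Γ i).norm_char _ _

lemma norm_conj_character (ξ : DualDomain Γ) (x : Domain Γ) :
    ‖starRingEnd ℂ (character ξ x)‖ = 1 := by
  rw [RCLike.norm_conj, norm_character]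

lemma character_add_left (ξ η : DualDomain Γ) (x : Domain Γ) :
    character (ξ + η) x = character ξ x * character η x := by
  simp only [character, ← Finset.prod_mul_distrib]
  exact Finset.prod_congr rfl fun i _ => (Γ i).char_add_left _ _ _

lemma character_add_right (ξ : DualDomain Γ) (x y : Domain Γ) :
    character ξ (x + y) = character ξ x * character ξ y := by
  simp only [character, ← Finset.prod_mul_distrib]
  exact Finset.prod_congr rfl fun i _ => (Γ i).char_add_right _ _ _

lemma character_neg_left (ξ : DualDomain Γ) (x : Domain Γ) :
    character (-ξ) x = starRingEnd ℂ (character ξ x) := by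
  simp only [character, map_prod]
  exact Finset.prod_congr rfl fun i _ => (Γ i).char_neg_left _ _

lemma character_neg_right (ξ : DualDomain Γ) (x : Domain Γ) :
    character ξ (-x) = starRingEnd ℂ (character ξ x) := by
  simp only [character, map_prod]
  exact Finset.prod_congr rfl fun i _ => (Γ i).char_neg_right _ _

lemma character_zero_left (x : Domain Γ) : character (0 : DualDomain Γ) x = 1 :=
  Finset.prod_eq_one fun i _ => (Γ i).char_zero_left _

lemma character_zero_right (ξ : DualDomain Γ) : character ξ (0 : Domain Γ) = 1 :=
  Finset.prod_eq_one fun i _ => (Γ i).char_zero_right _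

lemma continuous_character :
    Continuous fun p : DualDomain Γ × Domain Γ => character p.1 p.2 := by
  refine continuous_finsetProd _ fun i _ => ?_
  have h : Continuous fun p : DualDomain Γ × Domain Γ =>
      ((p.1 i, p.2 i) : (Γ i).Dual × (Γ i).Space) := by fun_prop
  exact (Γ i).continuous_char.comp h

lemma continuous_character_left (x : Domain Γ) : Continuous fun ξ => character ξ x :=
  continuous_character.comp (continuous_id.prodMk continuous_const)

lemma continuous_character_right (ξ : DualDomain Γ) : Continuous fun x => character ξ x :=
  continuous_character.comp (continuous_const.prodMk continuous_id)

lemma character_single_right (ξ : DualDomain Γ) (j : Fin d) (y : (Γ j).Space) :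
    character ξ (Pi.single j y) = (Γ j).char (ξ j) y := by
  rw [character, Finset.prod_eq_single j]
  · simp
  · intro i _ hi
    rw [Pi.single_eq_of_ne hi, Factor.char_zero_right]
  · simp

lemma character_single_left (j : Fin d) (η : (Γ j).Dual) (x : Domain Γ) :
    character (Pi.single j η) x = (Γ j).char η (x j) := by
  rw [character, Finset.prod_eq_single j]
  · simp
  · intro i _ hi
    rw [Pi.single_eq_of_ne hi, Factor.char_zero_left]
  · simp

/-- The Fourier transform is injective on integrable functions on `Γ`. -/
lemma ae_eq_zero_of_integral_character_eq_zero {u : Domain Γ → ℂ} (hu : Integrable u)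
    (h : ∀ ξ : DualDomain Γ, ∫ x, u x * character ξ x = 0) : u =ᵐ[volume] 0 := by
  refine ae_eq_zero_of_integral_mul_eq_zero
    (fun ξ : DualDomain Γ => BoundedContinuousFunction.ofNormedAddCommGroup
      (fun x => character ξ x) (continuous_character_right ξ) 1 fun x => (norm_character ξ x).le)
    ⟨0, ?_⟩ (fun ξ η => ⟨ξ + η, ?_⟩) (fun ξ => ⟨-ξ, ?_⟩) (fun x y hxy => ?_) hu h
  · ext x; exact character_zero_left x
  · ext x; exact character_add_left ξ η x
  · ext x; exact character_neg_left ξ x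
  · obtain ⟨i, hi⟩ := Function.ne_iff.1 hxy
    -- Points differing in one coordinate are separated by a character supported in that coordinate.
    obtain ⟨η, hη⟩ := (Γ i).exists_char_ne_one_of_ne_zero (sub_ne_zero.2 hi)
    refine ⟨Pi.single i η, fun h => hη ?_⟩
    change character (Pi.single i η) x = character (Pi.single i η) y at h
    rw [character_single_left, character_single_left] at h
    have hne : (Γ i).char η (y i) ≠ 0 :=
      norm_ne_zero_iff.1 (by rw [Factor.norm_char]; exact one_ne_zero)
    have h2 := (Γ i).char_add_right η (x i - y i) (y i)
    rw [sub_add_cancel, h] at h2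
    exact (mul_eq_right₀ hne).1 h2.symm

/-- The Fourier transform is injective on integrable functions on the dual group. -/
lemma ae_eq_zero_of_integral_dual_character_eq_zero {u : DualDomain Γ → ℂ} (hu : Integrable u)
    (h : ∀ x : Domain Γ, ∫ ξ, u ξ * character ξ x = 0) : u =ᵐ[volume] 0 := by
  refine ae_eq_zero_of_integral_mul_eq_zero
    (fun x : Domain Γ => BoundedContinuousFunction.ofNormedAddCommGroup
      (fun ξ => character ξ x) (continuous_character_left x) 1 fun ξ => (norm_character ξ x).le)
    ⟨0, ?_⟩ (fun x y => ⟨x + y, ?_⟩) (fun x => ⟨-x, ?_⟩) (fun ξ η hξη => ?_) hu h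
  · ext ξ; exact character_zero_right ξ
  · ext ξ; exact character_add_right ξ x y
  · ext ξ; exact character_neg_right ξ x
  · obtain ⟨i, hi⟩ := Function.ne_iff.1 hξη
    obtain ⟨y, hy⟩ := (Γ i).exists_char_ne_one_of_dual_ne_zero (sub_ne_zero.2 hi)
    refine ⟨Pi.single i y, fun h => hy ?_⟩
    change character ξ (Pi.single i y) = character η (Pi.single i y) at h
    rw [character_single_right, character_single_right] at h
    have hne : (Γ i).char (η i) y ≠ 0 :=
      norm_ne_zero_iff.1 (by rw [Factor.norm_char]; exact one_ne_zero)
    have h2 := (Γ i).char_add_left (ξ i - η i) (η i) y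
    rw [sub_add_cancel, h] at h2
    exact (mul_eq_right₀ hne).1 h2.symm

/-- The Fubini theorem for a bounded continuous kernel. -/
lemma integral_kernel_swap {X Y : Type*} [TopologicalSpace X] [TopologicalSpace Y]
    [SecondCountableTopology X] [SecondCountableTopology Y]
    [MeasurableSpace X] [MeasurableSpace Y] [BorelSpace X] [BorelSpace Y]
    {μ : Measure X} {ν : Measure Y} [SFinite μ] [SFinite ν] {F : X → ℂ} {G : Y → ℂ}
    (hF : Integrable F μ) (hG : Integrable G ν) {k : X → Y → ℂ}
    (hk : Continuous fun p : X × Y => k p.1 p.2) (hk1 : ∀ x y, ‖k x y‖ ≤ 1) :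
    ∫ y, (∫ x, F x * k x y ∂μ) * G y ∂ν = ∫ x, F x * ∫ y, G y * k x y ∂ν ∂μ := by
  have h_int : Integrable (fun p : X × Y => F p.1 * G p.2 * k p.1 p.2) (μ.prod ν) :=
    (hF.mul_prod hG).mul_bdd (c := 1) hk.aestronglyMeasurable
      (Filter.Eventually.of_forall fun p => hk1 _ _)
  have h := integral_integral_swap (f := fun x y => F x * G y * k x y) h_int
  simp_rw [← integral_mul_const, ← integral_const_mul]
  refine Eq.trans ?_ (h.symm.trans ?_)
  · exact integral_congr_ae (Filter.Eventually.of_forall fun y =>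
      integral_congr_ae (Filter.Eventually.of_forall fun x => by simp only; ring))
  · exact integral_congr_ae (Filter.Eventually.of_forall fun y =>
      integral_congr_ae (Filter.Eventually.of_forall fun x => by simp only; ring))

/-- The integral of an integrable function against a bounded continuous kernel is continuous. -/
lemma continuous_integral_kernel {X Y : Type*} [TopologicalSpace X] [TopologicalSpace Y]
    [SecondCountableTopology X] [FirstCountableTopology Y] [MeasurableSpace X] [BorelSpace X]
    {μ : Measure X} {F : X → ℂ} (hF : Integrable F μ) {k : X → Y → ℂ}
    (hk : Continuous fun p : X × Y => k p.1 p.2) (hk1 : ∀ x y, ‖k x y‖ ≤ 1) :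
    Continuous fun y => ∫ x, F x * k x y ∂μ := by
  refine continuous_of_dominated (bound := fun x => ‖F x‖) (fun y => ?_) (fun y => ?_) hF.norm ?_
  · exact hF.1.mul (hk.comp (continuous_id.prodMk continuous_const)).aestronglyMeasurable
  · refine Filter.Eventually.of_forall fun x => ?_
    rw [norm_mul]
    exact mul_le_of_le_one_right (norm_nonneg _) (hk1 x y)
  · refine Filter.Eventually.of_forall fun x => ?_
    exact continuous_const.mul (hk.comp (continuous_const.prodMk continuous_id))

lemma norm_integral_kernel_le {X Y : Type*} [MeasurableSpace X] {μ : Measure X} {F : X → ℂ}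
    (hF : Integrable F μ) {k : X → Y → ℂ} (hk1 : ∀ x y, ‖k x y‖ ≤ 1) (y : Y) :
    ‖∫ x, F x * k x y ∂μ‖ ≤ ∫ x, ‖F x‖ ∂μ := by
  refine norm_integral_le_of_norm_le hF.norm (Filter.Eventually.of_forall fun x => ?_)
  rw [norm_mul]
  exact mul_le_of_le_one_right (norm_nonneg _) (hk1 x y)

/-- Translation of a frequency in the non-periodic directions. -/
def shiftVec (ξ : DualDomain Γ) (v : Fin d → ℝ) : DualDomain Γ := fun i => (Γ i).shift (ξ i) (v i)

lemma shiftVec_zero (ξ : DualDomain Γ) : shiftVec ξ 0 = ξ := funext fun i => (Γ i).shift_zero _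

lemma character_shiftVec (ξ : DualDomain Γ) (v : Fin d → ℝ) (x : Domain Γ) :
    character (shiftVec ξ v) x =
      character ξ x * Complex.exp (∑ i, -(2 * Real.pi * Complex.I * v i * coordVec x i)) := by
  rw [Complex.exp_sum]
  simp only [character, ← Finset.prod_mul_distrib]
  exact Finset.prod_congr rfl fun i _ => (Γ i).char_shift _ _ _

lemma hasFDerivAt_conj_character_shiftVec (ξ : DualDomain Γ) (v : Fin d → ℝ) (x : Domain Γ) :
    HasFDerivAt (fun v => starRingEnd ℂ (character (shiftVec ξ v) x))
      (∑ i, (2 * Real.pi * Complex.I * coordVec x i *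
        starRingEnd ℂ (character (shiftVec ξ v) x)) • coordCLM i) v := by
  have e : ∀ v, starRingEnd ℂ (character (shiftVec ξ v) x) = starRingEnd ℂ (character ξ x) *
      Complex.exp (∑ i, (2 * Real.pi * Complex.I * coordVec x i) * coordCLM i v) := fun v => by
    rw [character_shiftVec, map_mul, ← Complex.exp_conj, map_sum]
    congr 2
    refine Finset.sum_congr rfl fun i _ => ?_
    simp only [map_neg, map_mul, Complex.conj_ofReal, Complex.conj_I, Complex.conj_ofNat,
      coordCLM_apply]
    ring
  simp_rw [e]
  have h1 : HasFDerivAt (fun v => ∑ i, (2 * Real.pi * Complex.I * coordVec x i) * coordCLM i v)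
      (∑ i, (2 * Real.pi * Complex.I * (coordVec x i : ℂ)) • coordCLM i) v :=
    HasFDerivAt.fun_sum fun i _ => (coordCLM i).hasFDerivAt.const_mul _
  refine (h1.cexp.const_mul (starRingEnd ℂ (character ξ x))).congr_fderiv ?_
  rw [Finset.smul_sum, Finset.smul_sum]
  refine Finset.sum_congr rfl fun i _ => ?_
  rw [smul_smul, smul_smul]
  congr 1
  ring

/-- A set of rapidly decaying functions on the dual group closed under partial derivatives
consists of Schwartz functions. -/
lemma isDualSchwartz_of_family (P : Set (DualDomain Γ → ℂ))
    (hdecay : ∀ f ∈ P, ∀ k : ℕ, ∃ C, ∀ ξ, ‖freqVec ξ‖ ^ k * ‖f ξ‖ ≤ C)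
    (hderiv : ∀ f ∈ P, ∃ f' : Fin d → DualDomain Γ → ℂ, (∀ i, f' i ∈ P) ∧
      ∀ ξ v, HasFDerivAt (fun v => f (shiftVec ξ v))
        (∑ i, f' i (shiftVec ξ v) • coordCLM i) v)
    {f : DualDomain Γ → ℂ} (hf : f ∈ P) : IsDualSchwartz f := by
  choose F hF hF' using hderiv
  have h := contDiff_and_decay_of_family (J := P) (X := DualDomain Γ)
    (fun j ξ v => j.1 (shiftVec ξ v))
    (fun j i => ⟨F j.1 j.2 i, hF j.1 j.2 i⟩) (fun ξ v => ‖freqVec (shiftVec ξ v)‖)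
    (fun _ _ => norm_nonneg _) (fun j ξ v => hF' j.1 j.2 ξ v) (fun j k => by
      obtain ⟨C, hC⟩ := hdecay j.1 j.2 k
      exact ⟨C, fun _ v => hC _⟩)
  refine ⟨h.1 ⟨f, hf⟩, fun k n => ?_⟩
  obtain ⟨C, hC⟩ := h.2 n ⟨f, hf⟩ k
  refine ⟨C, fun ξ => ?_⟩
  have := hC ξ 0
  rw [shiftVec_zero] at this
  exact this

lemma norm_freqVec_le_sum (ξ : DualDomain Γ) : ‖freqVec ξ‖ ≤ ∑ i, |(Γ i).freq (ξ i)| := by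
  rw [EuclideanSpace.norm_eq]
  refine Real.sqrt_le_iff.2 ⟨Finset.sum_nonneg fun i _ => abs_nonneg _, ?_⟩
  exact Finset.sum_sq_le_sq_sum_of_nonneg fun i _ => abs_nonneg _

/-! ### The Fourier transform preserves the Schwartz class. -/

section Transform

variable {ψ : Domain Γ → ℂ}

lemma norm_spaceFourier_le (hψ : Integrable ψ) (ξ : DualDomain Γ) :
    ‖spaceFourier ψ ξ‖ ≤ ‖normConst Γ‖ * ∫ x, ‖ψ x‖ := by
  rw [spaceFourier, norm_mul]
  exact mul_le_mul_of_nonneg_left (norm_integral_kernel_le hψ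
    (k := fun x ξ => starRingEnd ℂ (character ξ x))
    (fun x ξ => (norm_conj_character ξ x).le) ξ) (norm_nonneg _)

/-- For `|u| ≤ 1` one has `1 + c² ≤ 3 (1 + (c+u)²)`. This provides a domination uniform in small
translations, for differentiating under the integral. -/
lemma majorant_add_single_le (x : Domain Γ) (j : Fin d) {t : ℝ} (ht : |t| ≤ 1) :
    majorant (x + Pi.single j ((Γ j).proj t)) ≤ 3 * majorant x := by
  have h3 : (3 : ℝ) = ∏ i : Fin d, if i = j then 3 else 1 := by simp
  rw [majorant, majorant, h3, ← Finset.prod_mul_distrib]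
  refine Finset.prod_le_prod (fun i _ => by positivity) fun i _ => ?_
  by_cases h : i = j
  · subst h
    simp only [Pi.add_apply, Pi.single_eq_same, if_true, map_add, Factor.coord_proj]
    have ht' : |(Γ i).realCoord t| ≤ 1 := by
      cases Γ i with
      | line => exact ht
      | circle _ _ => simp [Factor.realCoord]
    generalize (Γ i).coord (x i) = c at *
    generalize (Γ i).realCoord t = u at *
    rw [← div_eq_mul_inv, inv_eq_one_div, div_le_div_iff₀ (by positivity) (by positivity)]
    have hu : u ^ 2 ≤ 1 := by rw [← sq_abs]; exact pow_le_one₀ (abs_nonneg _) ht'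
    nlinarith [sq_nonneg (c + 2 * u), sq_nonneg (c + u)]
  · simp [h]

lemma spaceFourier_translate (ψ : Domain Γ → ℂ) (y : Domain Γ) (ξ : DualDomain Γ) :
    spaceFourier (fun x => ψ (x + y)) ξ = character ξ y * spaceFourier ψ ξ := by
  have h := integral_add_right_eq_self (μ := (volume : Measure (Domain Γ)))
    (fun x => ψ x * starRingEnd ℂ (character ξ (x - y))) y
  simp only [add_sub_cancel_right] at h
  have e : ∫ x, ψ x * starRingEnd ℂ (character ξ (x - y)) =
      character ξ y * ∫ x, ψ x * starRingEnd ℂ (character ξ x) := by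
    rw [← integral_const_mul]
    refine integral_congr_ae (Filter.Eventually.of_forall fun x => ?_)
    simp only
    rw [sub_eq_add_neg, character_add_right, character_neg_right, map_mul, Complex.conj_conj]
    ring
  rw [spaceFourier, h, e, spaceFourier, mul_left_comm]

/-- Instead of integrating by parts, differentiate the transform of a translate at `t = 0` in two
ways: under the integral, and as a character times the transform. -/
lemma spaceFourier_partialDeriv (hψ : ψ ∈ schwartzSubmodule Γ) (j : Fin d) (ξ : DualDomain Γ) :
    spaceFourier (partialDeriv j ψ) ξ =
      -(2 * Real.pi * Complex.I * (Γ j).freq (ξ j)) * spaceFourier ψ ξ := by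
  have hd := partialDeriv_mem_schwartz hψ j
  obtain ⟨C, hC0, hC⟩ := exists_norm_le_majorant hd
  have hcont : Continuous fun x => starRingEnd ℂ (character ξ x) :=
    Complex.continuous_conj.comp (continuous_character_right ξ)
  have h1 : HasDerivAt (fun t : ℝ => ∫ x, ψ (x + Pi.single j ((Γ j).proj t)) *
      starRingEnd ℂ (character ξ x)) (∫ x, partialDeriv j ψ (x + Pi.single j ((Γ j).proj 0)) *
      starRingEnd ℂ (character ξ x)) 0 := by
    refine (hasDerivAt_integral_of_dominated_loc_of_deriv_le
      (F := fun (t : ℝ) x => ψ (x + Pi.single j ((Γ j).proj t)) * starRingEnd ℂ (character ξ x))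
      (F' := fun (t : ℝ) x => partialDeriv j ψ (x + Pi.single j ((Γ j).proj t)) *
        starRingEnd ℂ (character ξ x))
      (bound := fun x => C * (3 * majorant x)) (Metric.ball_mem_nhds (0 : ℝ) one_pos)
      (Filter.Eventually.of_forall fun t => ?_) ?_ ?_ ?_ ?_ ?_).2
    · exact (((continuous_of_mem_schwartz hψ).comp (continuous_add_const _)).mul
        hcont).aestronglyMeasurable
    · simp only [Factor.proj_zero, Pi.single_zero, add_zero]
      exact (integrable_of_mem_schwartz hψ).mul_bdd (c := 1) hcont.aestronglyMeasurable
        (Filter.Eventually.of_forall fun x => (norm_conj_character ξ x).le)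
    · exact (((continuous_of_mem_schwartz hd).comp (continuous_add_const _)).mul
        hcont).aestronglyMeasurable
    · refine Filter.Eventually.of_forall fun x t ht => ?_
      rw [norm_mul, norm_conj_character, mul_one]
      refine (hC _).trans (mul_le_mul_of_nonneg_left (majorant_add_single_le x j ?_) hC0)
      rw [Metric.mem_ball, dist_zero_right, Real.norm_eq_abs] at ht
      exact ht.le
    · exact (integrable_majorant.const_mul 3).const_mul C
    · exact Filter.Eventually.of_forall fun x t _ => (hasDerivAt_add_single hψ j x t).mul_const _
  have h2 := h1.const_mul (normConst Γ)
  simp only [Factor.proj_zero, Pi.single_zero, add_zero] at h2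
  have h3 : (fun t : ℝ => normConst Γ * ∫ x, ψ (x + Pi.single j ((Γ j).proj t)) *
      starRingEnd ℂ (character ξ x)) = fun t : ℝ =>
      Complex.exp (-(2 * Real.pi * Complex.I * (Γ j).freq (ξ j) * t)) * spaceFourier ψ ξ := by
    funext t
    rw [← Factor.char_proj, ← character_single_right, ← spaceFourier_translate]
    rfl
  rw [h3] at h2
  have h4 : HasDerivAt (fun t : ℝ =>
      Complex.exp (-(2 * Real.pi * Complex.I * (Γ j).freq (ξ j) * t)) * spaceFourier ψ ξ)
      (-(2 * Real.pi * Complex.I * (Γ j).freq (ξ j)) * spaceFourier ψ ξ) 0 := by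
    have h5 : HasDerivAt (fun t : ℝ => -(2 * Real.pi * Complex.I * ((Γ j).freq (ξ j) : ℂ) * (t : ℂ)))
        (-(2 * Real.pi * Complex.I * (Γ j).freq (ξ j) * 1)) 0 :=
      (Complex.ofRealCLM.hasDerivAt.const_mul _).neg
    simpa using h5.cexp.mul_const (spaceFourier ψ ξ)
  exact h2.unique h4

/-- Each power of `|ξ| ≤ ∑ |ξ_j|` is traded for one derivative of `ψ`; the factor `2π ≥ 1` is
discarded. -/
lemma exists_decay_spaceFourier (hψ : ψ ∈ schwartzSubmodule Γ) (k : ℕ) :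
    ∃ C, ∀ ξ, ‖freqVec ξ‖ ^ k * ‖spaceFourier ψ ξ‖ ≤ C := by
  induction k generalizing ψ with
  | zero =>
    exact ⟨_, fun ξ => by
      rw [pow_zero, one_mul]
      exact norm_spaceFourier_le (integrable_of_mem_schwartz hψ) ξ⟩
  | succ k ih =>
    choose C hC using fun j => ih (partialDeriv_mem_schwartz hψ j)
    refine ⟨∑ j, C j, fun ξ => ?_⟩
    have h1 : ∀ j, |(Γ j).freq (ξ j)| * ‖spaceFourier ψ ξ‖ ≤
        ‖spaceFourier (partialDeriv j ψ) ξ‖ := fun j => by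
      rw [spaceFourier_partialDeriv hψ, norm_mul]
      refine mul_le_mul_of_nonneg_right ?_ (norm_nonneg _)
      have : ‖-(2 * Real.pi * Complex.I * ((Γ j).freq (ξ j) : ℂ))‖ =
          2 * Real.pi * |(Γ j).freq (ξ j)| := by
        simp [abs_of_pos Real.pi_pos]
      rw [this]
      have := Real.pi_gt_three
      nlinarith [abs_nonneg ((Γ j).freq (ξ j))]
    calc ‖freqVec ξ‖ ^ (k + 1) * ‖spaceFourier ψ ξ‖
        = ‖freqVec ξ‖ ^ k * (‖freqVec ξ‖ * ‖spaceFourier ψ ξ‖) := by ring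
      _ ≤ ‖freqVec ξ‖ ^ k * ((∑ j, |(Γ j).freq (ξ j)|) * ‖spaceFourier ψ ξ‖) := by
          gcongr; exact norm_freqVec_le_sum ξ
      _ = ∑ j, ‖freqVec ξ‖ ^ k * (|(Γ j).freq (ξ j)| * ‖spaceFourier ψ ξ‖) := by
          rw [Finset.sum_mul, Finset.mul_sum]
      _ ≤ ∑ j, ‖freqVec ξ‖ ^ k * ‖spaceFourier (partialDeriv j ψ) ξ‖ :=
          Finset.sum_le_sum fun j _ => mul_le_mul_of_nonneg_left (h1 j) (by positivity)
      _ ≤ _ := Finset.sum_le_sum fun j _ => hC j ξ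

/-- Differentiating the conjugate character brings down `2πi x_i`, so the derivatives are again
transforms of Schwartz functions. In periodic directions the real coordinate is `0`, consistently
with the absence of motion there. -/
lemma hasFDerivAt_spaceFourier_shiftVec (hψ : ψ ∈ schwartzSubmodule Γ) (ξ : DualDomain Γ)
    (v : Fin d → ℝ) :
    HasFDerivAt (fun v => spaceFourier ψ (shiftVec ξ v))
      (∑ i, spaceFourier ((2 * Real.pi * Complex.I) • mulCoord i ψ) (shiftVec ξ v) •
        coordCLM i) v := by
  have hM : ∀ i, (2 * Real.pi * Complex.I) • mulCoord i ψ ∈ schwartzSubmodule Γ := fun i =>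
    Submodule.smul_mem _ _ (mulCoord_mem_schwartz hψ i)
  have hcont : ∀ η : DualDomain Γ, Continuous fun x => starRingEnd ℂ (character η x) := fun η =>
    Complex.continuous_conj.comp (continuous_character_right η)
  have h_int : ∀ (χ : Domain Γ → ℂ), χ ∈ schwartzSubmodule Γ → ∀ η : DualDomain Γ,
      Integrable fun x => χ x * starRingEnd ℂ (character η x) := fun χ hχ η =>
    (integrable_of_mem_schwartz hχ).mul_bdd (c := 1) (hcont η).aestronglyMeasurable
      (Filter.Eventually.of_forall fun x => (norm_conj_character η x).le)
  have h := hasFDerivAt_integral_of_dominated_of_fderiv_le (μ := (volume : Measure (Domain Γ)))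
    (F := fun v x => ψ x * starRingEnd ℂ (character (shiftVec ξ v) x))
    (F' := fun v x => ∑ i, (((2 * Real.pi * Complex.I) • mulCoord i ψ) x *
      starRingEnd ℂ (character (shiftVec ξ v) x)) • coordCLM i) (x₀ := v)
    (bound := fun x => ∑ i, ‖((2 * Real.pi * Complex.I) • mulCoord i ψ) x‖ *
      ‖coordCLM (d := d) i‖) Filter.univ_mem
    (Filter.Eventually.of_forall fun w => (h_int ψ hψ _).1) (h_int ψ hψ _)
    (by
      refine Finset.aestronglyMeasurable_fun_sum _ fun i _ => ?_
      exact (h_int _ (hM i) _).1.smul_const _)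
    (Filter.Eventually.of_forall fun x w _ => by
      refine (norm_sum_le _ _).trans (Finset.sum_le_sum fun i _ => ?_)
      rw [norm_smul, norm_mul, norm_conj_character, mul_one])
    (integrable_finsetSum _ fun i _ => (integrable_of_mem_schwartz (hM i)).norm.mul_const _)
    (Filter.Eventually.of_forall fun x w _ => by
      refine ((hasFDerivAt_conj_character_shiftVec ξ w x).const_mul (ψ x)).congr_fderiv ?_
      rw [Finset.smul_sum]
      refine Finset.sum_congr rfl fun i _ => ?_
      rw [smul_smul]
      congr 1
      simp only [Pi.smul_apply, smul_eq_mul, mulCoord]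
      ring)
  refine (h.const_mul (normConst Γ)).congr_fderiv ?_
  rw [integral_finsetSum _ fun i _ => (h_int _ (hM i) _).smul_const _, Finset.smul_sum]
  refine Finset.sum_congr rfl fun i _ => ?_
  rw [integral_smul_const, smul_smul, spaceFourier]

/-- The Fourier transform of a Schwartz function is a Schwartz function. -/
lemma isDualSchwartz_spaceFourier (hψ : ψ ∈ schwartzSubmodule Γ) :
    IsDualSchwartz (spaceFourier ψ) := by
  refine isDualSchwartz_of_family {f | ∃ χ ∈ schwartzSubmodule Γ, f = spaceFourier χ} ?_ ?_
    ⟨ψ, hψ, rfl⟩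
  · rintro _ ⟨χ, hχ, rfl⟩ k
    exact exists_decay_spaceFourier hχ k
  · rintro _ ⟨χ, hχ, rfl⟩
    exact ⟨fun i => spaceFourier ((2 * Real.pi * Complex.I) • mulCoord i χ), fun i =>
      ⟨_, Submodule.smul_mem _ _ (mulCoord_mem_schwartz hχ i), rfl⟩,
      hasFDerivAt_spaceFourier_shiftVec hχ⟩

end Transform

variable {d : ℕ} {Γ : Fin d → Factor}

/-! ### Continuity and integrability of Schwartz functions on the dual group. -/

section DualSchwartz

variable {φ : DualDomain Γ → ℂ}

lemma IsDualSchwartz.continuous (hφ : IsDualSchwartz φ) : Continuous φ := by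
  refine continuous_iff_continuousAt.2 fun ξ => ?_
  let D : DualDomain Γ → Fin d → ℝ := fun η i =>
    (Γ i).dualCoord (η i) - (Γ i).dualCoord (ξ i)
  have hD : Continuous D := continuous_pi fun i =>
    ((Γ i).continuous_dualCoord.comp (continuous_apply i)).sub continuous_const
  have h1 : ContinuousAt (fun η => slice φ ξ (D η)) ξ :=
    ((hφ.1 ξ).continuous.comp hD).continuousAt
  refine h1.congr ?_
  -- Near `ξ` every frequency is obtained by a line-direction shift, so the function agrees there
  -- with a single slice composed with a continuous map.
  have h2 : ∀ᶠ η in nhds ξ, ∀ i, (Γ i).shift (ξ i) (D η i) = η i :=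
    Filter.eventually_all.2 fun i =>
      (continuous_apply i).continuousAt.eventually ((Γ i).eventually_shift_eq (ξ i))
  filter_upwards [h2] with η hη
  exact congrArg φ (funext hη)

lemma IsDualSchwartz.exists_decay (hφ : IsDualSchwartz φ) (k : ℕ) :
    ∃ C, ∀ ξ, ‖freqVec ξ‖ ^ k * ‖φ ξ‖ ≤ C := by
  obtain ⟨C, hC⟩ := hφ.2 k 0
  refine ⟨C, fun ξ => ?_⟩
  have h := hC ξ
  have e : slice φ ξ 0 = φ ξ := congrArg φ (shiftVec_zero ξ)
  rwa [norm_iteratedFDeriv_zero, e] at h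

lemma abs_freq_le_norm (ξ : DualDomain Γ) (i : Fin d) : |(Γ i).freq (ξ i)| ≤ ‖freqVec ξ‖ :=
  PiLp.norm_apply_le (freqVec ξ) i

lemma IsDualSchwartz.integrable (hφ : IsDualSchwartz φ) : Integrable φ := by
  obtain ⟨A, hA⟩ := hφ.exists_decay 0
  obtain ⟨B, hB⟩ := hφ.exists_decay (2 * d)
  have h1 : Integrable fun ξ : DualDomain Γ => ∏ i, (1 + (Γ i).freq (ξ i) ^ 2)⁻¹ := by
    refine Integrable.fintype_prod_dep (f := fun i ξ => (1 + (Γ i).freq ξ ^ 2)⁻¹) fun i => ?_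
    have := (Γ i).integrable_one_add_freq_sq_rpow (p := 1) (by norm_num)
    simpa only [Real.rpow_neg_one] using this
  refine (h1.const_mul (2 ^ d * (A + B))).mono' hφ.continuous.aestronglyMeasurable
    (Filter.Eventually.of_forall fun ξ => ?_)
  exact norm_le_mul_prod_inv (abs_freq_le_norm ξ) (norm_nonneg _) (by simpa using hA ξ) (hB ξ)

end DualSchwartz

/-! ### Products of one-dimensional test functions -/

section Test

/-- A product of functions of one coordinate. -/
def tensor {X : Fin d → Type} (a : ∀ i, X i → ℂ) (x : ∀ i, X i) : ℂ := ∏ i, a i (x i)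

lemma tensor_update {X : Fin d → Type} (a : ∀ i, X i → ℂ) (j : Fin d) (c : X j → ℂ)
    (x : ∀ i, X i) :
    tensor (Function.update a j c) x = (∏ i ∈ Finset.univ.erase j, a i (x i)) * c (x j) := by
  rw [tensor, ← Finset.prod_erase_mul _ _ (Finset.mem_univ j), Function.update_self]
  congr 1
  exact Finset.prod_congr rfl fun i hi => by
    rw [Function.update_of_ne (Finset.ne_of_mem_erase hi)]

lemma hasFDerivAt_prod_coord {f f' : Fin d → ℝ → ℂ} {v : Fin d → ℝ}
    (h : ∀ i, HasDerivAt (f i) (f' i (v i)) (v i)) :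
    HasFDerivAt (fun v : Fin d → ℝ => ∏ i, f i (v i))
      (∑ j, ((∏ i ∈ Finset.univ.erase j, f i (v i)) * f' j (v j)) • coordCLM j) v := by
  have h1 : ∀ i, HasFDerivAt (fun v : Fin d → ℝ => f i (v i)) (f' i (v i) • coordCLM i) v :=
    fun i => by
      have h2 : HasFDerivAt (fun v : Fin d → ℝ => v i)
        (ContinuousLinearMap.proj (R := ℝ) (φ := fun _ : Fin d => ℝ) i) v :=
        (ContinuousLinearMap.proj (R := ℝ) (φ := fun _ : Fin d => ℝ) i).hasFDerivAt
      refine ((h i).hasFDerivAt.comp v h2).congr_fderiv ?_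
      ext w
      simp [mul_comm]
  refine (HasFDerivAt.finsetProd (u := Finset.univ) fun i _ => h1 i).congr_fderiv ?_
  exact Finset.sum_congr rfl fun j _ => by rw [smul_smul]

lemma sum_le_prod_one_add {ι : Type*} (s : Finset ι) {c : ι → ℝ} (hc : ∀ i, 0 ≤ c i) :
    ∑ i ∈ s, c i ≤ ∏ i ∈ s, (1 + c i) := by
  classical
  have h : 1 + ∑ i ∈ s, c i ≤ ∏ i ∈ s, (1 + c i) := by
    induction s using Finset.induction_on with
    | empty => simp
    | insert a s ha ih =>
      rw [Finset.sum_insert ha, Finset.prod_insert ha]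
      have : 0 ≤ ∑ i ∈ s, c i := Finset.sum_nonneg fun i _ => hc i
      nlinarith [hc a]
  linarith

/-- A sum of coordinates is dominated by the product of the `1 + |c_i|`, and a product weight
distributes over the factors, so the one-dimensional bounds multiply. -/
lemma exists_bound_tensor {X : Fin d → Type} {a : ∀ i, X i → ℂ} {c : ∀ i, X i → ℝ} (k : ℕ)
    (h : ∀ i, ∃ C, ∀ x, (1 + |c i x|) ^ k * ‖a i x‖ ≤ C) :
    ∃ C, ∀ (x : ∀ i, X i) (R : ℝ), 0 ≤ R → R ≤ ∑ i, |c i (x i)| → R ^ k * ‖tensor a x‖ ≤ C := by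
  choose C hC using h
  refine ⟨∏ i, C i, fun x R hR hR' => ?_⟩
  calc R ^ k * ‖tensor a x‖ ≤ (∏ i, (1 + |c i (x i)|)) ^ k * ‖tensor a x‖ := by
        gcongr
        exact hR'.trans (sum_le_prod_one_add _ fun i => abs_nonneg _)
    _ = ∏ i, ((1 + |c i (x i)|) ^ k * ‖a i (x i)‖) := by
        rw [tensor, norm_prod, ← Finset.prod_pow, Finset.prod_mul_distrib]
    _ ≤ ∏ i, C i := Finset.prod_le_prod (fun i _ => by positivity) fun i _ => hC i _

variable {a : ∀ i, (Γ i).Space → ℂ} {b : ∀ i, (Γ i).Dual → ℂ}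

/-- A partial derivative replaces one factor by its derivative, so tensor products of test functions
form a rapidly decaying class closed under differentiation. -/
lemma tensor_mem_schwartz (h : ∀ i, Factor.IsTestPair (Γ i) (a i) (b i)) :
    tensor a ∈ schwartzSubmodule Γ := by
  refine mem_schwartzSubmodule_of_family
    {f | ∃ a b, (∀ i, Factor.IsTestPair (Γ i) (a i) (b i)) ∧ f = tensor a} ?_ ?_ ⟨a, b, h, rfl⟩
  · rintro _ ⟨a, b, h, rfl⟩ k
    obtain ⟨C, hC⟩ := exists_bound_tensor (c := fun i => (Γ i).coord) k fun i => (h i).decay k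
    refine ⟨C, fun x => hC x _ (norm_nonneg _) ?_⟩
    refine (pi_norm_le_iff_of_nonneg (Finset.sum_nonneg fun i _ => abs_nonneg _)).2 fun i => ?_
    exact Finset.single_le_sum (f := fun i => |(Γ i).coord (x i)|) (fun i _ => abs_nonneg _)
      (Finset.mem_univ i)
  · rintro _ ⟨a, b, h, rfl⟩
    choose a' b' h' hd using fun i => (h i).exists_hasDerivAt
    refine ⟨fun j => tensor (Function.update a j (a' j)), fun j =>
      ⟨_, Function.update b j (b' j), fun i => ?_, rfl⟩, fun v => ?_⟩
    · by_cases hi : i = j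
      · subst hi; simpa using h' i
      · simpa [Function.update_of_ne hi] using h i
    · simp_rw [tensor_update]
      exact hasFDerivAt_prod_coord (f := fun i t => a i ((Γ i).proj t))
        (f' := fun i t => a' i ((Γ i).proj t)) fun i => hd i _

lemma tensor_isDualSchwartz (h : ∀ i, Factor.IsTestPair (Γ i) (a i) (b i)) :
    IsDualSchwartz (tensor b) := by
  refine isDualSchwartz_of_family
    {f | ∃ a b, (∀ i, Factor.IsTestPair (Γ i) (a i) (b i)) ∧ f = tensor b} ?_ ?_ ⟨a, b, h, rfl⟩
  · rintro _ ⟨a, b, h, rfl⟩ k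
    obtain ⟨C, hC⟩ := exists_bound_tensor (c := fun i => (Γ i).freq) k fun i => (h i).decay_dual k
    exact ⟨C, fun ξ => hC ξ _ (norm_nonneg _) (norm_freqVec_le_sum ξ)⟩
  · rintro _ ⟨a, b, h, rfl⟩
    choose a' b' h' hd using fun i => (h i).exists_hasDerivAt_dual
    refine ⟨fun j => tensor (Function.update b j (b' j)), fun j =>
      ⟨Function.update a j (a' j), _, fun i => ?_, rfl⟩, fun ξ v => ?_⟩
    · by_cases hi : i = j
      · subst hi; simpa using h' i
      · simpa [Function.update_of_ne hi] using h i
    · simp_rw [tensor_update]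
      exact hasFDerivAt_prod_coord (f := fun i t => b i ((Γ i).shift (ξ i) t))
        (f' := fun i t => b' i ((Γ i).shift (ξ i) t)) fun i => hd i _ _

lemma tensor_eq_dualFourier (h : ∀ i, Factor.IsTestPair (Γ i) (a i) (b i)) :
    tensor a = dualFourier (tensor b) := by
  funext x
  rw [dualFourier_eq, normConst, Complex.ofReal_prod]
  simp_rw [tensor, character, ← Finset.prod_mul_distrib]
  rw [integral_fintype_prod_volume_eq_prod fun i ξ => b i ξ * (Γ i).char ξ (x i),
    ← Finset.prod_mul_distrib]
  exact Finset.prod_congr rfl fun i _ => (h i).eq_integral_char _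

lemma tensor_eq_spaceFourier (h : ∀ i, Factor.IsTestPair (Γ i) (a i) (b i)) :
    tensor b = spaceFourier (tensor a) := by
  funext ξ
  rw [spaceFourier, normConst, Complex.ofReal_prod]
  simp_rw [tensor, character, map_prod, ← Finset.prod_mul_distrib]
  rw [integral_fintype_prod_volume_eq_prod fun i x => a i x * starRingEnd ℂ ((Γ i).char (ξ i) x),
    ← Finset.prod_mul_distrib]
  exact Finset.prod_congr rfl fun i _ => (h i).eq_integral_conj_char _

/-- Bounded continuous functions on `Γ` are determined by their integrals against products of test
functions. -/
lemma eq_zero_of_integral_tensor_eq_zero {u : Domain Γ → ℂ} (hu : Continuous u) {M : ℝ}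
    (hM : ∀ x, ‖u x‖ ≤ M)
    (h : ∀ (a : ∀ i, (Γ i).Space → ℂ) (b : ∀ i, (Γ i).Dual → ℂ),
      (∀ i, Factor.IsTestPair (Γ i) (a i) (b i)) → ∫ x, u x * tensor a x = 0) : u = 0 := by
  -- Cutting off makes `u` integrable, and cutoff times character is again a test tensor; hence the
  -- localized `u` has zero Fourier transform. By continuity it vanishes everywhere, not just a.e.
  have key : ∀ n : ℕ, (fun x => u x * tensor (fun i => (Γ i).cutoff n) x) = 0 := fun n => by
    have hpair : ∀ ξ : DualDomain Γ, ∃ b : ∀ i, (Γ i).Dual → ℂ, ∀ i,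
        Factor.IsTestPair (Γ i) (fun x => (Γ i).cutoff n x * (Γ i).char (ξ i) x) (b i) :=
      fun ξ => by
        choose b hb using fun i => (Γ i).exists_isTestPair_cutoff n (ξ i)
        exact ⟨b, hb⟩
    have hcut : Continuous (tensor fun i => (Γ i).cutoff n) :=
      continuous_finsetProd _ fun i _ =>
        ((Γ i).continuous_cutoff n).comp (continuous_apply i)
    have hmul : ∀ (ξ : DualDomain Γ) x, tensor (fun i => (Γ i).cutoff n) x * character ξ x =
        tensor (fun i x => (Γ i).cutoff n x * (Γ i).char (ξ i) x) x := fun ξ x => by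
      rw [tensor, tensor, character, ← Finset.prod_mul_distrib]
    have h_int : Integrable (tensor fun i => (Γ i).cutoff n) := by
      obtain ⟨b, hb⟩ := hpair 0
      refine (integrable_of_mem_schwartz (tensor_mem_schwartz hb)).congr
        (Filter.Eventually.of_forall fun x => ?_)
      rw [← hmul, character_zero_left, mul_one]
    have h_int' : Integrable fun x => u x * tensor (fun i => (Γ i).cutoff n) x :=
      h_int.bdd_mul (c := M) hu.aestronglyMeasurable (Filter.Eventually.of_forall hM)
    have := ae_eq_zero_of_integral_character_eq_zero h_int' fun ξ => by
      obtain ⟨b, hb⟩ := hpair ξ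
      simp_rw [mul_assoc, hmul]
      exact h _ b hb
    exact (Continuous.ae_eq_iff_eq volume (hu.mul hcut) continuous_zero).1 this
  funext x
  choose n hn using fun i => (Γ i).exists_cutoff_ne_zero (x i)
  have hx := congrFun (key (Finset.univ.sup n)) x
  simp only [Pi.zero_apply] at hx
  refine (mul_eq_zero.1 hx).resolve_right (Finset.prod_ne_zero_iff.2 fun i _ => ?_)
  exact hn i _ (Finset.le_sup (Finset.mem_univ i))

/-- Functions on the dual group are determined by their integrals against products of test
functions. -/
lemma ae_eq_zero_of_integral_dual_tensor_eq_zero {F : DualDomain Γ → ℂ}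
    (h_int : ∀ (a : ∀ i, (Γ i).Space → ℂ) (b : ∀ i, (Γ i).Dual → ℂ),
      (∀ i, Factor.IsTestPair (Γ i) (a i) (b i)) → Integrable fun ξ => F ξ * tensor b ξ)
    (h : ∀ (a : ∀ i, (Γ i).Space → ℂ) (b : ∀ i, (Γ i).Dual → ℂ),
      (∀ i, Factor.IsTestPair (Γ i) (a i) (b i)) → ∫ ξ, F ξ * tensor b ξ = 0) :
    F =ᵐ[volume] 0 := by
  have key : ∀ n : Fin d → ℕ × ℤ,
      (fun ξ => F ξ * tensor (fun i => (Γ i).dualCutoff (n i)) ξ) =ᵐ[volume] 0 := fun n => by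
    have hpair : ∀ x : Domain Γ, ∃ a : ∀ i, (Γ i).Space → ℂ, ∀ i,
        Factor.IsTestPair (Γ i) (a i) (fun ξ => (Γ i).dualCutoff (n i) ξ * (Γ i).char ξ (x i)) :=
      fun x => by
        choose a ha using fun i => (Γ i).exists_isTestPair_dualCutoff (n i) (x i)
        exact ⟨a, ha⟩
    have hmul : ∀ (ξ : DualDomain Γ) x,
        tensor (fun i => (Γ i).dualCutoff (n i)) ξ * character ξ x =
        tensor (fun i ξ => (Γ i).dualCutoff (n i) ξ * (Γ i).char ξ (x i)) ξ := fun ξ x => by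
      rw [tensor, tensor, character, ← Finset.prod_mul_distrib]
    refine ae_eq_zero_of_integral_dual_character_eq_zero ?_ fun x => ?_
    · obtain ⟨a, ha⟩ := hpair 0
      refine (h_int a _ ha).congr (Filter.Eventually.of_forall fun ξ => ?_)
      simp only
      rw [← hmul, character_zero_right, mul_one]
    · obtain ⟨a, ha⟩ := hpair x
      simp_rw [mul_assoc, hmul]
      exact h a _ ha
  -- The cutoffs are indexed by a countable set, so one null set suffices.
  filter_upwards [ae_all_iff.2 key] with ξ hξ
  choose n hn using fun i => (Γ i).exists_dualCutoff_ne_zero (ξ i)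
  have hx := hξ n
  simp only [Pi.zero_apply] at hx
  exact (mul_eq_zero.1 hx).resolve_right (Finset.prod_ne_zero_iff.2 fun i _ => hn i)

end Test

/-! ### Fourier inversion and the distributions given by bounded continuous functions. -/

variable {d : ℕ} {Γ : Fin d → Factor}

lemma conj_normConst : starRingEnd ℂ (normConst Γ) = normConst Γ := Complex.conj_ofReal _

lemma normConst_ne_zero : normConst Γ ≠ 0 := by
  refine Complex.ofReal_ne_zero.2 (Finset.prod_ne_zero_iff.2 fun i _ => ?_)
  cases Γ i with
  | line => exact one_ne_zero
  | circle L hL => exact one_div_ne_zero (Real.sqrt_pos.2 hL).ne'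

lemma continuous_conj_character :
    Continuous fun p : DualDomain Γ × Domain Γ => starRingEnd ℂ (character p.1 p.2) :=
  Complex.continuous_conj.comp continuous_character

lemma integral_dualFourier_mul {F : DualDomain Γ → ℂ} {ψ : Domain Γ → ℂ} (hF : Integrable F)
    (hψ : Integrable ψ) :
    ∫ x, dualFourier F x * ψ x = ∫ ξ, F ξ * (normConst Γ * ∫ x, ψ x * character ξ x) := by
  have h := integral_kernel_swap hF hψ continuous_character fun ξ x => (norm_character ξ x).le
  simp_rw [dualFourier_eq, mul_assoc, mul_left_comm _ (normConst Γ)]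
  rw [integral_const_mul, integral_const_mul, h]

/-- The function on `Γ` with a given Fourier transform. -/
def synthesis (F : DualDomain Γ → ℂ) (x : Domain Γ) : ℂ :=
  normConst Γ * ∫ ξ, F ξ * starRingEnd ℂ (character ξ x)

/-- By Fubini, since the conjugate character is a bounded continuous kernel. This identity mediates
between the distributional definition of `T̂` and the function `synthesis F`. -/
lemma integral_synthesis_mul {F : DualDomain Γ → ℂ} {ψ : Domain Γ → ℂ} (hF : Integrable F)
    (hψ : Integrable ψ) : ∫ x, synthesis F x * ψ x = ∫ ξ, F ξ * spaceFourier ψ ξ := by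
  have h := integral_kernel_swap hF hψ continuous_conj_character
    fun ξ x => (norm_conj_character ξ x).le
  simp_rw [synthesis, spaceFourier, mul_assoc, mul_left_comm _ (normConst Γ)]
  rw [integral_const_mul, integral_const_mul, h]

lemma continuous_synthesis {F : DualDomain Γ → ℂ} (hF : Integrable F) :
    Continuous (synthesis F) :=
  continuous_const.mul (continuous_integral_kernel hF continuous_conj_character
    fun ξ x => (norm_conj_character ξ x).le)

lemma norm_synthesis_le {F : DualDomain Γ → ℂ} (hF : Integrable F) (x : Domain Γ) :
    ‖synthesis F x‖ ≤ ‖normConst Γ‖ * ∫ ξ, ‖F ξ‖ := by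
  rw [synthesis, norm_mul]
  exact mul_le_mul_of_nonneg_left (norm_integral_kernel_le hF
    (k := fun ξ x => starRingEnd ℂ (character ξ x))
    (fun ξ x => (norm_conj_character ξ x).le) x) (norm_nonneg _)

lemma continuous_dualFourier {F : DualDomain Γ → ℂ} (hF : Integrable F) :
    Continuous (dualFourier F) :=
  continuous_const.mul (continuous_integral_kernel hF continuous_character
    fun ξ x => (norm_character ξ x).le)

lemma norm_dualFourier_le {F : DualDomain Γ → ℂ} (hF : Integrable F) (x : Domain Γ) :
    ‖dualFourier F x‖ ≤ ‖normConst Γ‖ * ∫ ξ, ‖F ξ‖ := by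
  rw [dualFourier_eq, norm_mul]
  exact mul_le_mul_of_nonneg_left (norm_integral_kernel_le hF (k := fun ξ x => character ξ x)
    (fun ξ x => (norm_character ξ x).le) x) (norm_nonneg _)

/-- Fourier inversion for Schwartz functions on `Γ`. -/
lemma dualFourier_spaceFourier {ψ : Domain Γ → ℂ} (hψ : ψ ∈ schwartzSubmodule Γ) :
    dualFourier (spaceFourier ψ) = ψ := by
  have hφ : Integrable (spaceFourier ψ) := (isDualSchwartz_spaceFourier hψ).integrable
  have hψi := integrable_of_mem_schwartz hψ
  obtain ⟨M, hM⟩ := exists_decay_of_mem_schwartz hψ 0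
  have hconjL : ∀ {X : Type} [MeasureSpace X] {u : X → ℂ}, Integrable u →
      Integrable fun x => starRingEnd ℂ (u x) := fun hu =>
    (Complex.conjCLE : ℂ →L[ℝ] ℂ).integrable_comp hu
  -- Paired with the conjugate of a test function, both `dualFourier (spaceFourier ψ)` and `ψ` give
  -- the integral of `spaceFourier ψ` against the conjugate of the test function's partner.
  -- Conjugating the difference turns this into a pairing with the test function itself.
  have key : (fun x => starRingEnd ℂ (dualFourier (spaceFourier ψ) x - ψ x)) = 0 := by
    refine eq_zero_of_integral_tensor_eq_zero
      (M := ‖normConst Γ‖ * (∫ ξ, ‖spaceFourier ψ ξ‖) + M) ?_ ?_ ?_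
    · exact Complex.continuous_conj.comp
        ((continuous_dualFourier hφ).sub (continuous_of_mem_schwartz hψ))
    · intro x
      rw [RCLike.norm_conj]
      exact (norm_sub_le _ _).trans (add_le_add (norm_dualFourier_le hφ x) (by simpa using hM x))
    · intro a b h
      have hA := tensor_mem_schwartz h
      have hAi := integrable_of_mem_schwartz hA
      have hBi := (tensor_isDualSchwartz h).integrable
      have hA' := hconjL hAi
      have hB' := hconjL hBi
      have h1 : ∫ x, dualFourier (spaceFourier ψ) x * starRingEnd ℂ (tensor a x) =
          ∫ ξ, spaceFourier ψ ξ * starRingEnd ℂ (tensor b ξ) := by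
        rw [integral_dualFourier_mul hφ hA']
        refine integral_congr_ae (Filter.Eventually.of_forall fun ξ => ?_)
        simp only
        rw [tensor_eq_spaceFourier h, spaceFourier.eq_def (tensor a), map_mul, conj_normConst, ← integral_conj]
        simp only [map_mul, Complex.conj_conj]
      have h2 : ∫ ξ, spaceFourier ψ ξ * starRingEnd ℂ (tensor b ξ) =
          ∫ x, ψ x * starRingEnd ℂ (tensor a x) := by
        have h3 := integral_synthesis_mul hB' hψi
        simp_rw [mul_comm (spaceFourier ψ _), ← h3, mul_comm (ψ _)]
        refine integral_congr_ae (Filter.Eventually.of_forall fun x => ?_)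
        simp only
        rw [tensor_eq_dualFourier h, dualFourier_eq, map_mul, conj_normConst, ← integral_conj]
        simp only [map_mul, synthesis]
      have h4 : ∫ x, (dualFourier (spaceFourier ψ) x - ψ x) * starRingEnd ℂ (tensor a x) = 0 := by
        simp_rw [sub_mul]
        rw [integral_sub, h1, h2, sub_self]
        · exact hA'.bdd_mul (continuous_dualFourier hφ).aestronglyMeasurable
            (Filter.Eventually.of_forall (norm_dualFourier_le hφ))
        · exact hA'.bdd_mul (c := M) (continuous_of_mem_schwartz hψ).aestronglyMeasurable
            (Filter.Eventually.of_forall fun x => by simpa using hM x)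
      have h5 := congrArg (starRingEnd ℂ) h4
      rw [← integral_conj, map_zero] at h5
      simpa only [map_mul, Complex.conj_conj] using h5
  funext x
  have := congrFun key x
  simp only [Pi.zero_apply, map_eq_zero] at this
  exact sub_eq_zero.1 this

/-- Fourier inversion for Schwartz functions on the dual group. -/
lemma spaceFourier_ae_eq_of_eq_dualFourier {φ : DualDomain Γ → ℂ} (hφ : IsDualSchwartz φ)
    {ψ : Domain Γ → ℂ} (hψ : ψ ∈ schwartzSubmodule Γ) (h : ψ = dualFourier φ) :
    spaceFourier ψ =ᵐ[volume] φ := by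
  have h1 := (isDualSchwartz_spaceFourier hψ).integrable
  have hb : ∀ (u : DualDomain Γ → ℂ) (x : Domain Γ), Integrable u →
      Integrable fun ξ => u ξ * character ξ x := fun u x hu =>
    hu.mul_bdd (c := 1) (continuous_character_left x).aestronglyMeasurable
      (Filter.Eventually.of_forall fun ξ => (norm_character ξ x).le)
  -- Both functions have the same dual transform, so injectivity on `L¹` identifies them up to a
  -- null set.
  have h2 := ae_eq_zero_of_integral_dual_character_eq_zero (h1.sub hφ.integrable) fun x => by
    have h3 : dualFourier (spaceFourier ψ) x = dualFourier φ x := by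
      rw [dualFourier_spaceFourier hψ, h]
    rw [dualFourier_eq, dualFourier_eq] at h3
    have h4 := mul_left_cancel₀ normConst_ne_zero h3
    simp only [Pi.sub_apply, sub_mul]
    rw [integral_sub (hb _ x h1) (hb _ x hφ.integrable), h4, sub_self]
  filter_upwards [h2] with ξ hξ
  exact sub_eq_zero.1 hξ

/-- The Fourier transform of a distribution is unique. -/
lemma HasFourier.ae_eq {T : Distribution Γ} {F G : DualDomain Γ → ℂ} (hF : HasFourier T F)
    (hG : HasFourier T G) : F =ᵐ[volume] G := by
  -- Tensor pairs supply a dual test function together with an explicit Schwartz transform, as the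
  -- pairing condition requires.
  have h := ae_eq_zero_of_integral_dual_tensor_eq_zero (F := fun ξ => F ξ - G ξ)
    (fun a b h => by
      simp_rw [sub_mul]
      exact (hF.integrable _ (tensor_isDualSchwartz h)).sub
        (hG.integrable _ (tensor_isDualSchwartz h)))
    (fun a b h => by
      have hb := tensor_isDualSchwartz h
      simp_rw [sub_mul]
      rw [integral_sub (hF.integrable _ hb) (hG.integrable _ hb),
        ← hF.pairing _ hb ⟨tensor a, tensor_mem_schwartz h⟩ (tensor_eq_dualFourier h),
        ← hG.pairing _ hb ⟨tensor a, tensor_mem_schwartz h⟩ (tensor_eq_dualFourier h), sub_self])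
  filter_upwards [h] with ξ hξ
  exact sub_eq_zero.1 hξ

/-- Removes the arbitrary choice in the definition of the norm. -/
lemma HasFourier.fourierFun_ae_eq {T : Distribution Γ} {F : DualDomain Γ → ℂ}
    (hF : HasFourier T F) : fourierFun T =ᵐ[volume] F := by
  have h : ∃ F, HasFourier T F := ⟨F, hF⟩
  rw [fourierFun, dif_pos h]
  exact h.choose_spec.ae_eq hF

/-- The bounded continuous function with a given integrable Fourier transform. -/
def synthesisBCF {F : DualDomain Γ → ℂ} (hF : Integrable F) : Domain Γ →ᵇ ℂ :=
  BoundedContinuousFunction.ofNormedAddCommGroup (synthesis F) (continuous_synthesis hF) _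
    (norm_synthesis_le hF)

lemma integrable_bcf_mul (f : Domain Γ →ᵇ ℂ) {ψ : Domain Γ → ℂ} (hψ : Integrable ψ) :
    Integrable fun x => f x * ψ x :=
  hψ.bdd_mul f.continuous.aestronglyMeasurable (Filter.Eventually.of_forall f.norm_coe_le_norm)

/-- By inversion `ψ` is the dual transform of `spaceFourier ψ`, so the defining pairing applies to
it; Fubini then moves the transform onto `F`. -/
lemma HasFourier.represents {T : Distribution Γ} {F : DualDomain Γ → ℂ} (h : HasFourier T F)
    (hF : Integrable F) : Represents T (synthesisBCF hF) := fun ψ => by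
  have hψ := integrable_of_mem_schwartz ψ.2
  refine ⟨integrable_bcf_mul _ hψ, ?_⟩
  rw [h.pairing _ (isDualSchwartz_spaceFourier ψ.2) ψ (dualFourier_spaceFourier ψ.2).symm]
  exact (integral_synthesis_mul hF hψ).symm

/-- The converse needs inversion on the dual side: if `ψ` is the dual transform of `φ`, then its own
transform is `φ` almost everywhere. -/
lemma Represents.hasFourier {T : Distribution Γ} {F : DualDomain Γ → ℂ} (hF : Integrable F)
    (h : Represents T (synthesis F)) : HasFourier T F where
  locallyIntegrable := hF.locallyIntegrable
  integrable φ hφ := by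
    obtain ⟨C, hC⟩ := hφ.exists_decay 0
    exact hF.mul_bdd (c := C) hφ.continuous.aestronglyMeasurable
      (Filter.Eventually.of_forall fun ξ => by simpa using hC ξ)
  pairing φ hφ ψ hψ := by
    rw [(h ψ).2, integral_synthesis_mul hF (integrable_of_mem_schwartz ψ.2)]
    refine integral_congr_ae ?_
    filter_upwards [spaceFourier_ae_eq_of_eq_dualFourier hφ ψ.2 hψ] with ξ hξ
    rw [hξ]

lemma eq_of_forall_integral_eq (f g : Domain Γ →ᵇ ℂ)
    (h : ∀ ψ : Schwartz Γ, ∫ x, f x * ψ.1 x = ∫ x, g x * ψ.1 x) : f = g := by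
  have key : (fun x => f x - g x) = 0 := by
    refine eq_zero_of_integral_tensor_eq_zero (M := ‖f‖ + ‖g‖) (f.continuous.sub g.continuous)
      (fun x => (norm_sub_le _ _).trans (add_le_add (f.norm_coe_le_norm x) (g.norm_coe_le_norm x)))
      fun a b hab => ?_
    have hi := integrable_of_mem_schwartz (tensor_mem_schwartz hab)
    simp_rw [sub_mul]
    rw [integral_sub (integrable_bcf_mul f hi) (integrable_bcf_mul g hi), sub_eq_zero]
    exact h ⟨tensor a, tensor_mem_schwartz hab⟩
  ext x
  exact sub_eq_zero.1 (congrFun key x)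

lemma Represents.unique {T : Distribution Γ} {f g : Domain Γ →ᵇ ℂ} (hf : Represents T f)
    (hg : Represents T g) : f = g :=
  eq_of_forall_integral_eq f g fun ψ => (hf ψ).2.symm.trans (hg ψ).2

/-- The distribution given by a bounded continuous function. -/
lemma exists_represents (f : Domain Γ →ᵇ ℂ) : ∃ T : Distribution Γ, Represents T f := by
  have h_int : ∀ ψ : Schwartz Γ, Integrable fun x => f x * ψ.1 x := fun ψ =>
    integrable_bcf_mul f (integrable_of_mem_schwartz ψ.2)
  let ℓ : Schwartz Γ →ₗ[ℂ] ℂ :=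
    { toFun := fun ψ => ∫ x, f x * ψ.1 x
      map_add' := fun ψ χ => by
        rw [← integral_add (h_int ψ) (h_int χ)]
        refine integral_congr_ae (Filter.Eventually.of_forall fun x => ?_)
        exact mul_add (f x) (ψ.1 x) (χ.1 x)
      map_smul' := fun c ψ => by
        rw [RingHom.id_apply, smul_eq_mul, ← integral_const_mul]
        refine integral_congr_ae (Filter.Eventually.of_forall fun x => ?_)
        exact mul_left_comm (f x) c (ψ.1 x) }
  have hw : WithSeminorms (schwartzSeminorm Γ) := ⟨rfl⟩
  have hsem : ∀ (ψ : Schwartz Γ) (k : ℕ) (x : Domain Γ),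
      ‖coordVec x‖ ^ k * ‖ψ.1 x‖ ≤ schwartzSeminorm Γ (k, 0) ψ := fun ψ k x => by
    obtain ⟨v, rfl⟩ := (isOpenQuotientMap_projVec Γ).surjective x
    have := le_ciSup (ψ.2.2 k 0) v
    rw [decay_eq, norm_iteratedFDeriv_zero] at this
    exact this
  have hcont : Continuous ℓ := by
    let M : ℝ := ∫ x : Domain Γ, majorant x
    have hM : 0 ≤ M := integral_nonneg fun x => (majorant_pos x).le
    -- The two seminorms of orders `0` and `2d` control the integrable majorant, hence the integral
    -- against a bounded function.
    refine WithSeminorms.continuous_normedSpace_rng ℂ hw ℓ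
      ⟨{(0, 0), (2 * d, 0)}, ⟨‖f‖ * (2 ^ d * 2 * M), by positivity⟩, fun ψ => ?_⟩
    let S : ℝ := (({(0, 0), (2 * d, 0)} : Finset (ℕ × ℕ)).sup (schwartzSeminorm Γ)) ψ
    have hS : ∀ m ∈ ({(0, 0), (2 * d, 0)} : Finset (ℕ × ℕ)), schwartzSeminorm Γ m ψ ≤ S :=
      fun m hm => Seminorm.le_finset_sup_apply hm
    have h1 : ∀ x, ‖ψ.1 x‖ ≤ 2 ^ d * (S + S) * majorant x := fun x =>
      norm_le_mul_majorant x
        (by simpa using (hsem ψ 0 x).trans (hS (0, 0) (by simp)))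
        ((hsem ψ (2 * d) x).trans (hS (2 * d, 0) (by simp)))
    have h2 : ‖ℓ ψ‖ ≤ ∫ x : Domain Γ, ‖f‖ * (2 ^ d * (S + S) * majorant x) := by
      refine norm_integral_le_of_norm_le ((integrable_majorant.const_mul _).const_mul _)
        (Filter.Eventually.of_forall fun x => ?_)
      rw [norm_mul]
      exact mul_le_mul (f.norm_coe_le_norm x) (h1 x) (norm_nonneg _) (norm_nonneg _)
    rw [integral_const_mul, integral_const_mul] at h2
    refine h2.trans_eq ?_
    change _ = ‖f‖ * (2 ^ d * 2 * M) * S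
    ring
  exact ⟨⟨ℓ, hcont⟩, fun ψ => ⟨h_int ψ, rfl⟩⟩

open scoped ENNReal

instance (γ : Factor) : (volume : Measure γ.Dual).IsNegInvariant :=
  match γ with
  | .line => inferInstanceAs (volume : Measure ℝ).IsNegInvariant
  | .circle _ _ => inferInstanceAs (Measure.count : Measure ℤ).IsNegInvariant

/-! ### Weighted `L²` convolution estimates. -/

section Convolution

variable {G : Type*} [MeasurableSpace G] {μ : Measure G}

lemma lintegral_mul_sq_le {f g : G → ℝ≥0∞} (hf : AEMeasurable f μ) (hg : AEMeasurable g μ) :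
    (∫⁻ x, f x * g x ∂μ) ^ 2 ≤ (∫⁻ x, f x ^ 2 ∂μ) * ∫⁻ x, g x ^ 2 ∂μ := by
  have h := ENNReal.lintegral_mul_le_Lp_mul_Lq μ Real.HolderConjugate.two_two hf hg
  calc (∫⁻ x, f x * g x ∂μ) ^ 2
      ≤ ((∫⁻ x, f x ^ (2 : ℝ) ∂μ) ^ (1 / (2 : ℝ)) * (∫⁻ x, g x ^ (2 : ℝ) ∂μ) ^ (1 / (2 : ℝ))) ^ 2 :=
        pow_le_pow_left' h 2
    _ = _ := by
        rw [mul_pow, ← ENNReal.rpow_natCast, ← ENNReal.rpow_natCast, ← ENNReal.rpow_mul,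
          ← ENNReal.rpow_mul]
        norm_num

lemma add_sq_le_two_mul (a b : ℝ≥0∞) : (a + b) ^ 2 ≤ 2 * (a ^ 2 + b ^ 2) := by
  have h := ENNReal.rpow_add_le_mul_rpow_add_rpow a b (p := 2) (by norm_num)
  norm_num at h
  exact h

variable [AddCommGroup G] [MeasurableAdd₂ G] [MeasurableNeg G] [SFinite μ]
  [μ.IsAddLeftInvariant]

/-- Cauchy–Schwarz in `η` splits off `k`; what remains is the integral of the convolution of `f²`
and `g²`, a product by Tonelli and invariance. -/
lemma lintegral_sq_conv_mul_le {f g k : G → ℝ≥0∞} (hf : Measurable f) (hg : Measurable g)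
    (hk : Measurable k) :
    ∫⁻ ξ, (∫⁻ η, f (ξ - η) * g η * k η ∂μ) ^ 2 ∂μ ≤
      (∫⁻ ξ, f ξ ^ 2 ∂μ) * (∫⁻ ξ, g ξ ^ 2 ∂μ) * ∫⁻ ξ, k ξ ^ 2 ∂μ := by
  have hm : Measurable fun p : G × G => f (p.1 - p.2) ^ 2 * g p.2 ^ 2 := by fun_prop
  calc ∫⁻ ξ, (∫⁻ η, f (ξ - η) * g η * k η ∂μ) ^ 2 ∂μ
      ≤ ∫⁻ ξ, (∫⁻ η, f (ξ - η) ^ 2 * g η ^ 2 ∂μ) * (∫⁻ η, k η ^ 2 ∂μ) ∂μ := by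
        refine lintegral_mono fun ξ => ?_
        refine (lintegral_mul_sq_le (f := fun η => f (ξ - η) * g η) (by fun_prop)
          (by fun_prop)).trans_eq ?_
        simp only [mul_pow]
    _ = (∫⁻ ξ, ∫⁻ η, f (ξ - η) ^ 2 * g η ^ 2 ∂μ ∂μ) * ∫⁻ η, k η ^ 2 ∂μ :=
        lintegral_mul_const _ hm.lintegral_prod_right'
    _ = _ := by
        congr 1
        rw [lintegral_lintegral_swap hm.aemeasurable]
        have : ∀ η, ∫⁻ ξ, f (ξ - η) ^ 2 * g η ^ 2 ∂μ = (∫⁻ ξ, f ξ ^ 2 ∂μ) * g η ^ 2 := fun η => by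
          rw [lintegral_mul_const _ (by fun_prop), lintegral_sub_right_eq_self (fun ξ => f ξ ^ 2)]
        simp_rw [this]
        rw [lintegral_const_mul _ (by fun_prop)]

variable [μ.IsNegInvariant]

/-- Here Cauchy–Schwarz splits off `f`, leaving `g(η)² κ(ξ,η)²`; integrating first in `ξ` uses only
the uniform bound on `κ`. -/
lemma lintegral_sq_conv_kernel_le {f g : G → ℝ≥0∞} {κ : G → G → ℝ≥0∞} (hf : Measurable f)
    (hg : Measurable g) (hκ : Measurable fun p : G × G => κ p.1 p.2) {M : ℝ≥0∞}
    (hM : ∀ η, ∫⁻ ξ, κ ξ η ^ 2 ∂μ ≤ M) :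
    ∫⁻ ξ, (∫⁻ η, f (ξ - η) * g η * κ ξ η ∂μ) ^ 2 ∂μ ≤
      (∫⁻ ξ, f ξ ^ 2 ∂μ) * (∫⁻ ξ, g ξ ^ 2 ∂μ) * M := by
  have hm : Measurable fun p : G × G => g p.2 ^ 2 * κ p.1 p.2 ^ 2 := by fun_prop
  have hκ1 : ∀ η, Measurable fun ξ => κ ξ η := fun η => hκ.comp measurable_prodMk_right
  have hκ2 : ∀ ξ, Measurable fun η => κ ξ η := fun η => hκ.comp measurable_prodMk_left
  calc ∫⁻ ξ, (∫⁻ η, f (ξ - η) * g η * κ ξ η ∂μ) ^ 2 ∂μ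
      ≤ ∫⁻ ξ, (∫⁻ η, f η ^ 2 ∂μ) * (∫⁻ η, g η ^ 2 * κ ξ η ^ 2 ∂μ) ∂μ := by
        refine lintegral_mono fun ξ => ?_
        have h := lintegral_mul_sq_le (μ := μ) (f := fun η => f (ξ - η))
          (g := fun η => g η * κ ξ η) (by fun_prop) (hg.mul (hκ2 ξ)).aemeasurable
        simp only [← mul_assoc, mul_pow] at h
        rwa [lintegral_sub_left_eq_self (fun ξ => f ξ ^ 2)] at h
    _ = (∫⁻ η, f η ^ 2 ∂μ) * ∫⁻ ξ, ∫⁻ η, g η ^ 2 * κ ξ η ^ 2 ∂μ ∂μ :=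
        lintegral_const_mul _ hm.lintegral_prod_right'
    _ = (∫⁻ η, f η ^ 2 ∂μ) * ∫⁻ η, g η ^ 2 * ∫⁻ ξ, κ ξ η ^ 2 ∂μ ∂μ := by
        rw [lintegral_lintegral_swap hm.aemeasurable]
        congr 1
        refine lintegral_congr fun η => ?_
        rw [lintegral_const_mul _ ((hκ1 η).pow_const 2)]
    _ ≤ (∫⁻ η, f η ^ 2 ∂μ) * ∫⁻ η, g η ^ 2 * M ∂μ := by
        gcongr with η
        exact hM η
    _ = _ := by rw [lintegral_mul_const _ (by fun_prop), mul_assoc]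

/-- A weighted `L²` space is a convolution algebra if the weight satisfies a suitable kernel
inequality. -/
lemma lintegral_weighted_conv_sq_le {W : G → ℝ≥0∞} {κ : G → G → ℝ≥0∞} (hW : Measurable W)
    (hW0 : ∀ ξ, W ξ ≠ 0) (hWt : ∀ ξ, W ξ ≠ ⊤)
    (hκ : Measurable fun p : G × G => κ p.1 p.2) {M C : ℝ≥0∞}
    (hM : ∀ η, ∫⁻ ξ, κ ξ η ^ 2 ∂μ ≤ M)
    (hC : ∀ᵐ ξ ∂μ, ∀ η, W ξ ≤ C * (W (ξ - η) + W η +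
      W (ξ - η) * W η * (κ ξ (ξ - η) + κ ξ η)))
    {f g : G → ℝ≥0∞} (hf : Measurable f) (hg : Measurable g) :
    ∫⁻ ξ, (W ξ * ∫⁻ η, f (ξ - η) * g η ∂μ) ^ 2 ∂μ ≤
      8 * C ^ 2 * (∫⁻ ξ, (W ξ)⁻¹ ^ 2 ∂μ + M) *
        ((∫⁻ ξ, (W ξ * f ξ) ^ 2 ∂μ) * ∫⁻ ξ, (W ξ * g ξ) ^ 2 ∂μ) := by
  -- `A` collects the terms with one weight, the missing one being supplied by `W⁻¹`; `B` collects
  -- the kernel terms. The substitution `η ↦ ξ - η` exchanges `f` and `g` in the mirrored terms.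
  let A : (G → ℝ≥0∞) → (G → ℝ≥0∞) → G → ℝ≥0∞ := fun f g ξ =>
    ∫⁻ η, (W (ξ - η) * f (ξ - η)) * (W η * g η) * (W η)⁻¹ ∂μ
  let B : (G → ℝ≥0∞) → (G → ℝ≥0∞) → G → ℝ≥0∞ := fun f g ξ =>
    ∫⁻ η, (W (ξ - η) * f (ξ - η)) * (W η * g η) * κ ξ η ∂μ
  have hA : ∀ f g, Measurable f → Measurable g → Measurable (A f g) := fun f g hf hg => by
    refine Measurable.lintegral_prod_right' (f := fun p : G × G =>
      (W (p.1 - p.2) * f (p.1 - p.2)) * (W p.2 * g p.2) * (W p.2)⁻¹) ?_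
    fun_prop
  have hB : ∀ f g, Measurable f → Measurable g → Measurable (B f g) := fun f g hf hg => by
    refine Measurable.lintegral_prod_right' (f := fun p : G × G =>
      (W (p.1 - p.2) * f (p.1 - p.2)) * (W p.2 * g p.2) * κ p.1 p.2) ?_
    fun_prop
  have hκ2 : ∀ ξ, Measurable fun η => κ ξ η := fun η => hκ.comp measurable_prodMk_left
  have hpt : ∀ᵐ ξ ∂μ, W ξ * ∫⁻ η, f (ξ - η) * g η ∂μ ≤
      C * ((A f g ξ + A g f ξ) + (B f g ξ + B g f ξ)) := by
    filter_upwards [hC] with ξ hξ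
    have swap : ∀ h : G → ℝ≥0∞, ∫⁻ η, h (ξ - η) ∂μ = ∫⁻ η, h η ∂μ := fun h =>
      lintegral_sub_left_eq_self h ξ
    have e1 : A g f ξ = ∫⁻ η, (W η * g η) * (W (ξ - η) * f (ξ - η)) * (W (ξ - η))⁻¹ ∂μ := by
      rw [← swap]; simp only [sub_sub_cancel]; rfl
    have e2 : B g f ξ = ∫⁻ η, (W η * g η) * (W (ξ - η) * f (ξ - η)) * κ ξ (ξ - η) ∂μ := by
      rw [← swap]; simp only [sub_sub_cancel]; rfl
    rw [e1, e2, ← lintegral_add_left (by fun_prop), ← lintegral_add_left (by fun_prop),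
      ← lintegral_add_left (by fun_prop), ← lintegral_const_mul _ (by fun_prop),
      ← lintegral_const_mul _ (by fun_prop)]
    refine lintegral_mono fun η => ?_
    have h1 := ENNReal.mul_inv_cancel (hW0 η) (hWt η)
    have h2 := ENNReal.mul_inv_cancel (hW0 (ξ - η)) (hWt (ξ - η))
    calc W ξ * (f (ξ - η) * g η) ≤ C * (W (ξ - η) + W η +
          W (ξ - η) * W η * (κ ξ (ξ - η) + κ ξ η)) * (f (ξ - η) * g η) := by gcongr; exact hξ η
      _ = C * ((W (ξ - η) * f (ξ - η) * g η * 1 + W η * g η * f (ξ - η) * 1) +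
          (W (ξ - η) * f (ξ - η) * (W η * g η) * κ ξ η +
            W η * g η * (W (ξ - η) * f (ξ - η)) * κ ξ (ξ - η))) := by ring
      _ = C * ((W (ξ - η) * f (ξ - η) * g η * (W η * (W η)⁻¹) +
          W η * g η * f (ξ - η) * (W (ξ - η) * (W (ξ - η))⁻¹)) +
          (W (ξ - η) * f (ξ - η) * (W η * g η) * κ ξ η +
            W η * g η * (W (ξ - η) * f (ξ - η)) * κ ξ (ξ - η))) := by rw [h1, h2]
      _ = _ := by ring
  have hAA : ∀ f g, Measurable f → Measurable g → ∫⁻ ξ, A f g ξ ^ 2 ∂μ ≤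
      (∫⁻ ξ, (W ξ * f ξ) ^ 2 ∂μ) * (∫⁻ ξ, (W ξ * g ξ) ^ 2 ∂μ) * ∫⁻ ξ, (W ξ)⁻¹ ^ 2 ∂μ :=
    fun f g hf hg => lintegral_sq_conv_mul_le (hW.mul hf) (hW.mul hg) hW.inv
  have hBB : ∀ f g, Measurable f → Measurable g → ∫⁻ ξ, B f g ξ ^ 2 ∂μ ≤
      (∫⁻ ξ, (W ξ * f ξ) ^ 2 ∂μ) * (∫⁻ ξ, (W ξ * g ξ) ^ 2 ∂μ) * M :=
    fun f g hf hg => lintegral_sq_conv_kernel_le (hW.mul hf) (hW.mul hg) hκ hM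
  have m1 := hA f g hf hg
  have m2 := hA g f hg hf
  have m3 := hB f g hf hg
  have m4 := hB g f hg hf
  -- Squaring a sum of four terms costs `4`, and the two terms of each type give the remaining `2`
  -- in the constant `8`.
  calc ∫⁻ ξ, (W ξ * ∫⁻ η, f (ξ - η) * g η ∂μ) ^ 2 ∂μ
      ≤ ∫⁻ ξ, 4 * C ^ 2 * ((A f g ξ ^ 2 + A g f ξ ^ 2) + (B f g ξ ^ 2 + B g f ξ ^ 2)) ∂μ := by
        refine lintegral_mono_ae ?_
        filter_upwards [hpt] with ξ hξ
        calc _ ≤ (C * ((A f g ξ + A g f ξ) + (B f g ξ + B g f ξ))) ^ 2 := pow_le_pow_left' hξ 2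
          _ = C ^ 2 * ((A f g ξ + A g f ξ) + (B f g ξ + B g f ξ)) ^ 2 := mul_pow _ _ _
          _ ≤ C ^ 2 * (2 * ((A f g ξ + A g f ξ) ^ 2 + (B f g ξ + B g f ξ) ^ 2)) := by
              gcongr; exact add_sq_le_two_mul _ _
          _ ≤ C ^ 2 * (2 * (2 * (A f g ξ ^ 2 + A g f ξ ^ 2) +
              2 * (B f g ξ ^ 2 + B g f ξ ^ 2))) := by
              gcongr <;> exact add_sq_le_two_mul _ _
          _ = _ := by ring
    _ = 4 * C ^ 2 * ((∫⁻ ξ, A f g ξ ^ 2 ∂μ + ∫⁻ ξ, A g f ξ ^ 2 ∂μ) +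
          (∫⁻ ξ, B f g ξ ^ 2 ∂μ + ∫⁻ ξ, B g f ξ ^ 2 ∂μ)) := by
        rw [lintegral_const_mul _ (by fun_prop), lintegral_add_left (by fun_prop),
          lintegral_add_left (by fun_prop), lintegral_add_left (by fun_prop)]
    _ ≤ 4 * C ^ 2 * (((∫⁻ ξ, (W ξ * f ξ) ^ 2 ∂μ) * (∫⁻ ξ, (W ξ * g ξ) ^ 2 ∂μ) *
          ∫⁻ ξ, (W ξ)⁻¹ ^ 2 ∂μ + (∫⁻ ξ, (W ξ * g ξ) ^ 2 ∂μ) * (∫⁻ ξ, (W ξ * f ξ) ^ 2 ∂μ) *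
          ∫⁻ ξ, (W ξ)⁻¹ ^ 2 ∂μ) + ((∫⁻ ξ, (W ξ * f ξ) ^ 2 ∂μ) * (∫⁻ ξ, (W ξ * g ξ) ^ 2 ∂μ) * M +
          (∫⁻ ξ, (W ξ * g ξ) ^ 2 ∂μ) * (∫⁻ ξ, (W ξ * f ξ) ^ 2 ∂μ) * M)) := by
        gcongr
        · exact hAA f g hf hg
        · exact hAA g f hg hf
        · exact hBB f g hf hg
        · exact hBB g f hg hf
    _ = _ := by ring

end Convolution

/-! ### Pointwise inequalities for the multiplier and the weight. -/

section Multiplier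

variable {d : ℕ}

lemma abs_apply_le_norm (x : EuclideanSpace ℝ (Fin d)) (i : Fin d) : |x i| ≤ ‖x‖ := by
  simpa using PiLp.norm_apply_le x i

/-- The Japanese bracket `⟨x⟩ = (1 + |x|²)^(1/2)`. -/
def bracket (x : EuclideanSpace ℝ (Fin d)) : ℝ := Real.sqrt (1 + ‖x‖ ^ 2)

lemma one_le_bracket (x : EuclideanSpace ℝ (Fin d)) : 1 ≤ bracket x :=
  Real.one_le_sqrt.2 (by nlinarith [norm_nonneg x])

lemma bracket_pos (x : EuclideanSpace ℝ (Fin d)) : 0 < bracket x :=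
  one_pos.trans_le (one_le_bracket x)

lemma bracket_le_one_add_norm (x : EuclideanSpace ℝ (Fin d)) : bracket x ≤ 1 + ‖x‖ :=
  Real.sqrt_le_iff.2 ⟨by positivity, by nlinarith [norm_nonneg x]⟩

lemma norm_le_bracket (x : EuclideanSpace ℝ (Fin d)) : ‖x‖ ≤ bracket x :=
  Real.le_sqrt_of_sq_le (by linarith)

lemma bracket_le_two_mul {x y : EuclideanSpace ℝ (Fin d)} (h : ‖x‖ ≤ 2 * ‖y‖) :
    bracket x ≤ 2 * bracket y := by
  refine Real.sqrt_le_iff.2 ⟨by linarith [bracket_pos y], ?_⟩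
  have h1 : bracket y ^ 2 = 1 + ‖y‖ ^ 2 := Real.sq_sqrt (by positivity)
  nlinarith [norm_nonneg x, norm_nonneg y]

lemma bracket_rpow_eq (s : ℝ) (x : EuclideanSpace ℝ (Fin d)) :
    bracket x ^ s = bracket x * bracket x ^ (s - 1) := by
  rw [Real.rpow_sub_one (bracket_pos x).ne', mul_div_cancel₀ _ (bracket_pos x).ne']

variable [NeZero d]

lemma multiplier_pos (x : EuclideanSpace ℝ (Fin d)) : 0 < multiplier x := by
  unfold multiplier
  split_ifs with h
  · exact one_pos
  · have := norm_pos_iff.2 h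
    positivity

lemma norm_le_multiplier (x : EuclideanSpace ℝ (Fin d)) : ‖x‖ ≤ multiplier x := by
  unfold multiplier
  split_ifs with h
  · simp [h]
  · exact le_add_of_nonneg_left (by positivity)

lemma abs_apply_div_norm_le_multiplier (x : EuclideanSpace ℝ (Fin d)) :
    |x 0| / ‖x‖ ≤ multiplier x := by
  unfold multiplier
  split_ifs with h
  · simp [h]
  · exact le_add_of_nonneg_right (norm_nonneg x)

/-- `|x₁|` is the product of the two summands of the multiplier. This is the gain over `|x| ≤ μ(x)`
that makes `μ⁻²` integrable near `0` even in dimension two. -/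
lemma abs_apply_le_multiplier_sq (x : EuclideanSpace ℝ (Fin d)) : |x 0| ≤ multiplier x ^ 2 := by
  by_cases h : x = 0
  · rw [h]; simp; positivity
  · have hx := norm_pos_iff.2 h
    calc |x 0| = |x 0| / ‖x‖ * ‖x‖ := by field_simp
      _ ≤ multiplier x * multiplier x := by
          gcongr
          · exact (multiplier_pos x).le
          · exact abs_apply_div_norm_le_multiplier x
          · exact norm_le_multiplier x
      _ = _ := (sq _).symm

lemma multiplier_le_two_mul_bracket (x : EuclideanSpace ℝ (Fin d)) :
    multiplier x ≤ 2 * bracket x := by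
  have h1 := one_le_bracket x
  unfold multiplier
  split_ifs with h
  · linarith
  · have h2 : |x 0| / ‖x‖ ≤ 1 := div_le_one_of_le₀ (abs_apply_le_norm x 0) (norm_nonneg x)
    linarith [norm_le_bracket x]

lemma mul_bracket_le_multiplier {δ : ℝ} (hδ : 0 < δ) (hδ1 : δ ≤ 1)
    {x : EuclideanSpace ℝ (Fin d)} (hx : δ ≤ ‖x‖) : δ / 2 * bracket x ≤ multiplier x := by
  refine le_trans ?_ (norm_le_multiplier x)
  nlinarith [bracket_le_one_add_norm x]

lemma measurable_multiplier : Measurable (multiplier (d := d)) := by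
  unfold multiplier
  refine Measurable.ite (measurableSet_eq) measurable_const ?_
  fun_prop

lemma weight_pos (s : ℝ) (x : EuclideanSpace ℝ (Fin d)) : 0 < weight s x :=
  mul_pos (multiplier_pos x) (Real.rpow_pos_of_pos (bracket_pos x) _)

lemma measurable_weight (s : ℝ) : Measurable (weight (d := d) s) :=
  measurable_multiplier.mul (by fun_prop)

lemma weight_le (s : ℝ) (x : EuclideanSpace ℝ (Fin d)) : weight s x ≤ 2 * bracket x ^ s := by
  rw [bracket_rpow_eq, ← mul_assoc]
  exact mul_le_mul_of_nonneg_right (multiplier_le_two_mul_bracket x)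
    (Real.rpow_pos_of_pos (bracket_pos x) _).le

lemma le_weight {s c : ℝ} {x : EuclideanSpace ℝ (Fin d)} (h : c * bracket x ≤ multiplier x) :
    c * bracket x ^ s ≤ weight s x := by
  rw [bracket_rpow_eq, ← mul_assoc]
  exact mul_le_mul_of_nonneg_right h (Real.rpow_pos_of_pos (bracket_pos x) _).le

lemma multiplier_le_weight {s : ℝ} (hs : 1 ≤ s) (x : EuclideanSpace ℝ (Fin d)) :
    multiplier x ≤ weight s x :=
  le_mul_of_one_le_right (multiplier_pos x).le
    (Real.one_le_rpow (one_le_bracket x) (by linarith))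

lemma weight_le_of_norm_le_two_mul {s c : ℝ} (hs : 0 ≤ s) (hc : 0 < c)
    {x y : EuclideanSpace ℝ (Fin d)} (h : ‖x‖ ≤ 2 * ‖y‖) (hy : c * bracket y ≤ multiplier y) :
    weight s x ≤ 2 * 2 ^ s / c * weight s y := by
  have h1 := le_weight (s := s) hy
  calc weight s x ≤ 2 * bracket x ^ s := weight_le s x
    _ ≤ 2 * (2 * bracket y) ^ s := by
        gcongr
        · exact (bracket_pos x).le
        · exact bracket_le_two_mul h
    _ = 2 * 2 ^ s / c * (c * bracket y ^ s) := by
        rw [Real.mul_rpow (by norm_num) (bracket_pos y).le]; field_simp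
    _ ≤ _ := by gcongr

/-- Away from `0` the weight is subadditive up to a constant. -/
lemma weight_add_le {s c : ℝ} (hs : 0 ≤ s) (hc : 0 < c) {x y : EuclideanSpace ℝ (Fin d)}
    (hx : ‖x + y‖ ≤ 2 * ‖x‖ → c * bracket x ≤ multiplier x)
    (hy : ‖x + y‖ ≤ 2 * ‖y‖ → c * bracket y ≤ multiplier y) :
    weight s (x + y) ≤ 2 * 2 ^ s / c * (weight s x + weight s y) := by
  have hC : 0 < 2 * 2 ^ s / c := by positivity
  have h := norm_add_le x y
  -- The larger summand has norm at least half that of the sum, and only there is the lower bound on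
  -- the multiplier needed.
  rcases le_total ‖x‖ ‖y‖ with hxy | hxy
  · have h2 : ‖x + y‖ ≤ 2 * ‖y‖ := by linarith
    refine (weight_le_of_norm_le_two_mul hs hc h2 (hy h2)).trans ?_
    exact mul_le_mul_of_nonneg_left (by linarith [weight_pos s x]) hC.le
  · have h2 : ‖x + y‖ ≤ 2 * ‖x‖ := by linarith
    refine (weight_le_of_norm_le_two_mul hs hc h2 (hx h2)).trans ?_
    exact mul_le_mul_of_nonneg_left (by linarith [weight_pos s y]) hC.le

/-- The kernel that controls the weight near `0`. -/
def lowKernel (x y : EuclideanSpace ℝ (Fin d)) : ℝ :=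
  if ‖x‖ < 1 ∧ |x 0| ≤ 2 * |y 0| then |x 0| / (‖x‖ * |y 0|) else 0

lemma lowKernel_nonneg (x y : EuclideanSpace ℝ (Fin d)) : 0 ≤ lowKernel x y := by
  unfold lowKernel
  split_ifs <;> positivity

lemma measurable_lowKernel : Measurable
    fun p : EuclideanSpace ℝ (Fin d) × EuclideanSpace ℝ (Fin d) => lowKernel p.1 p.2 := by
  unfold lowKernel
  refine Measurable.ite ?_ (by fun_prop) measurable_const
  measurability

/-- Write `z = x + y`, so `|z₁| ≤ 2|y₁|`. If `|y| ≤ 2|z|`, then `|z₁|/|z| ≤ 4|y₁|/|y|`. Otherwise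
`|x| ≥ |y|/2`, and the factors `|x|` and `|y₁|/|y|` of `μ(x)μ(y)` leave at least `|y₁|/2`, which the
kernel converts into the required ratio. -/
lemma abs_apply_div_norm_add_le {x y : EuclideanSpace ℝ (Fin d)} (hn : ‖x + y‖ < 1)
    (hxy : |x 0| ≤ |y 0|) :
    |(x + y) 0| / ‖x + y‖ ≤
      4 * (multiplier y + multiplier x * multiplier y * lowKernel (x + y) y) := by
  have hm := multiplier_pos x
  have hm' := multiplier_pos y
  have hk := lowKernel_nonneg (x + y) y
  have h0 : |(x + y) 0| ≤ 2 * |y 0| := by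
    have := abs_add_le (x 0) (y 0)
    simp only [PiLp.add_apply]
    linarith
  rcases eq_or_ne (y 0) 0 with hy | hy
  · rw [hy, abs_zero, mul_zero] at h0
    rw [le_antisymm h0 (abs_nonneg _), zero_div]
    positivity
  have hy0 : 0 < |y 0| := abs_pos.2 hy
  have hyn : 0 < ‖y‖ := hy0.trans_le (abs_apply_le_norm y 0)
  rcases eq_or_ne (x + y) 0 with hz | hz
  · rw [hz]
    simp only [norm_zero, div_zero]
    rw [hz] at hk
    positivity
  have hzn := norm_pos_iff.2 hz
  rcases le_or_gt ‖y‖ (2 * ‖x + y‖) with h | h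
  · calc |(x + y) 0| / ‖x + y‖ ≤ 4 * (|y 0| / ‖y‖) := by
          rw [← mul_div_assoc, div_le_div_iff₀ hzn hyn]
          nlinarith [abs_nonneg ((x + y) 0)]
      _ ≤ 4 * multiplier y := by gcongr; exact abs_apply_div_norm_le_multiplier y
      _ ≤ _ := by
          have : 0 ≤ multiplier x * multiplier y * lowKernel (x + y) y := by positivity
          linarith
  · have hx : ‖y‖ / 2 ≤ ‖x‖ := by
      have := norm_sub_le (x + y) x
      rw [add_sub_cancel_left] at this
      linarith
    have hker : lowKernel (x + y) y = |(x + y) 0| / (‖x + y‖ * |y 0|) := if_pos ⟨hn, h0⟩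
    calc |(x + y) 0| / ‖x + y‖
        = 2 * ((‖y‖ / 2) * (|y 0| / ‖y‖) * (|(x + y) 0| / (‖x + y‖ * |y 0|))) := by
          field_simp
      _ ≤ 2 * (multiplier x * multiplier y * lowKernel (x + y) y) := by
          rw [hker]
          gcongr
          · exact hx.trans (norm_le_multiplier x)
          · exact abs_apply_div_norm_le_multiplier y
      _ ≤ _ := by
          have : 0 ≤ multiplier x * multiplier y * lowKernel (x + y) y := by positivity
          linarith

/-- The argument is symmetric in which first coordinate is larger, hence both kernels. The constant
is `4` for the ratio plus `1` for `|x + y|`. -/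
lemma multiplier_add_le {x y : EuclideanSpace ℝ (Fin d)} (hz : x + y ≠ 0) (hn : ‖x + y‖ < 1) :
    multiplier (x + y) ≤ 5 * (multiplier x + multiplier y +
      multiplier x * multiplier y * (lowKernel (x + y) x + lowKernel (x + y) y)) := by
  have hx := multiplier_pos x
  have hy := multiplier_pos y
  have h1 : 0 ≤ multiplier x * multiplier y * lowKernel (x + y) x :=
    mul_nonneg (by positivity) (lowKernel_nonneg _ _)
  have h2 : 0 ≤ multiplier x * multiplier y * lowKernel (x + y) y :=
    mul_nonneg (by positivity) (lowKernel_nonneg _ _)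
  have h3 : ‖x + y‖ ≤ multiplier x + multiplier y :=
    (norm_add_le x y).trans (add_le_add (norm_le_multiplier x) (norm_le_multiplier y))
  have h4 : multiplier (x + y) = |(x + y) 0| / ‖x + y‖ + ‖x + y‖ := if_neg hz
  rw [h4, mul_add (multiplier x * multiplier y)]
  rcases le_total |x 0| |y 0| with h | h
  · linarith [abs_apply_div_norm_add_le hn h]
  · have h5 := abs_apply_div_norm_add_le (x := y) (y := x) (by rwa [add_comm]) h
    rw [add_comm y x, mul_comm (multiplier y)] at h5
    linarith

/-- For `|x+y| < 1` the bracket is at most `2`, and `s ≥ 1` lets weights replace multipliers. For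
`|x+y| ≥ 1` the larger summand has norm at least `1/2`, so its multiplier is at least `1/4` of its
bracket and no kernel is needed. -/
lemma weight_add_le_lowKernel {s : ℝ} (hs : 1 ≤ s) {x y : EuclideanSpace ℝ (Fin d)}
    (hz : x + y ≠ 0) :
    weight s (x + y) ≤ 8 * 2 ^ s * (weight s x + weight s y +
      weight s x * weight s y * (lowKernel (x + y) x + lowKernel (x + y) y)) := by
  have hx := weight_pos s x
  have hy := weight_pos s y
  have hk1 := lowKernel_nonneg (x + y) x
  have hk2 := lowKernel_nonneg (x + y) y
  rcases lt_or_ge ‖x + y‖ 1 with hn | hn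
  · have hb : bracket (x + y) ≤ 2 := (bracket_le_one_add_norm _).trans (by linarith)
    have hb' : bracket (x + y) ^ (s - 1) ≤ 2 ^ (s - 1) :=
      Real.rpow_le_rpow (bracket_pos _).le hb (by linarith)
    have h2 : (2 : ℝ) ^ s = 2 * 2 ^ (s - 1) := by
      rw [Real.rpow_sub_one two_ne_zero]; ring
    have hp : (0 : ℝ) < 2 ^ (s - 1) := by positivity
    calc weight s (x + y) ≤ multiplier (x + y) * 2 ^ (s - 1) :=
          mul_le_mul_of_nonneg_left hb' (multiplier_pos _).le
      _ ≤ 5 * (weight s x + weight s y +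
          weight s x * weight s y * (lowKernel (x + y) x + lowKernel (x + y) y)) *
            2 ^ (s - 1) := by
          refine mul_le_mul_of_nonneg_right ((multiplier_add_le hz hn).trans ?_) hp.le
          have := multiplier_pos x
          have := multiplier_pos y
          gcongr <;> exact multiplier_le_weight hs _
      _ ≤ _ := by
          rw [h2]
          have : 0 ≤ (weight s x + weight s y + weight s x * weight s y *
            (lowKernel (x + y) x + lowKernel (x + y) y)) * 2 ^ (s - 1) := by positivity
          linarith
  · have hd : ∀ w : EuclideanSpace ℝ (Fin d), ‖x + y‖ ≤ 2 * ‖w‖ →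
        1 / 4 * bracket w ≤ multiplier w := fun w hw => by
      have := mul_bracket_le_multiplier (δ := 1 / 2) (by norm_num) (by norm_num) (x := w)
        (by linarith)
      linarith
    refine (weight_add_le (by linarith) (c := 1 / 4) (by norm_num) (hd x) (hd y)).trans ?_
    have : (2 : ℝ) * 2 ^ s / (1 / 4) = 8 * 2 ^ s := by ring
    rw [this]
    exact mul_le_mul_of_nonneg_left (le_add_of_nonneg_right (by positivity)) (by positivity)

end Multiplier

/-! ### One-dimensional integrals over frequencies. -/

namespace Factor

lemma integrable_comp_freq_of_eq_line {γ : Factor} (h : γ = line) {φ : ℝ → ℝ}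
    (hφ : Integrable φ) : Integrable fun x : γ.Dual => φ (γ.freq x) := by
  subst h; exact hφ

lemma integral_comp_freq_of_eq_line {γ : Factor} (h : γ = line) (φ : ℝ → ℝ) :
    ∫ x : γ.Dual, φ (γ.freq x) = ∫ x, φ x := by
  subst h; rfl

lemma lintegral_comp_freq_of_eq_line {γ : Factor} (h : γ = line) (φ : ℝ → ENNReal) :
    ∫⁻ x : γ.Dual, φ (γ.freq x) = ∫⁻ x, φ x := by
  subst h; rfl

lemma ae_freq_ne_zero {γ : Factor} (h : γ = line) :
    ∀ᵐ x : γ.Dual, γ.freq x ≠ 0 := by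
  subst h
  exact Measure.ae_ne (volume : Measure ℝ) 0

lemma exists_le_abs_freq {γ : Factor} (h : γ ≠ line) :
    ∃ δ > 0, ∀ x : γ.Dual, γ.freq x ≠ 0 → δ ≤ |γ.freq x| := by
  cases γ with
  | line => exact absurd rfl h
  | circle L hL =>
    refine ⟨1 / L, by positivity, fun x hx => ?_⟩
    have key : ∀ k : ℤ, (k : ℝ) / L ≠ 0 → 1 / L ≤ |(k : ℝ) / L| := fun k hk => by
      have hk0 : k ≠ 0 := fun h0 => hk (by simp [h0])
      rw [abs_div, abs_of_pos hL]
      gcongr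
      exact_mod_cast Int.one_le_abs hk0
    exact key x hx

end Factor

lemma integrable_indicator_abs_rpow {e : ℝ} (he : e < 1) :
    Integrable ((Set.Icc (-1 : ℝ) 1).indicator fun x => |x| ^ (-e)) := by
  rw [integrable_indicator_iff measurableSet_Icc,
    ← intervalIntegrable_iff_integrableOn_Icc_of_le (by norm_num)]
  have h1 : IntervalIntegrable (fun x : ℝ => |x| ^ (-e)) volume 0 1 := by
    refine (intervalIntegral.intervalIntegrable_rpow' (r := -e) (by linarith)).congr ?_
    intro x hx
    rw [Set.uIoc_of_le zero_le_one] at hx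
    simp only [abs_of_pos hx.1]
  have h2 : IntervalIntegrable (fun x : ℝ => |x| ^ (-e)) volume (-1) 0 := by
    have := ((IntervalIntegrable.iff_comp_neg (by simp)).1 h1).symm
    simpa using this
  exact h2.trans h1

/-- Substituting `y ↦ a y` gives equality for `a ≠ 0`; for `a = 0` the left side is zero.
Independence of `a` is the source of the uniform kernel bound. -/
lemma lintegral_abs_div_sq_add_sq_le (a : ℝ) :
    ∫⁻ y : ℝ, ENNReal.ofReal (|a| / (a ^ 2 + y ^ 2)) ≤
      ∫⁻ y : ℝ, ENNReal.ofReal (1 + y ^ 2)⁻¹ := by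
  rcases eq_or_ne a 0 with ha | ha
  · simp [ha]
  have ha' : 0 < |a| := abs_pos.2 ha
  have e : ∀ y : ℝ, |a| / (a ^ 2 + y ^ 2) = |a|⁻¹ * (1 + (y / a) ^ 2)⁻¹ := fun y => by
    have h1 : 0 < a ^ 2 := by positivity
    have h2 : 0 < a ^ 2 + y ^ 2 := by positivity
    have h3 : 1 + (y / a) ^ 2 = (a ^ 2 + y ^ 2) / |a| ^ 2 := by
      rw [sq_abs]; field_simp
    rw [h3]; field_simp
  have hi : Integrable fun y : ℝ => (1 + (y / a) ^ 2)⁻¹ :=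
    integrable_inv_one_add_sq.comp_div ha
  simp_rw [e]
  rw [← ofReal_integral_eq_lintegral_ofReal (hi.const_mul _)
      (Filter.Eventually.of_forall fun y => by positivity),
    ← ofReal_integral_eq_lintegral_ofReal integrable_inv_one_add_sq
      (Filter.Eventually.of_forall fun y => by positivity),
    integral_const_mul, Measure.integral_comp_div (fun y : ℝ => (1 + y ^ 2)⁻¹), smul_eq_mul,
    inv_mul_cancel_left₀ ha'.ne']

/-! ### Square integrability of the inverse weight. -/

section Weights

variable {d : ℕ} {Γ : Fin d → Factor}

lemma freqVec_apply (ξ : DualDomain Γ) (i : Fin d) : freqVec ξ i = (Γ i).freq (ξ i) := rfl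

lemma freqVec_add (ξ η : DualDomain Γ) : freqVec (ξ + η) = freqVec ξ + freqVec η := by
  ext i; exact (Γ i).freq_add _ _

lemma measurable_freqVec : Measurable (freqVec (Γ := Γ)) := by
  refine (PiLp.continuous_toLp 2 _).measurable.comp (measurable_pi_lambda _ fun i => ?_)
  exact (Γ i).continuous_freq.measurable.comp (measurable_pi_apply i)

lemma ae_freq_ne_zero {i : Fin d} (h : Γ i = .line) :
    ∀ᵐ ξ : DualDomain Γ, (Γ i).freq (ξ i) ≠ 0 :=
  (Measure.quasiMeasurePreserving_eval (fun i => (volume : Measure (Γ i).Dual)) i).ae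
    (Factor.ae_freq_ne_zero h)

lemma bracket_sq (x : EuclideanSpace ℝ (Fin d)) : bracket x ^ 2 = 1 + ‖x‖ ^ 2 :=
  Real.sq_sqrt (by positivity)

/-- Distribute `(1+|ξ|²)^(-s)` as `d` factors of exponent `-s/d` and bound each by one coordinate;
`s/d > 1/2` makes every factor integrable. -/
lemma integrable_bracket_rpow_sq [NeZero d] {s : ℝ} (hs : (d : ℝ) / 2 < s) :
    Integrable fun ξ : DualDomain Γ => (bracket (freqVec ξ) ^ s)⁻¹ ^ 2 := by
  have hd : (0 : ℝ) < d := by exact_mod_cast Nat.pos_of_neZero d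
  have hp : 1 / 2 < s / d := by rw [lt_div_iff₀ hd]; linarith
  have hs0 : 0 < s / d := by linarith
  have h := Integrable.fintype_prod_dep (𝕜 := ℝ) (μ := fun i => (volume : Measure (Γ i).Dual))
    fun i => (Γ i).integrable_one_add_freq_sq_rpow hp
  refine h.mono' (f := fun ξ : DualDomain Γ => (bracket (freqVec ξ) ^ s)⁻¹ ^ 2) ?_
    (Filter.Eventually.of_forall fun ξ => ?_)
  · unfold bracket
    have := measurable_freqVec (Γ := Γ)
    exact Measurable.aestronglyMeasurable (by fun_prop)
  · have hb := bracket_pos (freqVec ξ)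
    rw [Real.norm_of_nonneg (by positivity)]
    calc (bracket (freqVec ξ) ^ s)⁻¹ ^ 2 = (bracket (freqVec ξ) ^ 2) ^ (-s) := by
          rw [← Real.rpow_neg hb.le, ← Real.rpow_natCast, ← Real.rpow_natCast,
            ← Real.rpow_mul hb.le, ← Real.rpow_mul hb.le, mul_comm]
      _ = ∏ _i : Fin d, (1 + ‖freqVec ξ‖ ^ 2) ^ (-(s / d)) := by
          rw [bracket_sq, Finset.prod_const, Finset.card_univ, Fintype.card_fin,
            ← Real.rpow_mul_natCast (by positivity)]
          congr 1; field_simp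
      _ ≤ _ := by
          refine Finset.prod_le_prod (fun i _ => by positivity) fun i _ => ?_
          refine Real.rpow_le_rpow_of_nonpos (by positivity) ?_ (by linarith)
          have := pow_le_pow_left₀ (abs_nonneg _) (abs_freq_le_norm ξ i) 2
          rw [sq_abs] at this
          linarith

variable [NeZero d]

lemma integrable_weight_inv_sq_of_le {s c : ℝ} (hs : (d : ℝ) / 2 < s) (hc : 0 < c)
    (h : ∀ ξ : DualDomain Γ, c * bracket (freqVec ξ) ≤ multiplier (freqVec ξ)) :
    Integrable fun ξ : DualDomain Γ => (weight s (freqVec ξ))⁻¹ ^ 2 := by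
  refine ((integrable_bracket_rpow_sq (Γ := Γ) hs).const_mul (c⁻¹ ^ 2)).mono' ?_
    (Filter.Eventually.of_forall fun ξ => ?_)
  · exact (((measurable_weight s).comp measurable_freqVec).inv.pow_const 2).aestronglyMeasurable
  · have hb := bracket_pos (freqVec ξ)
    rw [Real.norm_of_nonneg (by positivity), ← mul_pow, ← mul_inv]
    have h1 := le_weight (s := s) (h ξ)
    have h2 := weight_pos s (freqVec ξ)
    gcongr

/-- Interpolate: `μ⁻² = (μ²)^(-3/4) μ^(-1/2)` with `μ² ≥ |x₁|` and `μ ≥ |x_j|`. Both resulting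
exponents stay below `1`, so the bound is locally integrable in two variables. -/
lemma inv_multiplier_sq_le {x : EuclideanSpace ℝ (Fin d)} {j : Fin d} (h0 : x 0 ≠ 0)
    (hj : x j ≠ 0) : (multiplier x)⁻¹ ^ 2 ≤ |x 0| ^ (-(3 / 4) : ℝ) * |x j| ^ (-(1 / 2) : ℝ) := by
  have hm := multiplier_pos x
  have h0' := abs_pos.2 h0
  have hj' := abs_pos.2 hj
  have h1 : |x j| ≤ multiplier x := (abs_apply_le_norm x j).trans (norm_le_multiplier x)
  calc (multiplier x)⁻¹ ^ 2
      = (multiplier x ^ 2) ^ (-(3 / 4) : ℝ) * multiplier x ^ (-(1 / 2) : ℝ) := by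
        rw [← Real.rpow_natCast, ← Real.rpow_natCast, ← Real.rpow_mul hm.le,
          ← Real.rpow_add hm, Real.inv_rpow hm.le, ← Real.rpow_neg hm.le]
        norm_num
    _ ≤ _ := by
        refine mul_le_mul ?_ ?_ (by positivity) (by positivity)
        · exact Real.rpow_le_rpow_of_nonpos h0' (abs_apply_le_multiplier_sq x) (by norm_num)
        · exact Real.rpow_le_rpow_of_nonpos hj' h1 (by norm_num)

lemma integrable_weight_inv_sq_of_line {s : ℝ} (hs : (d : ℝ) / 2 < s) (hs1 : 1 ≤ s)
    (h0 : Γ 0 = .line) {j : Fin d} (hj0 : j ≠ 0) (hj : Γ j = .line) :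
    Integrable fun ξ : DualDomain Γ => (weight s (freqVec ξ))⁻¹ ^ 2 := by
  -- A product majorant on the unit ball: singular factors in the two line directions, and elsewhere
  -- `2/(1+t²)`, integrable and at least `1` for `|t| ≤ 1`.
  let g : (i : Fin d) → (Γ i).Dual → ℝ := fun i x =>
    if i = 0 then (Set.Icc (-1 : ℝ) 1).indicator (fun x => |x| ^ (-(3 / 4) : ℝ)) ((Γ i).freq x)
    else if i = j then
      (Set.Icc (-1 : ℝ) 1).indicator (fun x => |x| ^ (-(1 / 2) : ℝ)) ((Γ i).freq x)
    else 2 * (1 + (Γ i).freq x ^ 2) ^ (-1 : ℝ)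
  have hg : ∀ i, Integrable (g i) := fun i => by
    by_cases hi0 : i = 0
    · subst hi0
      simpa [g] using Factor.integrable_comp_freq_of_eq_line h0
        (integrable_indicator_abs_rpow (e := 3 / 4) (by norm_num))
    by_cases hij : i = j
    · subst hij
      simpa [g, hi0] using Factor.integrable_comp_freq_of_eq_line hj
        (integrable_indicator_abs_rpow (e := 1 / 2) (by norm_num))
    · have := ((Γ i).integrable_one_add_freq_sq_rpow (p := 1) (by norm_num)).const_mul 2
      simpa [g, hi0, hij] using this
  have hprod : Integrable fun ξ : DualDomain Γ => ∏ i, g i (ξ i) :=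
    Integrable.fintype_prod_dep (μ := fun i => (volume : Measure (Γ i).Dual)) hg
  refine (((integrable_bracket_rpow_sq (Γ := Γ) hs).const_mul 4).add hprod).mono' ?_ ?_
  · exact (((measurable_weight s).comp measurable_freqVec).inv.pow_const 2).aestronglyMeasurable
  filter_upwards [ae_freq_ne_zero h0, ae_freq_ne_zero hj] with ξ hξ0 hξj
  have hw := weight_pos s (freqVec ξ)
  have hb := bracket_pos (freqVec ξ)
  have hgn : ∀ i, 0 ≤ g i (ξ i) := fun i => by
    simp only [g]
    split_ifs
    · exact Set.indicator_nonneg (fun x _ => by positivity) _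
    · exact Set.indicator_nonneg (fun x _ => by positivity) _
    · positivity
  rw [Real.norm_of_nonneg (by positivity)]
  simp only [Pi.add_apply]
  rcases le_or_gt 1 ‖freqVec ξ‖ with h1 | h1
  · refine le_trans ?_ (le_add_of_nonneg_right (Finset.prod_nonneg fun i _ => hgn i))
    have h2 := le_weight (s := s) (mul_bracket_le_multiplier one_pos le_rfl h1)
    have h3 : (0 : ℝ) < 1 / 2 * bracket (freqVec ξ) ^ s := by positivity
    calc (weight s (freqVec ξ))⁻¹ ^ 2 ≤ (1 / 2 * bracket (freqVec ξ) ^ s)⁻¹ ^ 2 := by gcongr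
      _ = _ := by rw [mul_inv, mul_pow]; norm_num
  · refine le_trans ?_ (le_add_of_nonneg_left (by positivity))
    have hmem : ∀ i, (Γ i).freq (ξ i) ∈ Set.Icc (-1 : ℝ) 1 := fun i =>
      abs_le.1 ((abs_freq_le_norm ξ i).trans h1.le)
    calc (weight s (freqVec ξ))⁻¹ ^ 2 ≤ (multiplier (freqVec ξ))⁻¹ ^ 2 := by
          have := multiplier_pos (freqVec ξ)
          gcongr
          exact multiplier_le_weight hs1 _
      _ ≤ |(Γ 0).freq (ξ 0)| ^ (-(3 / 4) : ℝ) * |(Γ j).freq (ξ j)| ^ (-(1 / 2) : ℝ) :=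
          inv_multiplier_sq_le hξ0 hξj
      _ = g 0 (ξ 0) * g j (ξ j) := by
          simp only [g, if_true, if_neg hj0, Set.indicator_of_mem (hmem _)]
      _ = ∏ i ∈ {0, j}, g i (ξ i) := 
          (Finset.prod_pair (f := fun i => g i (ξ i)) hj0.symm).symm
      _ ≤ ∏ i, g i (ξ i) := by
          refine Finset.prod_le_prod_of_subset_of_one_le (Finset.subset_univ _)
            (fun i _ => hgn i) fun i _ hi => ?_
          simp only [Finset.mem_insert, Finset.mem_singleton, not_or] at hi
          simp only [g, if_neg hi.1, if_neg hi.2, Real.rpow_neg_one]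
          have h2 : (Γ i).freq (ξ i) ^ 2 ≤ 1 := by
            rw [← sq_abs]; exact pow_le_one₀ (abs_nonneg _) (abs_le.2 (hmem i))
          rw [← div_eq_mul_inv, le_div_iff₀ (by positivity)]
          linarith

end Weights

/-! ### Uniform square integrability of the low-frequency kernel. -/

section Kernel

variable {d : ℕ} {Γ : Fin d → Factor} [NeZero d]

/-- Split the square as `(|x₁|/|y₁|)(1/|y₁|)(|x₁|/|x|²)`: the first ratio is at most `2`, and `|x|²
≥ x₁² + x_j²`. The other coordinates enter through factors at least `1` on the unit ball, giving a
product structure. -/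
lemma lowKernel_sq_le {x y : EuclideanSpace ℝ (Fin d)} {j : Fin d} (hj0 : j ≠ 0) :
    lowKernel x y ^ 2 ≤ (if |x 0| ≤ 2 * |y 0| then 2 / |y 0| else 0) *
      (∏ i ∈ (Finset.univ.erase j).erase 0, 2 * (1 + x i ^ 2)⁻¹) *
        (|x 0| / (x 0 ^ 2 + x j ^ 2)) := by
  have hP : 0 ≤ ∏ i ∈ (Finset.univ.erase j).erase 0, 2 * (1 + x i ^ 2)⁻¹ :=
    Finset.prod_nonneg fun i _ => by positivity
  unfold lowKernel
  split_ifs with h h' h'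
  · have hP1 : 1 ≤ ∏ i ∈ (Finset.univ.erase j).erase 0, 2 * (1 + x i ^ 2)⁻¹ := by
      refine Finset.one_le_prod fun i _ => ?_
      have h2 : x i ^ 2 ≤ 1 := by
        rw [← sq_abs]
        exact pow_le_one₀ (abs_nonneg _) ((abs_apply_le_norm x i).trans h.1.le)
      rw [← div_eq_mul_inv, le_div_iff₀ (by positivity)]
      linarith
    rcases eq_or_ne (x 0) 0 with h0 | h0
    · simp [h0]
    have h0' : 0 < |x 0| := abs_pos.2 h0
    have hy : 0 < |y 0| := by linarith
    have hD : x 0 ^ 2 + x j ^ 2 ≤ ‖x‖ ^ 2 := by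
      rw [EuclideanSpace.norm_sq_eq, ← Finset.sum_pair (f := fun i => x i ^ 2) hj0.symm]
      simp only [Real.norm_eq_abs, sq_abs]
      exact Finset.sum_le_sum_of_subset_of_nonneg (Finset.subset_univ _)
        fun i _ _ => sq_nonneg _
    have hD0 : 0 < x 0 ^ 2 + x j ^ 2 := by positivity
    calc (|x 0| / (‖x‖ * |y 0|)) ^ 2
        = |x 0| / |y 0| * (1 / |y 0|) * (|x 0| / ‖x‖ ^ 2) := by
          rw [div_pow, mul_pow]; field_simp
      _ ≤ 2 * (1 / |y 0|) * (|x 0| / (x 0 ^ 2 + x j ^ 2)) := by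
          gcongr
          rw [div_le_iff₀ hy]; exact h.2
      _ = 2 / |y 0| * 1 * (|x 0| / (x 0 ^ 2 + x j ^ 2)) := by ring
      _ ≤ _ := by gcongr
  · exact absurd h.2 h'
  · rw [zero_pow two_ne_zero]; positivity
  · simp

lemma measurable_lowKernel_freqVec : Measurable fun p : DualDomain Γ × DualDomain Γ =>
    lowKernel (freqVec p.1) (freqVec p.2) := by
  have h1 : Measurable fun p : DualDomain Γ × DualDomain Γ => freqVec p.1 :=
    measurable_freqVec.comp measurable_fst
  have h2 : Measurable fun p : DualDomain Γ × DualDomain Γ => freqVec p.2 :=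
    measurable_freqVec.comp measurable_snd
  exact Measurable.comp (f := fun p : DualDomain Γ × DualDomain Γ => (freqVec p.1, freqVec p.2))
    measurable_lowKernel (h1.prodMk h2)

lemma exists_lintegral_lowKernel_sq_le (h0 : Γ 0 = .line) {j : Fin d} (hj0 : j ≠ 0)
    (hj : Γ j = .line) : ∃ M : ENNReal, M ≠ ⊤ ∧ ∀ η : DualDomain Γ,
      ∫⁻ ξ : DualDomain Γ, ENNReal.ofReal (lowKernel (freqVec ξ) (freqVec η)) ^ 2 ≤ M := by
  let b : Fin d → ℝ := fun i => ∫ x : (Γ i).Dual, 2 * (1 + (Γ i).freq x ^ 2)⁻¹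
  -- The `8` is the height `2/a` times the length `4a` of the interval `|ξ₁| ≤ 2a`; for `a = 0`
  -- division by zero gives height `0`.
  refine ⟨ENNReal.ofReal (8 * ∏ i ∈ Finset.univ.erase 0, b i), ENNReal.ofReal_ne_top,
    fun η => ?_⟩
  let a : ℝ := |(Γ 0).freq (η 0)|
  have ha : 0 ≤ a := abs_nonneg _
  let g : (i : Fin d) → (Γ i).Dual → ℝ := fun i x =>
    if i = 0 then (if |(Γ i).freq x| ≤ 2 * a then 2 / a else 0)
    else 2 * (1 + (Γ i).freq x ^ 2)⁻¹
  have hgn : ∀ i x, 0 ≤ g i x := fun i x => by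
    simp only [g]; split_ifs <;> positivity
  have e0 : ∀ x : ℝ, (if |x| ≤ 2 * a then 2 / a else 0) =
      (Set.Icc (-(2 * a)) (2 * a)).indicator (fun _ => 2 / a) x := fun x => by
    simp only [Set.indicator_apply, Set.mem_Icc, abs_le]
  have hi0 : Integrable fun x : ℝ => if |x| ≤ 2 * a then 2 / a else 0 := by
    simp_rw [e0]
    exact (integrable_indicator_iff measurableSet_Icc).2 (integrableOn_const (by simp))
  have hg : ∀ i, Integrable (g i) := fun i => by
    by_cases hi : i = 0
    · subst hi
      simpa [g] using Factor.integrable_comp_freq_of_eq_line h0 hi0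
    · have := ((Γ i).integrable_one_add_freq_sq_rpow (p := 1) (by norm_num)).const_mul 2
      simpa [g, hi, Real.rpow_neg_one] using this
  have hprod : Integrable fun ξ : DualDomain Γ => ∏ i, g i (ξ i) :=
    Integrable.fintype_prod_dep (μ := fun i => (volume : Measure (Γ i).Dual)) hg
  have h_int0 : ∫ x, g 0 x ≤ 8 := by
    have : ∫ x, g 0 x = ∫ x : ℝ, if |x| ≤ 2 * a then 2 / a else 0 := by
      rw [← Factor.integral_comp_freq_of_eq_line h0]
      simp only [g, if_true]
    rw [this]
    simp_rw [e0]
    rw [integral_indicator measurableSet_Icc]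
    simp only [integral_const, MeasurableSet.univ, measureReal_restrict_apply, Set.univ_inter,
      Real.volume_real_Icc, smul_eq_mul]
    rw [max_eq_left (by linarith)]
    rcases ha.eq_or_lt with h | h
    · rw [← h]; norm_num
    · field_simp; norm_num
  have hgm : Measurable fun ξ : DualDomain Γ => ∏ i, g i (ξ i) := by
    refine Finset.measurable_fun_prod _ fun i _ => ?_
    have hf : Measurable fun ξ : DualDomain Γ => (Γ i).freq (ξ i) :=
      (Γ i).continuous_freq.measurable.comp (measurable_pi_apply i)
    by_cases hi : i = 0
    · simp only [g, if_pos hi]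
      exact Measurable.ite (measurableSet_le hf.abs measurable_const) measurable_const
        measurable_const
    · simp only [g, if_neg hi]
      fun_prop
  have hkm : Measurable fun ξ : DualDomain Γ =>
      ENNReal.ofReal (lowKernel (freqVec ξ) (freqVec η)) ^ 2 :=
    (measurable_lowKernel.comp (measurable_freqVec.prodMk measurable_const)).ennreal_ofReal.pow_const 2
  have hmain : ∫⁻ ξ : DualDomain Γ, ENNReal.ofReal (lowKernel (freqVec ξ) (freqVec η)) ^ 2 ≤
      ∫⁻ ξ : DualDomain Γ, ENNReal.ofReal (∏ i, g i (ξ i)) := by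
    -- Integrate in `ξ_j` first: the kernel has no product majorant pointwise, but its `j`-marginal
    -- is bounded by that of the product of the `g i`.
    refine lintegral_le_of_lmarginal_le (μ := fun i => (volume : Measure (Γ i).Dual)) {j} hkm
      hgm.ennreal_ofReal ?_
    rw [lmarginal_singleton, lmarginal_singleton]
    intro ξ
    have hQ : 0 ≤ ∏ i ∈ Finset.univ.erase j, g i (ξ i) := Finset.prod_nonneg fun i _ => hgn i _
    have hupd : ∀ (y : (Γ j).Dual) (i : Fin d), i ≠ j → Function.update ξ j y i = ξ i :=
      fun y i hi => Function.update_of_ne hi _ _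
    have hQe : ∏ i ∈ Finset.univ.erase j, g i (ξ i) =
        (if |(Γ 0).freq (ξ 0)| ≤ 2 * a then 2 / a else 0) *
          ∏ i ∈ (Finset.univ.erase j).erase 0, 2 * (1 + (Γ i).freq (ξ i) ^ 2)⁻¹ := by
      rw [← Finset.mul_prod_erase _ _ (Finset.mem_erase.2 ⟨hj0.symm, Finset.mem_univ 0⟩)]
      refine congrArg₂ _ (if_pos rfl) (Finset.prod_congr rfl fun i hi => ?_)
      exact if_neg (Finset.ne_of_mem_erase hi)
    calc ∫⁻ y, ENNReal.ofReal (lowKernel (freqVec (Function.update ξ j y)) (freqVec η)) ^ 2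
        ≤ ∫⁻ y : (Γ j).Dual, ENNReal.ofReal (∏ i ∈ Finset.univ.erase j, g i (ξ i)) *
          ENNReal.ofReal (|(Γ 0).freq (ξ 0)| /
            ((Γ 0).freq (ξ 0) ^ 2 + (Γ j).freq y ^ 2)) := by
          refine lintegral_mono fun y => ?_
          rw [← ENNReal.ofReal_pow (lowKernel_nonneg _ _), ← ENNReal.ofReal_mul hQ, hQe]
          refine ENNReal.ofReal_le_ofReal ((lowKernel_sq_le hj0).trans_eq ?_)
          simp only [freqVec_apply, hupd y 0 hj0.symm, Function.update_self]
          congr 2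
          refine Finset.prod_congr rfl fun i hi => ?_
          rw [hupd y i (Finset.ne_of_mem_erase (Finset.mem_of_mem_erase hi))]
      _ = ENNReal.ofReal (∏ i ∈ Finset.univ.erase j, g i (ξ i)) * ∫⁻ y : ℝ,
          ENNReal.ofReal (|(Γ 0).freq (ξ 0)| / ((Γ 0).freq (ξ 0) ^ 2 + y ^ 2)) := by
          rw [lintegral_const_mul' _ _ ENNReal.ofReal_ne_top,
            ← Factor.lintegral_comp_freq_of_eq_line hj]
      _ ≤ ENNReal.ofReal (∏ i ∈ Finset.univ.erase j, g i (ξ i)) *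
          ∫⁻ y : ℝ, ENNReal.ofReal (1 + y ^ 2)⁻¹ := by
          exact mul_le_mul_right (lintegral_abs_div_sq_add_sq_le _) _
      _ = ∫⁻ y : (Γ j).Dual, ENNReal.ofReal (∏ i ∈ Finset.univ.erase j, g i (ξ i)) *
          ENNReal.ofReal (1 + (Γ j).freq y ^ 2)⁻¹ := by
          rw [lintegral_const_mul' _ _ ENNReal.ofReal_ne_top,
            ← Factor.lintegral_comp_freq_of_eq_line hj]
      _ ≤ ∫⁻ y, ENNReal.ofReal (∏ i, g i (Function.update ξ j y i)) := by
          refine lintegral_mono fun y => ?_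
          rw [← ENNReal.ofReal_mul hQ, ← Finset.prod_erase_mul _ _ (Finset.mem_univ j),
            Function.update_self]
          refine ENNReal.ofReal_le_ofReal ?_
          have h1 : ∏ i ∈ Finset.univ.erase j, g i (Function.update ξ j y i) =
              ∏ i ∈ Finset.univ.erase j, g i (ξ i) :=
            Finset.prod_congr rfl fun i hi => by rw [hupd y i (Finset.ne_of_mem_erase hi)]
          rw [h1]
          refine mul_le_mul_of_nonneg_left ?_ hQ
          simp only [g, if_neg hj0]
          have : 0 ≤ (1 + (Γ j).freq y ^ 2)⁻¹ := by positivity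
          linarith
  refine hmain.trans ?_
  rw [← ofReal_integral_eq_lintegral_ofReal hprod
    (Filter.Eventually.of_forall fun ξ => Finset.prod_nonneg fun i _ => hgn i _),
    integral_fintype_prod_volume_eq_prod, ← Finset.mul_prod_erase _ _ (Finset.mem_univ 0)]
  refine ENNReal.ofReal_le_ofReal ?_
  have hb : ∀ i ∈ Finset.univ.erase (0 : Fin d), ∫ x, g i x = b i := fun i hi => by
    simp only [g, b, if_neg (Finset.ne_of_mem_erase hi)]
  rw [Finset.prod_congr rfl hb]
  exact mul_le_mul_of_nonneg_right h_int0
    (Finset.prod_nonneg fun i _ => integral_nonneg fun x => by positivity)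

end Kernel

/-! ### The two geometric cases of an admissible domain. -/

section Weights

variable {d : ℕ} {Γ : Fin d → Factor} [NeZero d]

/-- The weight on the dual group, with values in `[0, ∞]`. -/
def dualWeight (s : ℝ) (ξ : DualDomain Γ) : ENNReal := ENNReal.ofReal (weight s (freqVec ξ))

lemma measurable_dualWeight (s : ℝ) : Measurable (dualWeight (Γ := Γ) s) :=
  ((measurable_weight s).comp measurable_freqVec).ennreal_ofReal

lemma dualWeight_ne_zero (s : ℝ) (ξ : DualDomain Γ) : dualWeight s ξ ≠ 0 :=
  (ENNReal.ofReal_pos.2 (weight_pos s _)).ne'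

lemma dualWeight_ne_top (s : ℝ) (ξ : DualDomain Γ) : dualWeight s ξ ≠ ⊤ :=
  ENNReal.ofReal_ne_top

/-- Transverse frequencies are discrete, so a small nonzero frequency lies on the first axis and has
`|ξ₁|/|ξ| = 1`. The weight is then comparable to the ordinary Sobolev weight. -/
lemma exists_mul_bracket_le_multiplier (h : ∀ i ≠ 0, Γ i ≠ .line) :
    ∃ c > 0, ∀ ξ : DualDomain Γ, c * bracket (freqVec ξ) ≤ multiplier (freqVec ξ) := by
  have hδ : ∀ i : Fin d, ∃ δ > 0, i ≠ 0 → ∀ x : (Γ i).Dual, (Γ i).freq x ≠ 0 →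
      δ ≤ |(Γ i).freq x| := fun i => by
    by_cases hi : i = 0
    · exact ⟨1, one_pos, fun h => absurd hi h⟩
    · obtain ⟨δ, h1, h2⟩ := Factor.exists_le_abs_freq (h i hi)
      exact ⟨δ, h1, fun _ => h2⟩
  choose δ hδ0 hδ using hδ
  obtain ⟨i₀, hi₀⟩ := Finite.exists_min δ
  have hm : 0 < min 1 (δ i₀) := lt_min one_pos (hδ0 i₀)
  refine ⟨min 1 (δ i₀) / 2, by positivity, fun ξ => ?_⟩
  rcases le_or_gt (min 1 (δ i₀)) ‖freqVec ξ‖ with hξ | hξ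
  · exact mul_bracket_le_multiplier hm (min_le_left _ _) hξ
  have hb : bracket (freqVec ξ) ≤ 1 + ‖freqVec ξ‖ := bracket_le_one_add_norm _
  have hc : min 1 (δ i₀) / 2 ≤ 1 := by linarith [min_le_left 1 (δ i₀)]
  have hle : min 1 (δ i₀) / 2 * bracket (freqVec ξ) ≤ 1 + ‖freqVec ξ‖ :=
    (mul_le_of_le_one_left (bracket_pos _).le hc).trans hb
  refine hle.trans ?_
  unfold multiplier
  split_ifs with h0
  · simp [h0]
  · have hz : ∀ i ≠ 0, freqVec ξ i = 0 := fun i hi => by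
      by_contra hne
      have h1 := hδ i hi (ξ i) hne
      have h2 := abs_freq_le_norm ξ i
      linarith [hi₀ i, min_le_right 1 (δ i₀)]
    have hn : ‖freqVec ξ‖ = |freqVec ξ 0| := by
      rw [EuclideanSpace.norm_eq, Finset.sum_eq_single 0 (fun i _ hi => by simp [hz i hi])
        (by simp)]
      simp [Real.sqrt_sq_eq_abs]
    have hn0 : ‖freqVec ξ‖ ≠ 0 := norm_ne_zero_iff.2 h0
    rw [← hn, div_self hn0]

lemma lintegral_inv_dualWeight_sq_ne_top {s : ℝ}
    (h : Integrable fun ξ : DualDomain Γ => (weight s (freqVec ξ))⁻¹ ^ 2) :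
    ∫⁻ ξ : DualDomain Γ, (dualWeight s ξ)⁻¹ ^ 2 ≠ ⊤ := by
  have e : ∀ ξ : DualDomain Γ, (dualWeight s ξ)⁻¹ ^ 2 =
      ENNReal.ofReal ((weight s (freqVec ξ))⁻¹ ^ 2) := fun ξ => by
    rw [ENNReal.ofReal_pow (inv_nonneg.2 (weight_pos _ _).le),
      ENNReal.ofReal_inv_of_pos (weight_pos _ _), dualWeight]
  simp_rw [e]
  exact h.lintegral_lt_top.ne

/-- For `s > d/2` the weighted `L²` space is contained in `L¹` and is a convolution algebra. -/
lemma dualWeight_bounds (hΓ : Admissible Γ) {s : ℝ} (hs : (d : ℝ) / 2 < s) :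
    ∫⁻ ξ : DualDomain Γ, (dualWeight s ξ)⁻¹ ^ 2 ≠ ⊤ ∧
    ∃ K : ENNReal, K ≠ ⊤ ∧ ∀ f g : DualDomain Γ → ENNReal, Measurable f → Measurable g →
      ∫⁻ ξ, (dualWeight s ξ * ∫⁻ η, f (ξ - η) * g η) ^ 2 ≤
        K * ((∫⁻ ξ, (dualWeight s ξ * f ξ) ^ 2) * ∫⁻ ξ, (dualWeight s ξ * g ξ) ^ 2) := by
  have hd1 : (1 : ℝ) ≤ d := by exact_mod_cast Nat.one_le_iff_ne_zero.2 (NeZero.ne d)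
  have hs0 : 0 ≤ s := by linarith
  -- It remains to exhibit a real kernel `κ`; the passage to `[0, ∞]`-valued functions and the
  -- convolution estimate are uniform in the two cases.
  suffices h : Integrable (fun ξ : DualDomain Γ => (weight s (freqVec ξ))⁻¹ ^ 2) ∧
      ∃ (C : ℝ) (M : ENNReal) (κ : DualDomain Γ → DualDomain Γ → ℝ), 0 ≤ C ∧ M ≠ ⊤ ∧
        (∀ ξ η, 0 ≤ κ ξ η) ∧ (Measurable fun p : DualDomain Γ × DualDomain Γ => κ p.1 p.2) ∧
        (∀ η, ∫⁻ ξ, ENNReal.ofReal (κ ξ η) ^ 2 ≤ M) ∧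
        ∀ᵐ ξ : DualDomain Γ, ∀ η, weight s (freqVec ξ) ≤ C * (weight s (freqVec (ξ - η)) +
          weight s (freqVec η) + weight s (freqVec (ξ - η)) * weight s (freqVec η) *
            (κ ξ (ξ - η) + κ ξ η)) by
    obtain ⟨hi, C, M, κ, hC, hM, hκ0, hκ, hκM, hW⟩ := h
    have hi' := lintegral_inv_dualWeight_sq_ne_top hi
    refine ⟨hi', 8 * ENNReal.ofReal C ^ 2 * ((∫⁻ ξ : DualDomain Γ, (dualWeight s ξ)⁻¹ ^ 2) + M),
      ?_, fun f g hf hg => ?_⟩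
    · exact ENNReal.mul_ne_top (ENNReal.mul_ne_top (by norm_num)
        (ENNReal.pow_ne_top ENNReal.ofReal_ne_top)) (ENNReal.add_ne_top.2 ⟨hi', hM⟩)
    refine lintegral_weighted_conv_sq_le (measurable_dualWeight s) (dualWeight_ne_zero s)
      (dualWeight_ne_top s) hκ.ennreal_ofReal hκM ?_ hf hg
    filter_upwards [hW] with ξ hξ η
    have h1 := (weight_pos s (freqVec (ξ - η))).le
    have h2 := (weight_pos s (freqVec η)).le
    unfold dualWeight
    rw [← ENNReal.ofReal_add h1 h2, ← ENNReal.ofReal_mul h1,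
      ← ENNReal.ofReal_add (hκ0 _ _) (hκ0 _ _), ← ENNReal.ofReal_mul (mul_nonneg h1 h2),
      ← ENNReal.ofReal_add (add_nonneg h1 h2)
        (mul_nonneg (mul_nonneg h1 h2) (add_nonneg (hκ0 _ _) (hκ0 _ _))),
      ← ENNReal.ofReal_mul hC]
    exact ENNReal.ofReal_le_ofReal (hξ η)
  have hsub : ∀ ξ η : DualDomain Γ, freqVec ξ = freqVec (ξ - η) + freqVec η := fun ξ η => by
    rw [← freqVec_add, sub_add_cancel]
  by_cases h : ∀ i ≠ 0, Γ i ≠ .line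
  · obtain ⟨c, hc, hm⟩ := exists_mul_bracket_le_multiplier h
    refine ⟨integrable_weight_inv_sq_of_le hs hc hm, 2 * 2 ^ s / c, 0, fun _ _ => 0,
      by positivity, by simp, fun _ _ => le_rfl, measurable_const, fun η => by simp,
      Filter.Eventually.of_forall fun ξ η => ?_⟩
    rw [hsub ξ η, add_zero, mul_zero, add_zero]
    exact weight_add_le hs0 hc (fun _ => hm _) fun _ => hm _
  · push Not at h
    obtain ⟨j, hj0, hj⟩ := h
    -- A transverse line excludes the all-circle alternative, so the first factor is a line. This
    -- makes `ξ₁ = 0` a null set and gives room to integrate in `ξ₁`.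
    have h0 : Γ 0 = .line := hΓ.resolve_right fun h => h j hj
    have hd2 : 2 ≤ d := by
      have h1 := j.2
      have h2 : (j : ℕ) ≠ 0 := fun h => hj0 (Fin.ext (by simpa using h))
      omega
    have hs1 : 1 ≤ s := by
      have : (2 : ℝ) ≤ d := by exact_mod_cast hd2
      linarith
    obtain ⟨M, hM, hκM⟩ := exists_lintegral_lowKernel_sq_le h0 hj0 hj
    refine ⟨integrable_weight_inv_sq_of_line hs hs1 h0 hj0 hj, 8 * 2 ^ s, M,
      fun ξ η => lowKernel (freqVec ξ) (freqVec η), by positivity, hM,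
      fun _ _ => lowKernel_nonneg _ _, ?_, hκM, ?_⟩
    · exact measurable_lowKernel_freqVec
    -- Discarding `ξ₁ = 0` excludes `ξ = 0`, where the multiplier has the special value `1`.
    filter_upwards [ae_freq_ne_zero h0] with ξ hξ η
    have hne : freqVec (ξ - η) + freqVec η ≠ 0 := fun hz => hξ <| by
      rw [← hsub] at hz
      rw [← freqVec_apply, hz]; rfl
    have := weight_add_le_lowKernel hs1 hne
    rwa [← hsub] at this

end Weights

/-! ### Products of functions and the algebra property. -/

section Product

variable {d : ℕ} {Γ : Fin d → Factor}

/-- The Fourier transform of the product of two functions whose Fourier transforms are `F`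
and `G`. -/
def fourierProduct (F G : DualDomain Γ → ℂ) (ξ : DualDomain Γ) : ℂ :=
  normConst Γ * ∫ η, F η * G (ξ - η)

lemma integrable_mul_conj_character {F : DualDomain Γ → ℂ} (hF : Integrable F) (x : Domain Γ) :
    Integrable fun ξ => F ξ * starRingEnd ℂ (character ξ x) :=
  hF.mul_bdd (c := 1)
    (Complex.continuous_conj.comp (continuous_character_left x)).aestronglyMeasurable
    (Filter.Eventually.of_forall fun ξ => (norm_conj_character ξ x).le)

lemma integrable_fourierProduct {F G : DualDomain Γ → ℂ} (hF : Integrable F)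
    (hG : Integrable G) : Integrable (fourierProduct F G) :=
  (hF.integrable_convolution (ContinuousLinearMap.mul ℝ ℂ) hG).const_mul _

/-- Characters are multiplicative, so the modulated convolution is the convolution of the modulated
functions, whose integral factors. The extra normalization in `fourierProduct` matches the two in
the product. -/
lemma synthesis_fourierProduct {F G : DualDomain Γ → ℂ} (hF : Integrable F) (hG : Integrable G)
    (x : Domain Γ) : synthesis (fourierProduct F G) x = synthesis F x * synthesis G x := by
  have h := integral_convolution (ContinuousLinearMap.mul ℝ ℂ)
    (integrable_mul_conj_character hF x) (integrable_mul_conj_character hG x)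
  have e : ∀ ξ, fourierProduct F G ξ * starRingEnd ℂ (character ξ x) = normConst Γ *
      ∫ η, F η * starRingEnd ℂ (character η x) *
        (G (ξ - η) * starRingEnd ℂ (character (ξ - η) x)) := fun ξ => by
    rw [fourierProduct, mul_assoc, ← integral_mul_const]
    congr 1
    refine integral_congr_ae (Filter.Eventually.of_forall fun η => ?_)
    have hc : character ξ x = character η x * character (ξ - η) x := by
      rw [← character_add_left, add_sub_cancel]
    simp only [hc, map_mul]
    ring
  simp only [convolution, ContinuousLinearMap.mul_apply'] at h
  simp only [synthesis, e]
  rw [integral_const_mul, h]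
  ring

lemma conj_eq_of_isReal {T : Distribution Γ} {f : Domain Γ →ᵇ ℂ} (hT : IsReal T)
    (h : Represents T f) (x : Domain Γ) : starRingEnd ℂ (f x) = f x := by
  have key : star f = f := by
    refine eq_of_forall_integral_eq _ _ fun ψ => ?_
    rw [← (h ψ).2, hT ψ, (h _).2, ← integral_conj]
    refine integral_congr_ae (Filter.Eventually.of_forall fun x => ?_)
    simp [conjSchwartz]
  exact DFunLike.congr_fun key x

lemma isReal_of_conj_eq {T : Distribution Γ} {f : Domain Γ → ℂ} (h : Represents T f)
    (hf : ∀ x, starRingEnd ℂ (f x) = f x) : IsReal T := fun ψ => by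
  rw [(h ψ).2, (h _).2, ← integral_conj]
  refine integral_congr_ae (Filter.Eventually.of_forall fun x => ?_)
  simp [conjSchwartz, hf x]

lemma exists_hasFourier_fourierProduct {F G : DualDomain Γ → ℂ} (hF : Integrable F)
    (hG : Integrable G) : ∃ T : Distribution Γ, HasFourier T (fourierProduct F G) ∧
      Represents T (synthesis F * synthesis G) := by
  obtain ⟨T, hT⟩ := exists_represents (synthesisBCF (integrable_fourierProduct hF hG))
  have hT' : Represents T (synthesis (fourierProduct F G)) := hT
  refine ⟨T, hT'.hasFourier (integrable_fourierProduct hF hG), ?_⟩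
  have e : synthesis (fourierProduct F G) = synthesis F * synthesis G :=
    funext fun x => synthesis_fourierProduct hF hG x
  rwa [e] at hT'

variable [NeZero d]

lemma enorm_weighted (s : ℝ) (F : DualDomain Γ → ℂ) (ξ : DualDomain Γ) :
    ‖weighted s F ξ‖ₑ = dualWeight s ξ * ‖F ξ‖ₑ := by
  rw [weighted, enorm_mul, dualWeight, ← ofReal_norm (weight s (freqVec ξ) : ℂ),
    Complex.norm_real, Real.norm_of_nonneg (weight_pos s _).le]

lemma eLpNorm_weighted_sq (s : ℝ) (F : DualDomain Γ → ℂ) :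
    eLpNorm (weighted s F) 2 ^ 2 = ∫⁻ ξ, (dualWeight s ξ * ‖F ξ‖ₑ) ^ 2 := by
  have h := eLpNorm_nnreal_pow_eq_lintegral (f := weighted s F) (p := 2) (μ := volume) two_ne_zero
  simpa only [enorm_weighted, NNReal.coe_ofNat, ENNReal.rpow_two, ENNReal.coe_ofNat] using h

lemma aestronglyMeasurable_weighted {s : ℝ} {F : DualDomain Γ → ℂ}
    (hF : AEStronglyMeasurable F) : AEStronglyMeasurable (weighted s F) :=
  (Complex.measurable_ofReal.comp
    ((measurable_weight s).comp measurable_freqVec)).aestronglyMeasurable.mul hF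

/-- Cauchy–Schwarz applied to `|F| = W⁻¹ · W|F|`. -/
lemma integrable_of_memLp_weighted {s : ℝ} {F : DualDomain Γ → ℂ}
    (hs : ∫⁻ ξ : DualDomain Γ, (dualWeight s ξ)⁻¹ ^ 2 ≠ ⊤) (hF : AEStronglyMeasurable F)
    (h : MemLp (weighted s F) 2) : Integrable F := by
  refine ⟨hF, ?_⟩
  have hW := measurable_dualWeight (Γ := Γ) s
  have h1 := lintegral_mul_sq_le (μ := volume) (f := fun ξ => (dualWeight s ξ)⁻¹)
    (g := fun ξ => dualWeight s ξ * ‖F ξ‖ₑ) hW.inv.aemeasurable (hW.aemeasurable.mul hF.enorm)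
  have e : ∀ ξ, (dualWeight s ξ)⁻¹ * (dualWeight s ξ * ‖F ξ‖ₑ) = ‖F ξ‖ₑ := fun ξ => by
    rw [← mul_assoc, ENNReal.inv_mul_cancel (dualWeight_ne_zero s ξ) (dualWeight_ne_top s ξ),
      one_mul]
  simp only [e] at h1
  rw [← eLpNorm_weighted_sq] at h1
  have h2 := h1.trans_lt (ENNReal.mul_lt_top hs.lt_top (ENNReal.pow_lt_top h.eLpNorm_lt_top))
  exact (ENNReal.pow_lt_top_iff.1 h2).resolve_right two_ne_zero

lemma lintegral_weighted_fourierProduct_sq_le {s : ℝ} {K : ENNReal}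
    (hK : ∀ f g : DualDomain Γ → ENNReal, Measurable f → Measurable g →
      ∫⁻ ξ, (dualWeight s ξ * ∫⁻ η, f (ξ - η) * g η) ^ 2 ≤
        K * ((∫⁻ ξ, (dualWeight s ξ * f ξ) ^ 2) * ∫⁻ ξ, (dualWeight s ξ * g ξ) ^ 2))
    {F G : DualDomain Γ → ℂ} (hF : AEStronglyMeasurable F) (hG : AEStronglyMeasurable G) :
    eLpNorm (weighted s (fourierProduct F G)) 2 ^ 2 ≤ ‖normConst Γ‖ₑ ^ 2 * K *
      (eLpNorm (weighted s F) 2 ^ 2 * eLpNorm (weighted s G) 2 ^ 2) := by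
  have hf := hF.enorm
  have hg := hG.enorm
  -- The convolution bound is for measurable functions; since `η ↦ ξ - η` preserves null sets,
  -- measurable modifications do not change the inner integral.
  have hgq : ∀ ξ : DualDomain Γ, (fun η => ‖G (ξ - η)‖ₑ) =ᵐ[volume] fun η => hg.mk _ (ξ - η) :=
    fun ξ => (quasiMeasurePreserving_sub_left volume ξ).ae_eq hg.ae_eq_mk
  have hmk : ∀ {f : DualDomain Γ → ENNReal} (hf : AEMeasurable f),
      ∫⁻ ξ, (dualWeight s ξ * hf.mk f ξ) ^ 2 = ∫⁻ ξ, (dualWeight s ξ * f ξ) ^ 2 := fun hf => by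
    refine lintegral_congr_ae ?_
    filter_upwards [hf.ae_eq_mk] with ξ hξ
    rw [hξ]
  simp only [eLpNorm_weighted_sq]
  calc ∫⁻ ξ, (dualWeight s ξ * ‖fourierProduct F G ξ‖ₑ) ^ 2
      ≤ ∫⁻ ξ, ‖normConst Γ‖ₑ ^ 2 *
        (dualWeight s ξ * ∫⁻ η, hg.mk _ (ξ - η) * hf.mk _ η) ^ 2 := by
        refine lintegral_mono fun ξ => ?_
        rw [← mul_pow, fourierProduct, enorm_mul, mul_left_comm]
        refine pow_le_pow_left' ?_ 2
        gcongr
        refine (enorm_integral_le_lintegral_enorm _).trans_eq ?_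
        refine lintegral_congr_ae ?_
        filter_upwards [hgq ξ, hf.ae_eq_mk] with η h1 h2
        rw [enorm_mul, h1, h2, mul_comm]
    _ = ‖normConst Γ‖ₑ ^ 2 *
        ∫⁻ ξ, (dualWeight s ξ * ∫⁻ η, hg.mk _ (ξ - η) * hf.mk _ η) ^ 2 :=
        lintegral_const_mul' _ _ (ENNReal.pow_ne_top enorm_ne_top)
    _ ≤ ‖normConst Γ‖ₑ ^ 2 * (K * ((∫⁻ ξ, (dualWeight s ξ * hg.mk _ ξ) ^ 2) *
        ∫⁻ ξ, (dualWeight s ξ * hf.mk _ ξ) ^ 2)) := by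
        gcongr
        exact hK _ _ hg.measurable_mk hf.measurable_mk
    _ = _ := by
        rw [hmk, hmk]
        ring

lemma eLpNorm_weighted_fourierProduct_le {s : ℝ} {K : ENNReal}
    (hK : ∀ f g : DualDomain Γ → ENNReal, Measurable f → Measurable g →
      ∫⁻ ξ, (dualWeight s ξ * ∫⁻ η, f (ξ - η) * g η) ^ 2 ≤
        K * ((∫⁻ ξ, (dualWeight s ξ * f ξ) ^ 2) * ∫⁻ ξ, (dualWeight s ξ * g ξ) ^ 2))
    {F G : DualDomain Γ → ℂ} (hF : AEStronglyMeasurable F) (hG : AEStronglyMeasurable G) :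
    eLpNorm (weighted s (fourierProduct F G)) 2 ≤ ‖normConst Γ‖ₑ * K ^ (1 / 2 : ℝ) *
      (eLpNorm (weighted s F) 2 * eLpNorm (weighted s G) 2) := by
  have h := lintegral_weighted_fourierProduct_sq_le hK hF hG
  rw [← mul_pow] at h
  have e : K = (K ^ (1 / 2 : ℝ)) ^ 2 := by
    rw [← ENNReal.rpow_mul_natCast]; norm_num
  rw [e, ← mul_pow, ← mul_pow] at h
  exact (ENNReal.pow_le_pow_left_iff two_ne_zero).1 h

lemma xsNorm_eq {s : ℝ} {T : Distribution Γ} {F : DualDomain Γ → ℂ} (h : HasFourier T F) :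
    xsNorm s T = (eLpNorm (weighted s F) 2).toReal := by
  rw [xsNorm, eLpNorm_congr_ae]
  filter_upwards [h.fourierFun_ae_eq] with ξ hξ
  rw [weighted, weighted, hξ]

lemma exists_represents_of_mem_xsComplex (hΓ : Admissible Γ) {s : ℝ} (hs : (d : ℝ) / 2 < s)
    {T : Distribution Γ} (hT : T ∈ XsComplex Γ s) :
    ∃ F : DualDomain Γ → ℂ, Integrable F ∧ HasFourier T F ∧ MemLp (weighted s F) 2 ∧
      Represents T (synthesis F) := by
  obtain ⟨F, hF, hF2⟩ := hT
  have hFi := integrable_of_memLp_weighted (dualWeight_bounds hΓ hs).1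
    hF.locallyIntegrable.aestronglyMeasurable hF2
  exact ⟨F, hFi, hF, hF2, hF.represents hFi⟩

lemma exists_norm_fourierProduct_le (hΓ : Admissible Γ) {s : ℝ} (hs : (d : ℝ) / 2 < s) :
    ∃ C : ℝ, 0 < C ∧ ∀ F G : DualDomain Γ → ℂ, Integrable F → Integrable G →
      MemLp (weighted s F) 2 → MemLp (weighted s G) 2 →
        MemLp (weighted s (fourierProduct F G)) 2 ∧
        (eLpNorm (weighted s (fourierProduct F G)) 2).toReal ≤
          C * (eLpNorm (weighted s F) 2).toReal * (eLpNorm (weighted s G) 2).toReal := by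
  obtain ⟨K, hKt, hK⟩ := (dualWeight_bounds hΓ hs).2
  obtain ⟨A, hAe⟩ : ∃ A, A = ‖normConst Γ‖ₑ * K ^ (1 / 2 : ℝ) := ⟨_, rfl⟩
  have hA : A ≠ ⊤ := hAe ▸ ENNReal.mul_ne_top enorm_ne_top
    (ENNReal.rpow_ne_top_of_nonneg (by norm_num) hKt)
  -- Adding `1` ensures a strictly positive constant.
  refine ⟨A.toReal + 1, by positivity, fun F G hF hG hF2 hG2 => ?_⟩
  have hle := eLpNorm_weighted_fourierProduct_le hK hF.1 hG.1
  rw [← hAe] at hle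
  have hfin := ENNReal.mul_ne_top hA
    (ENNReal.mul_ne_top hF2.eLpNorm_lt_top.ne hG2.eLpNorm_lt_top.ne)
  refine ⟨⟨aestronglyMeasurable_weighted (integrable_fourierProduct hF hG).1,
    hle.trans_lt hfin.lt_top⟩, ?_⟩
  have h := ENNReal.toReal_mono hfin hle
  rw [ENNReal.toReal_mul, ENNReal.toReal_mul, ← mul_assoc] at h
  refine h.trans ?_
  gcongr
  linarith

lemma isPointwiseAlgebra_xsComplex (hΓ : Admissible Γ) {s : ℝ} (hs : (d : ℝ) / 2 < s) :
    IsPointwiseAlgebra s (XsComplex Γ s : Set (Distribution Γ)) := by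
  obtain ⟨C, hC, hle⟩ := exists_norm_fourierProduct_le hΓ hs
  refine ⟨fun T hT => ?_, C, hC, fun T₁ h₁ T₂ h₂ f₁ f₂ hf₁ hf₂ => ?_⟩
  · obtain ⟨F, hF, -, -, h⟩ := exists_represents_of_mem_xsComplex hΓ hs hT
    exact ⟨synthesisBCF hF, h⟩
  obtain ⟨F, hF, hTF, hF2, hRF⟩ := exists_represents_of_mem_xsComplex hΓ hs h₁
  obtain ⟨G, hG, hTG, hG2, hRG⟩ := exists_represents_of_mem_xsComplex hΓ hs h₂
  obtain ⟨T, hTH, hT⟩ := exists_hasFourier_fourierProduct hF hG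
  obtain ⟨hH2, hn⟩ := hle F G hF hG hF2 hG2
  -- The representing functions are arbitrary; uniqueness among bounded continuous ones identifies
  -- them with the syntheses.
  have e₁ : ⇑f₁ = synthesis F := congrArg DFunLike.coe (hf₁.unique (g := synthesisBCF hF) hRF)
  have e₂ : ⇑f₂ = synthesis G := congrArg DFunLike.coe (hf₂.unique (g := synthesisBCF hG) hRG)
  refine ⟨T, ⟨_, hTH, hH2⟩, ?_, ?_⟩
  · rwa [e₁, e₂]
  rwa [xsNorm_eq hTH, xsNorm_eq hTF, xsNorm_eq hTG]

lemma isPointwiseAlgebra_xsReal (hΓ : Admissible Γ) {s : ℝ} (hs : (d : ℝ) / 2 < s) :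
    IsPointwiseAlgebra s (XsReal Γ s : Set (Distribution Γ)) := by
  obtain ⟨h1, C, hC, h2⟩ := isPointwiseAlgebra_xsComplex hΓ hs
  refine ⟨fun T hT => h1 T hT.1, C, hC, fun T₁ h₁ T₂ h₂ f₁ f₂ hf₁ hf₂ => ?_⟩
  obtain ⟨T, hT, hTr, hn⟩ := h2 T₁ h₁.1 T₂ h₂.1 f₁ f₂ hf₁ hf₂
  refine ⟨T, ⟨hT, isReal_of_conj_eq hTr fun x => ?_⟩, hTr, hn⟩
  simp only [Pi.mul_apply, map_mul, conj_eq_of_isReal h₁.2 hf₁, conj_eq_of_isReal h₂.2 hf₂]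

end Product

end Aniso

end

theorem theorem1 (d : ℕ) [NeZero d] (Sig : Fin d → Aniso.Factor) (hSig : Aniso.Admissible Sig)
    (s : ℝ) (hs : (d : ℝ) / 2 < s) :
    Aniso.IsPointwiseAlgebra s (Aniso.XsComplex Sig s : Set (Aniso.Distribution Sig)) ∧
      Aniso.IsPointwiseAlgebra s (Aniso.XsReal Sig s : Set (Aniso.Distribution Sig)) := by
  exact ⟨Aniso.isPointwiseAlgebra_xsComplex hSig hs, Aniso.isPointwiseAlgebra_xsReal hSig hs⟩
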